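/- Let $\lambda>0$, $\mu>1$, $c>0$, $m\in(-1,1)$, and let $N=\{N_t;t\ge 0\}$ be a homogeneous Poisson process with rate $\mu$ on a probability space $(\Omega,\mathcal H,\mathbb P_0)$, with jump times $\sigma_1\le\sigma_2\le\cdots$. Let $\mathbb F$ be its natural filtration, enlarged by the $\mathbb P_0$-null sets and made right-continuous, and let $\mathcal S$ be the set of $\mathbb F$-stopping times with values in $[0,\infty]$. For $(\phi_0,\phi_1)\in\mathbb R_+^2$ let $\tilde\Phi=(\tilde\Phi^{(0)},\tilde\Phi^{(1)})$ be the solution of $$d\tilde\Phi^{(0)}_t=\Big[(\lambda+1)\tilde\Phi^{(0)}_t+\tfrac{\lambda(1-m)}{\sqrt2}\Big]dt-\tfrac1\mu\tilde\Phi^{(0)}_{t-}\,dN_t,\qquad d\tilde\Phi^{(1)}_t=\Big[(\lambda-1)\tilde\Phi^{(1)}_t+\tfrac{\lambda(1+m)}{\sqrt2}\Big]dt+\tfrac1\mu\tilde\Phi^{(1)}_{t-}\,dN_t,$$ $\tilde\Phi_0=(\phi_0,\phi_1)$, and write $\mathbb E_0^{\phi_0,\phi_1}$ for the expectation when $\tilde\Phi$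 starts at $(\phi_0,\phi_1)$. Let $x(t,\phi_0)$, $y(t,\phi_1)$, $t\in\mathbb R$, be the solutions of $x'=(\lambda+1)x+\lambda(1-m)/\sqrt2$, $x(0,\phi_0)=\phi_0$, and $y'=(\lambda-1)y+\lambda(1+m)/\sqrt2$, $y(0,\phi_1)=\phi_1$. Put $g(\phi_0,\phi_1)=\phi_0+\phi_1-\frac{\lambda}{c}\sqrt2$ and $$V(\phi_0,\phi_1)=\inf_{\tau\in\mathcal S}\mathbb E_0^{\phi_0,\phi_1}\Big[\int_0^\tau e^{-\lambda t}g(\tilde\Phi_t)\,dt\Big].$$ Let $v_0\equiv0$ and, for $n\ge1$, $$v_n(\phi_0,\phi_1)=\inf_{t\in[0,\infty]}\mathbb E_0^{\phi_0,\phi_1}\Big[\int_0^{t\wedge\sigma_1}e^{-\lambda u}g(\tilde\Phi_u)\,du+\mathbf 1_{\{t\ge\sigma_1\}}e^{-\lambda\sigma_1}v_{n-1}(\tilde\Phi_{\sigma_1})\Big].$$ Let $\Gamma_n=\{v_n=0\}$, $n\ge1$, and $\Gamma=\{V=0\}$, as subsets of $\mathbb R_+^2$. Finally, let $\xi^*=\frac{\lambda+\mu}{c}\sqrt2$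 if $\lambda\ge1$ or $\frac{\lambda}{1-\lambda}\ge\frac{\lambda+\mu}{c}$. Otherwise let $(\phi_0^*,\phi_1^*)$ be the intersection of the lines $(\lambda+1)x+(\lambda-1)y+\lambda\sqrt2=0$ and $x+y=\frac{\lambda+\mu}{c}\sqrt2$, let $t^*\ge0$ solve $x(-t^*,\phi_0^*)=0$, and let $\xi^*=y(-t^*,\phi_1^*)$. Then there are decreasing, convex and continuous functions $\gamma_n:\mathbb R_+\to\mathbb R_+$, $n\ge1$, and $\gamma:\mathbb R_+\to\mathbb R_+$ such that $$\Gamma_n=\{(\phi_0,\phi_1)\in\mathbb R_+^2:\phi_1\ge\gamma_n(\phi_0)\}\ (n\ge1),\qquad \Gamma=\{(\phi_0,\phi_1)\in\mathbb R_+^2:\phi_1\ge\gamma(\phi_0)\}.$$ For every $\phi_0\in\mathbb R_+$ the sequence $(\gamma_n(\phi_0))_{n\ge1}$ is increasing with limit $\gamma(\phi_0)$. There are numbers $$\frac\lambda c\sqrt2\le\xi_1\le\xi_2\le\cdots\le\xi_n\le\cdots\le\xi<\xi^*<\infty$$ such that each $\gamma_n$ is strictly decreasing on $[0,\xi_n]$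 and vanishes on $[\xi_n,\infty)$, and $\gamma$ is strictly decreasing on $[0,\xi]$ and vanishes on $[\xi,\infty)$. Moreover, $$\frac\lambda c\sqrt2\le\gamma_1(0)\le\gamma_2(0)\le\cdots\le\gamma_n(0)\le\cdots\le\gamma(0)<\xi^*<\infty.$$ -/

import Mathlib

open MeasureTheory ProbabilityTheory Filter Topology Set
open scoped NNReal ENNReal

noncomputable section

namespace PoissonDisorder

/-! ### The observation process and its filtration -/

/-- `N` is a homogeneous Poisson process with rate `rate` under `P`: a right-continuous,
nondecreasing, `ℕ`-valued process started at `0` with independent increments, the increment over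
`(s, t]` being Poisson distributed with parameter `rate * (t - s)`. -/
structure IsPoissonProcess {Ω : Type*} [MeasurableSpace Ω] (N : ℝ≥0 → Ω → ℕ) (rate : ℝ)
    (P : Measure Ω) : Prop where
  measurable : ∀ t, Measurable (N t)
  zero : ∀ ω, N 0 ω = 0
  mono : ∀ ω, Monotone fun t => N t ω
  rightCont : ∀ ω t, ContinuousWithinAt (fun s => N s ω) (Ici t) t
  indep : HasIndepIncrements N P
  law : ∀ s t, s ≤ t →
    P.map (fun ω => N t ω - N s ω) = poissonMeasure (rate.toNNReal * (t - s))

/-- The σ-algebra generated by the (measurable) `P`-null sets. -/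
@[reducible] def nullSigma {Ω : Type*} [MeasurableSpace Ω] (P : Measure Ω) : MeasurableSpace Ω :=
  MeasurableSpace.generateFrom {A | MeasurableSet A ∧ P A = 0}

theorem nullSigma_le {Ω : Type*} [mΩ : MeasurableSpace Ω] (P : Measure Ω) : nullSigma P ≤ mΩ :=
  MeasurableSpace.generateFrom_le fun _ hA => hA.1

/-- The filtration `𝔽`: the natural filtration of `N`, enlarged by the `P`-null sets and made
right-continuous. -/
def observationFiltration {Ω : Type*} [mΩ : MeasurableSpace Ω] (P : Measure Ω)
    (N : ℝ≥0 → Ω → ℕ) (hN : ∀ t, Measurable (N t)) : Filtration ℝ≥0 mΩ :=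
  (Filtration.natural N (fun t => (hN t).stronglyMeasurable) ⊔
    Filtration.const ℝ≥0 (nullSigma P) (nullSigma_le P)).rightCont

/-- The `n`-th jump time `σ_n = inf {t ≥ 0 : N_t ≥ n}` of `N` (`∞` if there is no such `t`);
in particular `σ_0 = 0`. -/
def jumpTime {Ω : Type*} (N : ℝ≥0 → Ω → ℕ) (n : ℕ) (ω : Ω) : ℝ≥0∞ :=
  ⨅ (t : ℝ≥0) (_ : n ≤ N t ω), (t : ℝ≥0∞)

/-! ### The sufficient statistic -/

/-- The solution `x(t, φ₀)` of `x' = (λ + 1) x + λ (1 - m) / √2`, `x(0) = φ₀`. -/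
def flowX (lam m t φ₀ : ℝ) : ℝ :=
  -(lam * (1 - m) / (√2 * (lam + 1))) +
    Real.exp ((lam + 1) * t) * (φ₀ + lam * (1 - m) / (√2 * (lam + 1)))

open Classical in
/-- The solution `y(t, φ₁)` of `y' = (λ - 1) y + λ (1 + m) / √2`, `y(0) = φ₁`. -/
def flowY (lam m t φ₁ : ℝ) : ℝ :=
  if lam = 1 then φ₁ + (1 + m) / √2 * t
  else -(lam * (1 + m) / (√2 * (lam - 1))) +
    Real.exp ((lam - 1) * t) * (φ₁ + lam * (1 + m) / (√2 * (lam - 1)))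

/-- The deterministic motion of the statistic between jumps. -/
def flow (lam m t : ℝ) (p : ℝ × ℝ) : ℝ × ℝ := (flowX lam m t p.1, flowY lam m t p.2)

/-- The map `S(φ₀, φ₁) = ((1 - 1/μ) φ₀, (1 + 1/μ) φ₁)`, the effect of a jump on the statistic. -/
def jumpMap (mu : ℝ) (p : ℝ × ℝ) : ℝ × ℝ := ((1 - 1 / mu) * p.1, (1 + 1 / mu) * p.2)

/-- The value of the statistic at the `n`-th jump time, when it starts at `p`. -/
def postJump {Ω : Type*} (lam mu m : ℝ) (N : ℝ≥0 → Ω → ℕ) (p : ℝ × ℝ) : ℕ → Ω → ℝ × ℝ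
  | 0, _ => p
  | n + 1, ω => jumpMap mu
      (flow lam m (jumpTime N (n + 1) ω - jumpTime N n ω).toReal (postJump lam mu m N p n ω))

/-- The sufficient statistic `Φ̃_t`, `t ≥ 0`, started at `p = (φ₀, φ₁)`: the pathwise solution of
`dΦ⁰ = ((λ + 1) Φ⁰ + λ (1 - m) / √2) dt - (1/μ) Φ⁰₋ dN`,
`dΦ¹ = ((λ - 1) Φ¹ + λ (1 + m) / √2) dt + (1/μ) Φ¹₋ dN`,
which follows `flow` between the jumps of `N` and is moved by `jumpMap` at each jump. -/
def statistic {Ω : Type*} (lam mu m : ℝ) (N : ℝ≥0 → Ω → ℕ) (p : ℝ × ℝ) (t : ℝ) (ω : Ω) : ℝ × ℝ :=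
  flow lam m (t - (jumpTime N (N t.toNNReal ω) ω).toReal)
    (postJump lam mu m N p (N t.toNNReal ω) ω)

/-- The running cost `g(φ₀, φ₁) = φ₀ + φ₁ - (λ / c) √2`. -/
def runningCost (lam c : ℝ) (p : ℝ × ℝ) : ℝ := p.1 + p.2 - lam / c * √2

/-! ### The optimal stopping problem -/

/-- The time interval `[0, T)`, as a set of reals, for `T ∈ [0, ∞]`. -/
def before (T : ℝ≥0∞) : Set ℝ := {s | 0 ≤ s ∧ ENNReal.ofReal s < T}

/-- The expected cost `𝔼₀ [∫₀^τ e^{-λ t} g(Φ̃_t) dt]` of a random time `τ` when the statistic starts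
at `p`, as an extended real: the integral of the positive part minus that of the negative part
(which is always finite, `g` being bounded below by `-(λ / c) √2` on the quadrant). -/
def expectedCost {Ω : Type*} [MeasurableSpace Ω] (P : Measure Ω) (lam mu c m : ℝ)
    (N : ℝ≥0 → Ω → ℕ) (p : ℝ × ℝ) (τ : Ω → ℝ≥0∞) : EReal :=
  ((∫⁻ ω, (∫⁻ s in before (τ ω), ENNReal.ofReal
      (Real.exp (-lam * s) * runningCost lam c (statistic lam mu m N p s ω))) ∂P : ℝ≥0∞) : EReal) -
  ((∫⁻ ω, (∫⁻ s in before (τ ω), ENNReal.ofReal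
      (-(Real.exp (-lam * s) * runningCost lam c (statistic lam mu m N p s ω)))) ∂P : ℝ≥0∞) : EReal)

/-- The value function `V(p)`: the infimum of the expected cost over all `𝔽`-stopping times with
values in `[0, ∞]`. -/
def valueFunction {Ω : Type*} [MeasurableSpace Ω] (P : Measure Ω) (lam mu c m : ℝ)
    (N : ℝ≥0 → Ω → ℕ) (hN : ∀ t, Measurable (N t)) (p : ℝ × ℝ) : EReal :=
  ⨅ (τ : Ω → ℝ≥0∞) (_ : IsStoppingTime (ι := ℝ≥0) (observationFiltration P N hN) τ),
    expectedCost P lam mu c m N p τ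

open Classical in
/-- `J w(t, p) = 𝔼₀ [∫₀^{t ∧ σ₁} e^{-λ u} g(Φ̃_u) du + 1_{t ≥ σ₁} e^{-λ σ₁} w(Φ̃_{σ₁})]`,
`t ∈ [0, ∞]`, where `Φ̃` starts at `p`. -/
def opJ {Ω : Type*} [MeasurableSpace Ω] (P : Measure Ω) (lam mu c m : ℝ)
    (N : ℝ≥0 → Ω → ℕ) (w : ℝ × ℝ → ℝ) (t : ℝ≥0∞) (p : ℝ × ℝ) : ℝ :=
  ∫ ω, ((∫ u in before (min t (jumpTime N 1 ω)),
      Real.exp (-lam * u) * runningCost lam c (statistic lam mu m N p u ω)) +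
    if jumpTime N 1 ω ≤ t then
      Real.exp (-lam * (jumpTime N 1 ω).toReal) *
        w (statistic lam mu m N p (jumpTime N 1 ω).toReal ω)
    else 0) ∂P

/-- `J₀ w(p) = inf_{t ∈ [0, ∞]} J w(t, p)`. -/
def opJ₀ {Ω : Type*} [MeasurableSpace Ω] (P : Measure Ω) (lam mu c m : ℝ)
    (N : ℝ≥0 → Ω → ℕ) (w : ℝ × ℝ → ℝ) (p : ℝ × ℝ) : ℝ :=
  ⨅ t : ℝ≥0∞, opJ P lam mu c m N w t p

/-- The successive approximations `v_0 = 0`, `v_{n+1} = J₀ v_n`. -/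
def iterV {Ω : Type*} [MeasurableSpace Ω] (P : Measure Ω) (lam mu c m : ℝ)
    (N : ℝ≥0 → Ω → ℕ) : ℕ → ℝ × ℝ → ℝ
  | 0 => fun _ => 0
  | n + 1 => opJ₀ P lam mu c m N (iterV P lam mu c m N n)

/-- The stopping region `Γ_n = {v_n = 0}` in the closed quadrant. -/
def stopRegionN {Ω : Type*} [MeasurableSpace Ω] (P : Measure Ω) (lam mu c m : ℝ)
    (N : ℝ≥0 → Ω → ℕ) (n : ℕ) : Set (ℝ × ℝ) :=
  {p | 0 ≤ p.1 ∧ 0 ≤ p.2 ∧ iterV P lam mu c m N n p = 0}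

/-- The optimal stopping region `Γ = {V = 0}` in the closed quadrant. -/
def stopRegion {Ω : Type*} [MeasurableSpace Ω] (P : Measure Ω) (lam mu c m : ℝ)
    (N : ℝ≥0 → Ω → ℕ) (hN : ∀ t, Measurable (N t)) : Set (ℝ × ℝ) :=
  {p | 0 ≤ p.1 ∧ 0 ≤ p.2 ∧ valueFunction P lam mu c m N hN p = 0}

/-- The part of the epigraph of `f` that lies over `[0, ∞)` in the closed quadrant. -/
def quadrantEpigraph (f : ℝ → ℝ) : Set (ℝ × ℝ) := {p | 0 ≤ p.1 ∧ 0 ≤ p.2 ∧ f p.1 ≤ p.2}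

/-! ### The constant `ξ*` -/

/-- First coordinate `φ₀*` of the intersection of the line
`(λ + 1) x + (λ - 1) y + λ √2 = 0` with the line `x + y = (λ + μ) √2 / c`. -/
def phiStar₀ (lam mu c : ℝ) : ℝ := ((1 - lam) * ((lam + mu) / c * √2) - lam * √2) / 2

/-- Second coordinate `φ₁*` of that intersection. -/
def phiStar₁ (lam mu c : ℝ) : ℝ := (lam + mu) / c * √2 - phiStar₀ lam mu c

/-- The solution `t*` of `x(-t*, φ₀*) = 0`. -/
def tStar (lam mu c m : ℝ) : ℝ :=
  Real.log (1 + phiStar₀ lam mu c * (√2 * (lam + 1)) / (lam * (1 - m))) / (lam + 1)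

open Classical in
/-- The constant `ξ*` that bounds the region `D = {φ₀ + φ₁ < ξ*}`: it is `(λ + μ) √2 / c` unless
`λ < 1` and `λ / (1 - λ) < (λ + μ) / c`, and in that case it is `y(-t*, φ₁*)`. -/
def xiStar (lam mu c m : ℝ) : ℝ :=
  if lam < 1 ∧ lam / (1 - lam) < (lam + mu) / c then
    flowY lam m (-tStar lam mu c m) (phiStar₁ lam mu c)
  else (lam + mu) / c * √2

end PoissonDisorder

end

/-! Between jumps the statistic follows an affine deterministic flow, and the first jump time is
exponential. Hence J becomes `detJ`, an integral of `costRate` along the flow, and v_n becomes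
`detV` on the quadrant (`opJ_eq_detJ`, `iterV_eq_detV`). The running cost, the flow and the jump map
are affine, and all three are monotone, so `detJ₀` preserves the class `Admissible` of nonpositive,
increasing, concave, Lipschitz functions bounded below by a constant -κ (`admissible_detJ₀`). The
decreasing limit `limV` stays in this class and is a fixed point of `detJ₀` (`detJ₀_limV`).

If such a function is negative for x + y < (λ/c)√2 and vanishes at (M, 0) and (0, M), its zero set
in the quadrant is the epigraph of a decreasing, convex, continuous function (`HasBoundary`).
Convexity comes from concavity of the function, and strict decrease up to the first zero comes from
convexity.

The strict inequality with ξ* rests on κ. If w ≥ -κ, the rate of cost is at least x + y - (λ/c)√2 -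
μκ. With κ = √2/c it is nonnegative above the line x + y = (λ+μ)√2/c, and ξ* is such that the flow
from (0, ξ*) never falls below that line. The upward drift of the first coordinate improves κ to
`lossBound` < √2/c for all iterates at once. The line moves down by a fixed amount, so that one
number `zeroBound` < ξ* bounds the zeros of all v_n and of the limit.

It remains to show that V vanishes exactly where `limV` does, the infimum being over all stopping
times of the completed right-continuous filtration. Time is cut into steps of length h. Up to O(h²)
times the size of the statistic, the mean over a step of the cost plus the discounted terminal value
of `limV` equals `detStep`, on every event of the completed past
(`abs_setIntegral_stepValue_sub_le`, `abs_mean_sub_detStep_le`). Always `limV` ≤ `detStep`, with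
equality where `limV` is below -`level` h. Telescoping over T/h steps leaves an error O(h). So a
stopping time truncated at T costs at least `limV` (`limV_le_integral_region`), while waiting until
`limV` is nearly zero, or until T, costs little more than `limV` (`setIntegral_gridRegion_le`).
These give `valueFunction_eq_zero` and `valueFunction_neg`. -/

namespace PoissonDisorder

/-! ### The deterministic flow -/

/-- `∫₀ᵗ e^{α s} ds`. -/
noncomputable def expInt (α t : ℝ) : ℝ := ∫ s in (0 : ℝ)..t, Real.exp (α * s)

/-- Without a division the identity covers α = 0, which occurs for the second coordinate when λ = 1.
-/
theorem mul_expInt (α t : ℝ) : α * expInt α t = Real.exp (α * t) - 1 := by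
  simp [expInt]

theorem expInt_zero_left (t : ℝ) : expInt 0 t = t := by simp [expInt]

theorem expInt_mono_left {α β t : ℝ} (h : α ≤ β) (ht : 0 ≤ t) : expInt α t ≤ expInt β t := by
  refine intervalIntegral.integral_mono_on ht (by apply Continuous.intervalIntegrable; fun_prop)
    (by apply Continuous.intervalIntegrable; fun_prop) fun s hs => ?_
  exact Real.exp_le_exp.2 (mul_le_mul_of_nonneg_right h hs.1)

theorem expInt_nonneg {α t : ℝ} (ht : 0 ≤ t) : 0 ≤ expInt α t :=
  intervalIntegral.integral_nonneg ht fun _ _ => (Real.exp_pos _).le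

theorem le_expInt {α t : ℝ} (hα : 0 ≤ α) (ht : 0 ≤ t) : t ≤ expInt α t := by
  simpa [expInt_zero_left] using expInt_mono_left hα ht

theorem expInt_le {α t : ℝ} (hα : 0 ≤ α) (ht : 0 ≤ t) : expInt α t ≤ t * Real.exp (α * t) := by
  have : expInt α t ≤ ∫ _ in (0 : ℝ)..t, Real.exp (α * t) := by
    refine intervalIntegral.integral_mono_on ht (by apply Continuous.intervalIntegrable; fun_prop)
      (by simp) fun s hs => ?_
    exact Real.exp_le_exp.2 (mul_le_mul_of_nonneg_left hs.2 hα)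
  simpa using this

/-- The drift `λ (1 - m) / √2` of the first coordinate at `0`. -/
noncomputable def driftX (lam m : ℝ) : ℝ := lam * (1 - m) / √2

/-- The drift `λ (1 + m) / √2` of the second coordinate at `0`. -/
noncomputable def driftY (lam m : ℝ) : ℝ := lam * (1 + m) / √2

theorem driftX_pos {lam m : ℝ} (hlam : 0 < lam) (hm : m ∈ Ioo (-1 : ℝ) 1) : 0 < driftX lam m :=
  div_pos (mul_pos hlam (by linarith [hm.2])) (by positivity)

theorem driftY_pos {lam m : ℝ} (hlam : 0 < lam) (hm : m ∈ Ioo (-1 : ℝ) 1) : 0 < driftY lam m :=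
  div_pos (mul_pos hlam (by linarith [hm.1])) (by positivity)

theorem driftX_add_driftY (lam m : ℝ) : driftX lam m + driftY lam m = lam * √2 := by
  unfold driftX driftY
  have h2 : √2 * √2 = (2 : ℝ) := Real.mul_self_sqrt (by norm_num)
  field_simp
  rw [sq, h2]; ring

theorem flowX_eq {lam : ℝ} (hlam : 0 < lam) (m t x : ℝ) :
    flowX lam m t x = Real.exp ((lam + 1) * t) * x + driftX lam m * expInt (lam + 1) t := by
  have h := mul_expInt (lam + 1) t
  have hl : lam + 1 ≠ 0 := by positivity
  have : expInt (lam + 1) t = (Real.exp ((lam + 1) * t) - 1) / (lam + 1) := by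
    field_simp; linarith
  rw [this, flowX, driftX]
  field_simp
  ring

/-- Removes the case distinction at λ = 1 and exhibits the flow as affine with nonnegative
coefficients for t ≥ 0. -/
theorem flowY_eq {lam : ℝ} (m t y : ℝ) :
    flowY lam m t y = Real.exp ((lam - 1) * t) * y + driftY lam m * expInt (lam - 1) t := by
  unfold flowY
  split_ifs with hl
  · subst hl
    simp [expInt_zero_left, driftY]
  · have h := mul_expInt (lam - 1) t
    have hl : lam - 1 ≠ 0 := sub_ne_zero.2 hl
    have : expInt (lam - 1) t = (Real.exp ((lam - 1) * t) - 1) / (lam - 1) := by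
      field_simp; linarith
    rw [this, driftY]
    field_simp
    ring

theorem flowX_add {lam : ℝ} (m s t x : ℝ) :
    flowX lam m (s + t) x = flowX lam m s (flowX lam m t x) := by
  simp only [flowX, mul_add, Real.exp_add]; ring

theorem flowY_add (lam m s t y : ℝ) :
    flowY lam m (s + t) y = flowY lam m s (flowY lam m t y) := by
  unfold flowY
  split_ifs with hl
  · ring
  · simp only [mul_add, Real.exp_add]; ring

theorem flow_add (lam m s t : ℝ) (p : ℝ × ℝ) :
    flow lam m (s + t) p = flow lam m s (flow lam m t p) := by
  simp [flow, flowX_add, flowY_add]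

@[simp] theorem flow_zero (lam m : ℝ) (p : ℝ × ℝ) : flow lam m 0 p = p := by
  unfold flow flowX flowY
  ext
  · simp
  · dsimp only; split_ifs <;> simp

theorem expInt_continuous (α : ℝ) : Continuous (expInt α) := by
  by_cases h : α = 0
  · subst h
    have : expInt 0 = id := funext expInt_zero_left
    rw [this]; exact continuous_id
  · have : expInt α = fun t => (Real.exp (α * t) - 1) / α := by
      funext t
      have := mul_expInt α t
      field_simp; linarith
    rw [this]; fun_prop

theorem flow_continuous {lam : ℝ} (hlam : 0 < lam) (m : ℝ) :
    Continuous fun q : ℝ × ℝ × ℝ => flow lam m q.1 q.2 := by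
  have h : (fun q : ℝ × ℝ × ℝ => flow lam m q.1 q.2) = fun q =>
      (Real.exp ((lam + 1) * q.1) * q.2.1 + driftX lam m * expInt (lam + 1) q.1,
        Real.exp ((lam - 1) * q.1) * q.2.2 + driftY lam m * expInt (lam - 1) q.1) := by
    funext q; simp [flow, flowX_eq hlam, flowY_eq]
  have h1 := expInt_continuous (lam + 1)
  have h2 := expInt_continuous (lam - 1)
  rw [h]; fun_prop

theorem flow_continuous_time {lam : ℝ} (hlam : 0 < lam) (m : ℝ) (p : ℝ × ℝ) :
    Continuous fun t => flow lam m t p :=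
  (flow_continuous hlam m).comp (f := fun t => (t, p)) (by fun_prop)

/-- The size function `2 + φ₀ + φ₁` in which all growth estimates are expressed. -/
def size (p : ℝ × ℝ) : ℝ := 2 + p.1 + p.2

theorem two_le_size {p : ℝ × ℝ} (hp : 0 ≤ p) : 2 ≤ size p := by
  have h1 : 0 ≤ p.1 := hp.1
  have h2 : 0 ≤ p.2 := hp.2
  unfold size; linarith

section Flow

variable {lam m : ℝ} (hlam : 0 < lam) (hm : m ∈ Ioo (-1 : ℝ) 1)

include hlam hm

/-- This linear growth is the source of both `waitBound` and the gap between `lossBound` and √2/c.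
-/
theorem le_flowX {t x : ℝ} (ht : 0 ≤ t) (hx : 0 ≤ x) :
    x + driftX lam m * t ≤ flowX lam m t x := by
  rw [flowX_eq hlam]
  have h1 : (1 : ℝ) ≤ Real.exp ((lam + 1) * t) := Real.one_le_exp (by positivity)
  have h2 := le_expInt (α := lam + 1) (by positivity) ht
  have h3 := driftX_pos hlam hm
  nlinarith [mul_le_mul_of_nonneg_left h2 h3.le, mul_le_mul_of_nonneg_right h1 hx]

theorem flowY_nonneg {t y : ℝ} (ht : 0 ≤ t) (hy : 0 ≤ y) : 0 ≤ flowY lam m t y := by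
  rw [flowY_eq]
  have h3 := driftY_pos hlam hm
  have h2 := expInt_nonneg (α := lam - 1) ht
  positivity

theorem flow_nonneg {t : ℝ} {p : ℝ × ℝ} (ht : 0 ≤ t) (hp : 0 ≤ p) : 0 ≤ flow lam m t p := by
  refine ⟨?_, flowY_nonneg hlam hm ht hp.2⟩
  have h0 : (0 : ℝ) ≤ p.1 := hp.1
  have h1 := le_flowX hlam hm ht h0
  have h3 := driftX_pos hlam hm
  show 0 ≤ flowX lam m t p.1
  have := mul_nonneg h3.le ht
  linarith

/-- The constant 2 in `size` absorbs the drifts: their sum is λ√2 ≤ 2(λ + 1), so the size grows at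
most at rate λ + 1. -/
theorem size_flow_le {t : ℝ} {p : ℝ × ℝ} (ht : 0 ≤ t) (hp : 0 ≤ p) :
    size (flow lam m t p) ≤ Real.exp ((lam + 1) * t) * size p := by
  have h0 : (0 : ℝ) ≤ p.1 := hp.1
  have h1 : (0 : ℝ) ≤ p.2 := hp.2
  have e1 : expInt (lam - 1) t ≤ expInt (lam + 1) t := expInt_mono_left (by linarith) ht
  have e2 : Real.exp ((lam - 1) * t) ≤ Real.exp ((lam + 1) * t) :=
    Real.exp_le_exp.2 (by nlinarith)
  have e3 := mul_expInt (lam + 1) t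
  have e4 := driftX_add_driftY lam m
  have e5 := driftY_pos hlam hm
  have e6 := mul_le_mul_of_nonneg_left e1 e5.le
  have e7 := mul_le_mul_of_nonneg_right e2 h1
  have e0 := expInt_nonneg (α := lam + 1) ht
  have hs : √2 ≤ 2 := by
    rw [Real.sqrt_le_left (by norm_num)]; norm_num
  have e8 : lam * √2 * expInt (lam + 1) t ≤ 2 * ((lam + 1) * expInt (lam + 1) t) := by
    nlinarith [mul_le_mul_of_nonneg_right hs (mul_nonneg hlam.le e0)]
  simp only [size, flow, flowX_eq hlam, flowY_eq]
  have e9 : lam * √2 * expInt (lam + 1) t =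
    driftX lam m * expInt (lam + 1) t + driftY lam m * expInt (lam + 1) t := by rw [← e4]; ring
  nlinarith

/-- The motion over a time `t ≤ 1` is `O(t)`, relative to the size of the starting point. -/
theorem flow_displacement {t : ℝ} {p : ℝ × ℝ} (ht : 0 ≤ t) (ht1 : t ≤ 1) (hp : 0 ≤ p) :
    |(flow lam m t p).1 - p.1| + |(flow lam m t p).2 - p.2| ≤
      (lam + 1) * Real.exp (lam + 1) * t * size p := by
  have h0 : (0 : ℝ) ≤ p.1 := hp.1
  have h1 : (0 : ℝ) ≤ p.2 := hp.2
  have e1 : expInt (lam - 1) t ≤ expInt (lam + 1) t := expInt_mono_left (by linarith) ht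
  have e0 := expInt_nonneg (α := lam + 1) ht
  have e0' := expInt_nonneg (α := lam - 1) ht
  have e2 : expInt (lam + 1) t ≤ t * Real.exp (lam + 1) :=
    (expInt_le (by positivity) ht).trans (mul_le_mul_of_nonneg_left
      (Real.exp_le_exp.2 (by nlinarith)) ht)
  have e4 := driftX_add_driftY lam m
  have e5 := driftY_pos hlam hm
  have e6 := driftX_pos hlam hm
  have hs : √2 ≤ 2 := by
    rw [Real.sqrt_le_left (by norm_num)]; norm_num
  have d1 : (flow lam m t p).1 - p.1 =
      expInt (lam + 1) t * ((lam + 1) * p.1) + driftX lam m * expInt (lam + 1) t := by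
    simp only [flow, flowX_eq hlam]
    linear_combination -p.1 * mul_expInt (lam + 1) t
  have d2 : (flow lam m t p).2 - p.2 =
      expInt (lam - 1) t * ((lam - 1) * p.2) + driftY lam m * expInt (lam - 1) t := by
    simp only [flow, flowY_eq]
    linear_combination -p.2 * mul_expInt (lam - 1) t
  have b1 : |(flow lam m t p).1 - p.1| ≤
      expInt (lam + 1) t * ((lam + 1) * p.1) + driftX lam m * expInt (lam + 1) t := by
    rw [d1, abs_of_nonneg (by positivity)]
  have b2 : |(flow lam m t p).2 - p.2| ≤
      expInt (lam + 1) t * ((lam + 1) * p.2) + driftY lam m * expInt (lam + 1) t := by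
    rw [d2]
    refine (abs_add_le _ _).trans (add_le_add ?_ ?_)
    · rw [abs_mul, abs_mul, abs_of_nonneg e0', abs_of_nonneg h1]
      have : |lam - 1| ≤ lam + 1 := abs_le.2 ⟨by linarith, by linarith⟩
      gcongr
    · rw [abs_of_nonneg (by positivity)]
      gcongr
  calc _ ≤ expInt (lam + 1) t * ((lam + 1) * (p.1 + p.2) + lam * √2) := by
        rw [← e4]; linarith
    _ ≤ expInt (lam + 1) t * ((lam + 1) * size p) := by
        refine mul_le_mul_of_nonneg_left ?_ e0
        unfold size
        nlinarith [mul_le_mul_of_nonneg_left hs hlam.le]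
    _ ≤ (t * Real.exp (lam + 1)) * ((lam + 1) * size p) := by
        have := two_le_size hp
        gcongr
    _ = _ := by ring

omit hm in
/-- Differences of trajectories. -/
theorem flow_sub (t : ℝ) (p q : ℝ × ℝ) :
    (flow lam m t q).1 - (flow lam m t p).1 = Real.exp ((lam + 1) * t) * (q.1 - p.1) ∧
    (flow lam m t q).2 - (flow lam m t p).2 = Real.exp ((lam - 1) * t) * (q.2 - p.2) := by
  simp only [flow, flowX_eq hlam, flowY_eq]
  constructor <;> ring

omit hm in
theorem flow_mono (t : ℝ) {p q : ℝ × ℝ} (hpq : p ≤ q) : flow lam m t p ≤ flow lam m t q := by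
  obtain ⟨h1, h2⟩ := flow_sub (m := m) hlam t p q
  have h3 : p.1 ≤ q.1 := hpq.1
  have h4 : p.2 ≤ q.2 := hpq.2
  constructor
  · have := mul_nonneg (Real.exp_pos ((lam + 1) * t)).le (sub_nonneg.2 h3); linarith
  · have := mul_nonneg (Real.exp_pos ((lam - 1) * t)).le (sub_nonneg.2 h4); linarith

omit hm in
theorem flow_affine (t : ℝ) {a b : ℝ} (hab : a + b = 1) (p q : ℝ × ℝ) :
    flow lam m t (a • p + b • q) = a • flow lam m t p + b • flow lam m t q := by
  obtain rfl : b = 1 - a := by linarith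
  ext <;> simp [flow, flowX_eq hlam, flowY_eq] <;> ring

end Flow

/-! ### The jump map -/

section Jump

variable {mu : ℝ} (hmu : 1 < mu)

include hmu

theorem inv_lt_one_of_rate : 1 / mu < 1 := by rw [div_lt_one (by linarith)]; exact hmu

theorem jumpMap_nonneg {p : ℝ × ℝ} (hp : 0 ≤ p) : 0 ≤ jumpMap mu p := by
  have h := inv_lt_one_of_rate hmu
  have h' : 0 < 1 / mu := by positivity
  exact ⟨mul_nonneg (by linarith) hp.1, mul_nonneg (by linarith) hp.2⟩

theorem jumpMap_mono {p q : ℝ × ℝ} (hpq : p ≤ q) : jumpMap mu p ≤ jumpMap mu q := by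
  have h := inv_lt_one_of_rate hmu
  have h' : 0 < 1 / mu := by positivity
  exact ⟨mul_le_mul_of_nonneg_left hpq.1 (by linarith),
    mul_le_mul_of_nonneg_left hpq.2 (by linarith)⟩

theorem size_jumpMap_le {p : ℝ × ℝ} (hp : 0 ≤ p) : size (jumpMap mu p) ≤ (1 + 1 / mu) * size p := by
  have h := inv_lt_one_of_rate hmu
  have h' : 0 < 1 / mu := by positivity
  have h0 : (0 : ℝ) ≤ p.1 := hp.1
  simp only [size, jumpMap]
  nlinarith

omit hmu in
theorem jumpMap_affine (a b : ℝ) (p q : ℝ × ℝ) :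
    jumpMap mu (a • p + b • q) = a • jumpMap mu p + b • jumpMap mu q := by
  ext <;> simp [jumpMap] <;> ring

omit hmu in
theorem jumpMap_continuous : Continuous (jumpMap mu) := by unfold jumpMap; fun_prop

end Jump


/-! ### Time intervals -/

@[simp] theorem before_zero : before 0 = ∅ := by
  ext s; simp [before]

/-- For negative h both sides are empty. -/
theorem before_ofReal (h : ℝ) : before (ENNReal.ofReal h) = Ico 0 h := by
  ext s
  simp only [before, mem_ofPred_eq, mem_Ico]
  refine and_congr_right fun hs => ?_
  rw [ENNReal.ofReal_lt_ofReal_iff']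
  exact ⟨fun h => h.1, fun h => ⟨h, by linarith⟩⟩

theorem before_subset_Ici (t : ℝ≥0∞) : before t ⊆ Ici 0 := fun _ h => h.1

theorem before_mono {s t : ℝ≥0∞} (h : s ≤ t) : before s ⊆ before t :=
  fun _ hx => ⟨hx.1, hx.2.trans_le h⟩

theorem measurableSet_before (t : ℝ≥0∞) : MeasurableSet (before t) :=
  measurableSet_Ici.inter (measurableSet_lt ENNReal.measurable_ofReal measurable_const)

theorem before_min (s t : ℝ≥0∞) : before (min s t) = before s ∩ before t := by
  ext x; simp only [before, mem_ofPred_eq, mem_inter_iff, lt_min_iff]; tauto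

/-! ### Parameters and constants -/

/-- The standing assumptions on the parameters. -/
structure Params (lam mu c m : ℝ) : Prop where
  lam_pos : 0 < lam
  one_lt_mu : 1 < mu
  c_pos : 0 < c
  m_mem : m ∈ Ioo (-1 : ℝ) 1

/-- The level `(λ + μ) √2 / c`. -/
noncomputable def level (lam mu c : ℝ) : ℝ := (lam + mu) / c * √2

/-- A bound on `-V` that is strictly smaller than `√2 / c`. -/
noncomputable def lossBound (lam mu c m : ℝ) : ℝ :=
  level lam mu c / (lam + mu + driftX lam m / level lam mu c)

/-- A time after which it is never worthwhile to continue before the first jump. -/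
noncomputable def waitBound (lam mu c m : ℝ) : ℝ := level lam mu c / driftX lam m

/-- Bound on the slope of the value function in the first coordinate. -/
noncomputable def slopeX (lam mu c m : ℝ) : ℝ :=
  (Real.exp ((mu - 1) * waitBound lam mu c m) - 1) / (mu - 1)

/-- Bound on the slope of the value function in the second coordinate. -/
noncomputable def slopeY (lam mu c m : ℝ) : ℝ :=
  (Real.exp ((mu + 1) * waitBound lam mu c m) - 1) / (mu + 1)

/-- The class of functions to which the successive approximations belong. -/
structure Admissible (lam mu c m : ℝ) (w : ℝ × ℝ → ℝ) : Prop where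
  nonpos : ∀ p, w p ≤ 0
  lower : ∀ p, -lossBound lam mu c m ≤ w p
  mono : ∀ p q, p ≤ q → w p ≤ w q
  slope : ∀ p q, p ≤ q →
    w q - w p ≤ slopeX lam mu c m * (q.1 - p.1) + slopeY lam mu c m * (q.2 - p.2)
  concave : ConcaveOn ℝ (Ici 0) w

/-- Expected rate of cost at time `u` before the first jump, discounted and weighted by the
probability that there was no jump. -/
noncomputable def costRate (lam mu c m : ℝ) (w : ℝ × ℝ → ℝ) (p : ℝ × ℝ) (u : ℝ) : ℝ :=
  Real.exp (-(lam + mu) * u) * (runningCost lam c (flow lam m u p) +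
    mu * w (jumpMap mu (flow lam m u p)))

/-- The deterministic form of `opJ`. -/
noncomputable def detJ (lam mu c m : ℝ) (w : ℝ × ℝ → ℝ) (t : ℝ≥0∞) (p : ℝ × ℝ) : ℝ :=
  ∫ u in before t, costRate lam mu c m w p u

/-- The deterministic form of `opJ₀`, extended to the plane by projection on the quadrant. -/
noncomputable def detJ₀ (lam mu c m : ℝ) (w : ℝ × ℝ → ℝ) (p : ℝ × ℝ) : ℝ :=
  ⨅ t : ℝ≥0∞, detJ lam mu c m w t (p ⊔ 0)

/-- The deterministic form of `iterV`. -/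
noncomputable def detV (lam mu c m : ℝ) : ℕ → ℝ × ℝ → ℝ
  | 0 => fun _ => 0
  | n + 1 => detJ₀ lam mu c m (detV lam mu c m n)

/-- The limit of the successive approximations. -/
noncomputable def limV (lam mu c m : ℝ) (p : ℝ × ℝ) : ℝ := ⨅ n, detV lam mu c m n p

section

variable {lam mu c m : ℝ} (H : Params lam mu c m)

include H

theorem level_pos : 0 < level lam mu c := by
  have h1 := H.lam_pos
  have h2 := H.one_lt_mu
  have h3 := H.c_pos
  have : 0 < √2 := by positivity
  unfold level; positivity

theorem drift_pos : 0 < driftX lam m := driftX_pos H.lam_pos H.m_mem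

theorem lossBound_pos : 0 < lossBound lam mu c m := by
  have h1 := H.lam_pos
  have h2 := H.one_lt_mu
  have h3 := level_pos H
  have h4 := drift_pos H
  unfold lossBound; positivity

/-- Ignoring the drift of the first coordinate would give `level` / (λ + μ) = √2/c; the drift adds a
positive term to the denominator. This gap is what makes the final inequalities with ξ* strict. -/
theorem lossBound_lt : lossBound lam mu c m < √2 / c := by
  have h1 := H.lam_pos
  have h2 := H.one_lt_mu
  have h3 := level_pos H
  have h4 := drift_pos H
  have h5 := H.c_pos
  have : √2 / c = level lam mu c / (lam + mu) := by
    unfold level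
    have : lam + mu ≠ 0 := by positivity
    field_simp
  rw [this]
  unfold lossBound
  exact div_lt_div_of_pos_left h3 (by positivity) (lt_add_of_pos_right _ (by positivity))

theorem waitBound_pos : 0 < waitBound lam mu c m := div_pos (level_pos H) (drift_pos H)

theorem slopeX_nonneg : 0 ≤ slopeX lam mu c m := by
  have h2 := H.one_lt_mu
  have h3 := waitBound_pos H
  refine div_nonneg (sub_nonneg.2 (Real.one_le_exp ?_)) (by linarith)
  exact mul_nonneg (by linarith) h3.le

theorem slopeY_nonneg : 0 ≤ slopeY lam mu c m := by
  have h2 := H.one_lt_mu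
  have h3 := waitBound_pos H
  refine div_nonneg (sub_nonneg.2 (Real.one_le_exp ?_)) (by linarith)
  exact mul_nonneg (by linarith) h3.le

omit H in
theorem level_eq : level lam mu c = lam / c * √2 + mu * (√2 / c) := by unfold level; ring

/-! ### Admissible functions -/

variable {w : ℝ × ℝ → ℝ} (hw : Admissible lam mu c m w)

include hw

/-- The slope bound is one-sided and for ordered points only. It is applied from p to p ⊔ q, and
monotonicity then leads down to q. -/
theorem Admissible.abs_sub_le (p q : ℝ × ℝ) :
    |w q - w p| ≤ slopeX lam mu c m * |q.1 - p.1| + slopeY lam mu c m * |q.2 - p.2| := by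
  have key : ∀ p q : ℝ × ℝ,
      w q - w p ≤ slopeX lam mu c m * |q.1 - p.1| + slopeY lam mu c m * |q.2 - p.2| := by
    intro p q
    have h1 := hw.mono q (p ⊔ q) le_sup_right
    have h2 := hw.slope p (p ⊔ q) le_sup_left
    have h3 : (p ⊔ q).1 - p.1 ≤ |q.1 - p.1| := by
      show max p.1 q.1 - p.1 ≤ _
      rcases max_cases p.1 q.1 with h | h <;> rw [h.1]
      · simp
      · exact le_abs_self _
    have h4 : (p ⊔ q).2 - p.2 ≤ |q.2 - p.2| := by
      show max p.2 q.2 - p.2 ≤ _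
      rcases max_cases p.2 q.2 with h | h <;> rw [h.1]
      · simp
      · exact le_abs_self _
    have h5 := mul_le_mul_of_nonneg_left h3 (slopeX_nonneg H)
    have h6 := mul_le_mul_of_nonneg_left h4 (slopeY_nonneg H)
    linarith
  refine abs_le.2 ⟨?_, key p q⟩
  have := key q p
  rw [abs_sub_comm p.1, abs_sub_comm p.2] at this
  linarith

theorem Admissible.continuous : Continuous w := by
  refine continuous_iff_continuousAt.2 fun p => ?_
  rw [ContinuousAt, tendsto_iff_dist_tendsto_zero]
  have h0 : Tendsto (fun q : ℝ × ℝ =>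
      slopeX lam mu c m * |q.1 - p.1| + slopeY lam mu c m * |q.2 - p.2|) (𝓝 p) (𝓝 0) := by
    have : Continuous fun q : ℝ × ℝ =>
        slopeX lam mu c m * |q.1 - p.1| + slopeY lam mu c m * |q.2 - p.2| := by fun_prop
    simpa using this.tendsto p
  exact squeeze_zero (fun _ => dist_nonneg)
    (fun q => by rw [Real.dist_eq]; exact hw.abs_sub_le H p q) h0

theorem costRate_continuous (p : ℝ × ℝ) : Continuous (costRate lam mu c m w p) := by
  have h1 := flow_continuous_time H.lam_pos m p
  have h2 := hw.continuous H
  have h3 : Continuous fun u => w (jumpMap mu (flow lam m u p)) :=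
    h2.comp (jumpMap_continuous.comp h1)
  have h4 : Continuous fun u => runningCost lam c (flow lam m u p) :=
    (h1.fst.add h1.snd).sub continuous_const
  have h5 : Continuous fun u : ℝ => Real.exp (-(lam + mu) * u) := by fun_prop
  exact h5.mul (h4.add (h3.const_mul mu))

/-- Since w ≥ -`lossBound` rather than -√2/c, the threshold on x + y lies below `level` by μ(√2/c -
`lossBound`). -/
theorem cost_lower (q : ℝ × ℝ) :
    q.1 + q.2 - (level lam mu c - mu * (√2 / c - lossBound lam mu c m)) ≤
      runningCost lam c q + mu * w (jumpMap mu q) := by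
  have h1 := mul_le_mul_of_nonneg_left (hw.lower (jumpMap mu q)) (by linarith [H.one_lt_mu] : 0 ≤ mu)
  have h2 := level_eq (lam := lam) (mu := mu) (c := c)
  unfold runningCost
  linarith

theorem cost_lower' (q : ℝ × ℝ) :
    q.1 + q.2 - level lam mu c ≤ runningCost lam c q + mu * w (jumpMap mu q) := by
  have h1 := cost_lower H hw q
  have h2 := lossBound_lt H
  have h3 := H.one_lt_mu
  nlinarith

theorem abs_cost_le {q : ℝ × ℝ} (hq : 0 ≤ q) :
    |runningCost lam c q + mu * w (jumpMap mu q)| ≤ (1 + level lam mu c) * size q := by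
  have h1 := cost_lower' H hw q
  have h2 := hw.nonpos (jumpMap mu q)
  have h3 : 0 ≤ q.1 := hq.1
  have h4 : 0 ≤ q.2 := hq.2
  have h5 := level_pos H
  have h6 : 0 ≤ lam / c * √2 := by
    have := H.lam_pos
    have := H.c_pos
    positivity
  have h7 := mul_nonneg (by linarith [H.one_lt_mu] : 0 ≤ mu) (neg_nonneg.2 h2)
  have h8 := two_le_size hq
  have h9 : level lam mu c * 1 ≤ level lam mu c * size q :=
    mul_le_mul_of_nonneg_left (by linarith) h5.le
  have h10 : size q = 2 + q.1 + q.2 := rfl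
  rw [abs_le]
  constructor
  · nlinarith
  · unfold runningCost; nlinarith

/-- The weight e^{-(λ+μ)u} beats the growth e^{(λ+1)u} because μ > 1; this makes the infinite
horizon t = ∞ integrable. -/
theorem abs_costRate_le {p : ℝ × ℝ} (hp : 0 ≤ p) {u : ℝ} (hu : 0 ≤ u) :
    |costRate lam mu c m w p u| ≤
      (1 + level lam mu c) * size p * Real.exp (-(mu - 1) * u) := by
  have h1 := abs_cost_le H hw (flow_nonneg H.lam_pos H.m_mem hu hp)
  have h2 := size_flow_le H.lam_pos H.m_mem hu hp
  have h3 := level_pos H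
  unfold costRate
  rw [abs_mul, abs_of_pos (Real.exp_pos _)]
  calc _ ≤ Real.exp (-(lam + mu) * u) *
        ((1 + level lam mu c) * (Real.exp ((lam + 1) * u) * size p)) := by gcongr; exact h1.trans (by gcongr)
    _ = (1 + level lam mu c) * size p *
        (Real.exp (-(lam + mu) * u) * Real.exp ((lam + 1) * u)) := by ring
    _ = _ := by rw [← Real.exp_add]; congr 2; ring

omit hw in
theorem integrableOn_bound (p : ℝ × ℝ) : IntegrableOn
    (fun u => (1 + level lam mu c) * size p * Real.exp (-(mu - 1) * u)) (Ici 0) := by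
  rw [integrableOn_Ici_iff_integrableOn_Ioi]
  exact (integrableOn_exp_mul_Ioi (by linarith [H.one_lt_mu]) 0).const_mul _

theorem costRate_integrableOn {p : ℝ × ℝ} (hp : 0 ≤ p) (t : ℝ≥0∞) :
    IntegrableOn (costRate lam mu c m w p) (before t) := by
  refine IntegrableOn.mono_set ?_ (before_subset_Ici t)
  refine (integrableOn_bound H p).mono' (costRate_continuous H hw p).aestronglyMeasurable ?_
  refine (ae_restrict_iff' measurableSet_Ici).2 (Eventually.of_forall fun u hu => ?_)
  exact abs_costRate_le H hw hp hu

theorem costRate_lower {p : ℝ × ℝ} (hp : 0 ≤ p) {u : ℝ} (hu : 0 ≤ u) :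
    Real.exp (-(lam + mu) * u) * (driftX lam m * u - level lam mu c) ≤
      costRate lam mu c m w p u := by
  have h0 : (0 : ℝ) ≤ p.1 := hp.1
  have h1 := cost_lower' H hw (flow lam m u p)
  have h2 := le_flowX H.lam_pos H.m_mem hu h0
  have h3 : 0 ≤ (flow lam m u p).2 := (flow_nonneg H.lam_pos H.m_mem hu hp).2
  have h4 : (flow lam m u p).1 = flowX lam m u p.1 := rfl
  unfold costRate
  refine mul_le_mul_of_nonneg_left ?_ (Real.exp_pos _).le
  linarith

/-- With a = `driftX`, the inequality 1 - z ≤ e^{-z} gives `level` - a u ≤ `level` e^{-a u / level}.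
The exponential form is chosen because its weighted integral over [0, ∞) is exactly `lossBound`. -/
theorem costRate_ge_exp {p : ℝ × ℝ} (hp : 0 ≤ p) {u : ℝ} (hu : 0 ≤ u) :
    -(level lam mu c * Real.exp (-(lam + mu + driftX lam m / level lam mu c) * u)) ≤
      costRate lam mu c m w p u := by
  refine le_trans ?_ (costRate_lower H hw hp hu)
  have hK := level_pos H
  have h := Real.add_one_le_exp (-(driftX lam m / level lam mu c * u))
  have e : Real.exp (-(lam + mu + driftX lam m / level lam mu c) * u) =
      Real.exp (-(lam + mu) * u) * Real.exp (-(driftX lam m / level lam mu c * u)) := by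
    rw [← Real.exp_add]; congr 1; ring
  have h' := mul_le_mul_of_nonneg_left h hK.le
  have e2 : level lam mu c * (-(driftX lam m / level lam mu c * u) + 1) =
      level lam mu c - driftX lam m * u := by field_simp; ring
  rw [e2] at h'
  rw [e]
  have := mul_le_mul_of_nonneg_left h' (Real.exp_pos (-(lam + mu) * u)).le
  linarith

/-- In effect only w ≥ -√2/c is used, through `cost_lower'`, and the sharper constant comes out. So
one constant serves all iterates. -/
theorem detJ_lower {p : ℝ × ℝ} (hp : 0 ≤ p) (t : ℝ≥0∞) :
    -lossBound lam mu c m ≤ detJ lam mu c m w t p := by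
  have h1 := H.lam_pos
  have h2 := H.one_lt_mu
  have hK := level_pos H
  have ha := drift_pos H
  set θ := lam + mu + driftX lam m / level lam mu c with hθ
  have hθ0 : 0 < θ := by positivity
  have hi : IntegrableOn (fun u => level lam mu c * Real.exp (-θ * u)) (Ici 0) := by
    rw [integrableOn_Ici_iff_integrableOn_Ioi]
    exact (integrableOn_exp_mul_Ioi (by linarith) 0).const_mul _
  have e : ∫ u in Ici (0 : ℝ), level lam mu c * Real.exp (-θ * u) = lossBound lam mu c m := by
    rw [integral_const_mul, integral_Ici_eq_integral_Ioi, integral_exp_mul_Ioi (by linarith)]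
    rw [mul_zero, Real.exp_zero, neg_div_neg_eq, mul_one_div]
    rfl
  have h3 : ∫ u in before t, level lam mu c * Real.exp (-θ * u) ≤
      ∫ u in Ici (0 : ℝ), level lam mu c * Real.exp (-θ * u) :=
    setIntegral_mono_set hi (Eventually.of_forall fun u => by
      show 0 ≤ _
      positivity) (before_subset_Ici t).eventuallyLE
  have h4 : ∫ u in before t, -(level lam mu c * Real.exp (-θ * u)) ≤ detJ lam mu c m w t p := by
    refine setIntegral_mono_on (hi.mono_set (before_subset_Ici t)).neg
      (costRate_integrableOn H hw hp t) (measurableSet_before t) fun u hu => ?_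
    exact costRate_ge_exp H hw hp hu.1
  rw [integral_neg] at h4
  linarith

theorem detJ_bddBelow {p : ℝ × ℝ} (hp : 0 ≤ p) :
    BddBelow (range fun t => detJ lam mu c m w t p) :=
  ⟨_, by rintro _ ⟨t, rfl⟩; exact detJ_lower H hw hp t⟩

omit H hw in
theorem detJ_zero (w : ℝ × ℝ → ℝ) (p : ℝ × ℝ) : detJ lam mu c m w 0 p = 0 := by simp [detJ]

theorem detJ₀_le (t : ℝ≥0∞) (p : ℝ × ℝ) : detJ₀ lam mu c m w p ≤ detJ lam mu c m w t (p ⊔ 0) :=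
  ciInf_le (detJ_bddBelow H hw le_sup_right) t

/-- After time `level` / `driftX` the first coordinate alone exceeds `level`, and the integrand is
nonnegative. Bounded horizons suffice, and on them the slopes can be controlled. -/
theorem detJ_min_waitBound_le {p : ℝ × ℝ} (hp : 0 ≤ p) (t : ℝ≥0∞) :
    detJ lam mu c m w (min t (ENNReal.ofReal (waitBound lam mu c m))) p ≤
      detJ lam mu c m w t p := by
  set b := before (ENNReal.ofReal (waitBound lam mu c m)) with hb
  have hbm : MeasurableSet b := measurableSet_before _
  have h1 : detJ lam mu c m w t p = detJ lam mu c m w (min t (ENNReal.ofReal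
      (waitBound lam mu c m))) p + ∫ u in before t \ b, costRate lam mu c m w p u := by
    unfold detJ
    rw [before_min, ← hb, integral_inter_add_sdiff hbm (costRate_integrableOn H hw hp t)]
  rw [h1]
  refine le_add_of_nonneg_right (setIntegral_nonneg ((measurableSet_before t).diff hbm) ?_)
  rintro u ⟨hu, hu'⟩
  have hu0 : 0 ≤ u := hu.1
  rw [hb, before_ofReal] at hu'
  have hu1 : waitBound lam mu c m ≤ u := by
    by_contra hcon
    exact hu' ⟨hu0, not_le.1 hcon⟩
  refine le_trans ?_ (costRate_lower H hw hp hu0)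
  refine mul_nonneg (Real.exp_pos _).le ?_
  unfold waitBound at hu1
  rw [div_le_iff₀ (drift_pos H)] at hu1
  linarith

theorem detJ_mono (t : ℝ≥0∞) {p q : ℝ × ℝ} (hp : 0 ≤ p) (hpq : p ≤ q) :
    detJ lam mu c m w t p ≤ detJ lam mu c m w t q := by
  refine setIntegral_mono_on (costRate_integrableOn H hw hp t)
    (costRate_integrableOn H hw (hp.trans hpq) t) (measurableSet_before t) fun u _ => ?_
  refine mul_le_mul_of_nonneg_left ?_ (Real.exp_pos _).le
  have h1 := flow_mono (m := m) H.lam_pos u hpq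
  have h2 := hw.mono _ _ (jumpMap_mono H.one_lt_mu h1)
  have h3 := mul_le_mul_of_nonneg_left h2 (by linarith [H.one_lt_mu] : 0 ≤ mu)
  have h4 : (flow lam m u p).1 ≤ (flow lam m u q).1 := h1.1
  have h5 : (flow lam m u p).2 ≤ (flow lam m u q).2 := h1.2
  unfold runningCost
  linarith

/-- A jump turns a slope s in the first coordinate into μ(1 - 1/μ)s = (μ-1)s. The constant is the
solution of s = ∫₀ᵀ e^{-(μ-1)u} (1 + (μ-1)s) du with T = `waitBound`, that is, 1 + (μ-1)s =
e^{(μ-1)T}. The second coordinate is the same with μ+1. -/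
theorem costRate_slope {p q : ℝ × ℝ} (hpq : p ≤ q) (u : ℝ) :
    costRate lam mu c m w q u - costRate lam mu c m w p u ≤
      Real.exp (-(mu - 1) * u) *
        (Real.exp ((mu - 1) * waitBound lam mu c m) * (q.1 - p.1)) +
      Real.exp (-(mu + 1) * u) *
        (Real.exp ((mu + 1) * waitBound lam mu c m) * (q.2 - p.2)) := by
  have hmu := H.one_lt_mu
  have h1 := flow_mono (m := m) H.lam_pos u hpq
  have h2 := hw.slope _ _ (jumpMap_mono hmu h1)
  obtain ⟨d1, d2⟩ := flow_sub (m := m) H.lam_pos u p q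
  have ex : (jumpMap mu (flow lam m u q)).1 - (jumpMap mu (flow lam m u p)).1 =
      (1 - 1 / mu) * (Real.exp ((lam + 1) * u) * (q.1 - p.1)) := by
    rw [← d1]; simp only [jumpMap]; ring
  have ey : (jumpMap mu (flow lam m u q)).2 - (jumpMap mu (flow lam m u p)).2 =
      (1 + 1 / mu) * (Real.exp ((lam - 1) * u) * (q.2 - p.2)) := by
    rw [← d2]; simp only [jumpMap]; ring
  rw [ex, ey] at h2
  have sx : 1 + (mu - 1) * slopeX lam mu c m = Real.exp ((mu - 1) * waitBound lam mu c m) := by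
    unfold slopeX
    have : mu - 1 ≠ 0 := by linarith
    field_simp; ring
  have sy : 1 + (mu + 1) * slopeY lam mu c m = Real.exp ((mu + 1) * waitBound lam mu c m) := by
    unfold slopeY
    have : mu + 1 ≠ 0 := by linarith
    field_simp; ring
  have h3 := mul_le_mul_of_nonneg_left h2 (by linarith : 0 ≤ mu)
  have e1 : Real.exp (-(mu - 1) * u) = Real.exp (-(lam + mu) * u) * Real.exp ((lam + 1) * u) := by
    rw [← Real.exp_add]; congr 1; ring
  have e2 : Real.exp (-(mu + 1) * u) = Real.exp (-(lam + mu) * u) * Real.exp ((lam - 1) * u) := by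
    rw [← Real.exp_add]; congr 1; ring
  rw [e1, e2, ← sx, ← sy]
  set E := Real.exp (-(lam + mu) * u)
  set X := Real.exp ((lam + 1) * u) * (q.1 - p.1) with hX
  set Y := Real.exp ((lam - 1) * u) * (q.2 - p.2) with hY
  have h4 : runningCost lam c (flow lam m u q) - runningCost lam c (flow lam m u p) = X + Y := by
    unfold runningCost; linarith
  have hm0 : mu ≠ 0 := by linarith
  have h5 : mu * (slopeX lam mu c m * ((1 - 1 / mu) * X) + slopeY lam mu c m * ((1 + 1 / mu) * Y)) =
      (mu - 1) * slopeX lam mu c m * X + (mu + 1) * slopeY lam mu c m * Y := by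
    field_simp
  rw [h5] at h3
  have h6 : runningCost lam c (flow lam m u q) + mu * w (jumpMap mu (flow lam m u q)) -
      (runningCost lam c (flow lam m u p) + mu * w (jumpMap mu (flow lam m u p))) ≤
      (1 + (mu - 1) * slopeX lam mu c m) * X + (1 + (mu + 1) * slopeY lam mu c m) * Y := by
    linarith
  have h7 := mul_le_mul_of_nonneg_left h6 (Real.exp_pos (-(lam + mu) * u)).le
  unfold costRate
  linarith

/-- Integrating the bound of `costRate_slope` over the full horizon gives back the same slopes,
which are therefore inherited from one iterate to the next. -/
theorem detJ_slope {t : ℝ≥0∞} (ht : t ≤ ENNReal.ofReal (waitBound lam mu c m))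
    {p q : ℝ × ℝ} (hp : 0 ≤ p) (hpq : p ≤ q) :
    detJ lam mu c m w t q - detJ lam mu c m w t p ≤
      slopeX lam mu c m * (q.1 - p.1) + slopeY lam mu c m * (q.2 - p.2) := by
  have hmu := H.one_lt_mu
  have hT := waitBound_pos H
  have h1 : p.1 ≤ q.1 := hpq.1
  have h2 : p.2 ≤ q.2 := hpq.2
  set F : ℝ → ℝ := fun u => Real.exp (-(mu - 1) * u) *
        (Real.exp ((mu - 1) * waitBound lam mu c m) * (q.1 - p.1)) +
      Real.exp (-(mu + 1) * u) *
        (Real.exp ((mu + 1) * waitBound lam mu c m) * (q.2 - p.2)) with hF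
  have hFc : Continuous F := by fun_prop
  have hF0 : ∀ u, 0 ≤ F u := fun u => by
    have := sub_nonneg.2 h1
    have := sub_nonneg.2 h2
    positivity
  have hFi : IntegrableOn F (Ico 0 (waitBound lam mu c m)) :=
    (hFc.integrableOn_Icc).mono_set Ico_subset_Icc_self
  have hsub : before t ⊆ Ico 0 (waitBound lam mu c m) := by
    rw [← before_ofReal]; exact before_mono ht
  have e : ∫ u in Ico 0 (waitBound lam mu c m), F u =
      slopeX lam mu c m * (q.1 - p.1) + slopeY lam mu c m * (q.2 - p.2) := by
    rw [integral_Ico_eq_integral_Ioc, ← intervalIntegral.integral_of_le hT.le, hF,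
      intervalIntegral.integral_add (by apply Continuous.intervalIntegrable; fun_prop)
        (by apply Continuous.intervalIntegrable; fun_prop),
      intervalIntegral.integral_mul_const, intervalIntegral.integral_mul_const]
    have i1 := mul_expInt (-(mu - 1)) (waitBound lam mu c m)
    have i2 := mul_expInt (-(mu + 1)) (waitBound lam mu c m)
    have e1 : Real.exp (-(mu - 1) * waitBound lam mu c m) *
        Real.exp ((mu - 1) * waitBound lam mu c m) = 1 := by
      rw [← Real.exp_add, ← add_mul, neg_add_cancel, zero_mul, Real.exp_zero]
    have e2 : Real.exp (-(mu + 1) * waitBound lam mu c m) *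
        Real.exp ((mu + 1) * waitBound lam mu c m) = 1 := by
      rw [← Real.exp_add, ← add_mul, neg_add_cancel, zero_mul, Real.exp_zero]
    change expInt (-(mu - 1)) (waitBound lam mu c m) * _ +
      expInt (-(mu + 1)) (waitBound lam mu c m) * _ = _
    have m1 : mu - 1 ≠ 0 := by linarith
    have m2 : mu + 1 ≠ 0 := by linarith
    have f1 : expInt (-(mu - 1)) (waitBound lam mu c m) *
        Real.exp ((mu - 1) * waitBound lam mu c m) = slopeX lam mu c m := by
      unfold slopeX
      rw [eq_div_iff m1]
      linear_combination -Real.exp ((mu - 1) * waitBound lam mu c m) * i1 - e1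
    have f2 : expInt (-(mu + 1)) (waitBound lam mu c m) *
        Real.exp ((mu + 1) * waitBound lam mu c m) = slopeY lam mu c m := by
      unfold slopeY
      rw [eq_div_iff m2]
      linear_combination -Real.exp ((mu + 1) * waitBound lam mu c m) * i2 - e2
    rw [← f1, ← f2]; ring
  rw [← e]
  have hint := (costRate_integrableOn H hw (hp.trans hpq) t).sub (costRate_integrableOn H hw hp t)
  unfold detJ
  rw [← integral_sub (costRate_integrableOn H hw (hp.trans hpq) t)
    (costRate_integrableOn H hw hp t)]
  refine (setIntegral_mono_on hint (hFi.mono_set hsub) (measurableSet_before t)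
    fun u _ => costRate_slope H hw hpq u).trans ?_
  exact setIntegral_mono_set hFi (Eventually.of_forall hF0) hsub.eventuallyLE

/-- The flow, the jump map and the running cost are affine, so the integrand is affine plus a
positive multiple of a concave function of an affine one. -/
theorem detJ_concave (t : ℝ≥0∞) {p q : ℝ × ℝ} (hp : 0 ≤ p) (hq : 0 ≤ q) {a b : ℝ}
    (ha : 0 ≤ a) (hb : 0 ≤ b) (hab : a + b = 1) :
    a * detJ lam mu c m w t p + b * detJ lam mu c m w t q ≤
      detJ lam mu c m w t (a • p + b • q) := by
  have hpq : 0 ≤ a • p + b • q := add_nonneg (smul_nonneg ha hp) (smul_nonneg hb hq)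
  have i1 := (costRate_integrableOn H hw hp t).const_mul a
  have i2 := (costRate_integrableOn H hw hq t).const_mul b
  unfold detJ
  rw [← integral_const_mul, ← integral_const_mul, ← integral_add i1 i2]
  refine setIntegral_mono_on (i1.add i2) (costRate_integrableOn H hw hpq t)
    (measurableSet_before t) fun u hu => ?_
  have h1 := hw.concave.2
    (jumpMap_nonneg H.one_lt_mu (flow_nonneg H.lam_pos H.m_mem hu.1 hp))
    (jumpMap_nonneg H.one_lt_mu (flow_nonneg H.lam_pos H.m_mem hu.1 hq)) ha hb hab
  rw [← jumpMap_affine, ← flow_affine H.lam_pos u hab] at h1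
  have h2 := mul_le_mul_of_nonneg_left h1 (by linarith [H.one_lt_mu] : 0 ≤ mu)
  have h3 : runningCost lam c (flow lam m u (a • p + b • q)) =
      a * runningCost lam c (flow lam m u p) + b * runningCost lam c (flow lam m u q) := by
    rw [flow_affine H.lam_pos u hab]
    simp only [runningCost, Prod.fst_add, Prod.snd_add, Prod.smul_fst, Prod.smul_snd, smul_eq_mul]
    linear_combination (lam / c * √2) * hab
  have h4 : a * (runningCost lam c (flow lam m u p) + mu * w (jumpMap mu (flow lam m u p))) +
      b * (runningCost lam c (flow lam m u q) + mu * w (jumpMap mu (flow lam m u q))) ≤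
      runningCost lam c (flow lam m u (a • p + b • q)) +
        mu * w (jumpMap mu (flow lam m u (a • p + b • q))) := by
    rw [h3]
    simp only [smul_eq_mul] at h2
    linarith
  have h5 := mul_le_mul_of_nonneg_left h4 (Real.exp_pos (-(lam + mu) * u)).le
  show a * costRate lam mu c m w p u + b * costRate lam mu c m w q u ≤ _
  unfold costRate
  linarith

theorem admissible_detJ₀ : Admissible lam mu c m (detJ₀ lam mu c m w) where
  nonpos p := by
    have := detJ₀_le H hw 0 p
    rwa [detJ_zero] at this
  lower p := le_ciInf fun t => detJ_lower H hw le_sup_right t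
  mono p q hpq := le_ciInf fun t => (detJ₀_le H hw t p).trans
    (detJ_mono H hw t le_sup_right (sup_le_sup_right hpq 0))
  slope p q hpq := by
    have hx : p.1 ≤ q.1 := hpq.1
    have hy : p.2 ≤ q.2 := hpq.2
    -- Any time used from p, capped at `waitBound` (which does not raise the cost from p), is also
    -- available from q.
    rw [sub_le_comm]
    refine le_ciInf fun t => ?_
    have h1 := detJ₀_le H hw (min t (ENNReal.ofReal (waitBound lam mu c m))) q
    have h2 := detJ_slope H hw (min_le_right t (ENNReal.ofReal (waitBound lam mu c m)))
      (le_sup_right : 0 ≤ p ⊔ 0) (sup_le_sup_right hpq 0)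
    have h3 := detJ_min_waitBound_le H hw (le_sup_right : 0 ≤ p ⊔ 0) t
    have h4 : (q ⊔ 0).1 - (p ⊔ 0).1 ≤ q.1 - p.1 := by
      show max q.1 0 - max p.1 0 ≤ _
      rcases max_cases q.1 0 with h | h <;> rcases max_cases p.1 0 with h' | h' <;>
        rw [h.1, h'.1] <;> linarith
    have h5 : (q ⊔ 0).2 - (p ⊔ 0).2 ≤ q.2 - p.2 := by
      show max q.2 0 - max p.2 0 ≤ _
      rcases max_cases q.2 0 with h | h <;> rcases max_cases p.2 0 with h' | h' <;>
        rw [h.1, h'.1] <;> linarith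
    have h6 := mul_le_mul_of_nonneg_left h4 (slopeX_nonneg H)
    have h7 := mul_le_mul_of_nonneg_left h5 (slopeY_nonneg H)
    linarith
  concave := by
    refine ⟨convex_Ici 0, fun p hp q hq a b ha hb hab => ?_⟩
    have hp' : p ⊔ 0 = p := sup_of_le_left hp
    have hq' : q ⊔ 0 = q := sup_of_le_left hq
    have hpq : 0 ≤ a • p + b • q := add_nonneg (smul_nonneg ha hp) (smul_nonneg hb hq)
    refine le_ciInf fun t => ?_
    rw [sup_of_le_left hpq]
    refine le_trans ?_ (detJ_concave H hw t hp hq ha hb hab)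
    have h1 := detJ₀_le H hw t p
    have h2 := detJ₀_le H hw t q
    rw [hp'] at h1
    rw [hq'] at h2
    simp only [smul_eq_mul]
    gcongr

end


section

variable {lam mu c m : ℝ} (H : Params lam mu c m)

include H

/-! ### Successive approximations -/

theorem admissible_detV (n : ℕ) : Admissible lam mu c m (detV lam mu c m n) := by
  induction n with
  | zero =>
    refine ⟨fun _ => le_rfl, fun _ => ?_, fun _ _ _ => le_rfl, fun p q hpq => ?_,
      concaveOn_const _ (convex_Ici 0)⟩
    · exact neg_nonpos.2 (lossBound_pos H).le
    · have h1 := mul_nonneg (slopeX_nonneg H) (sub_nonneg.2 hpq.1)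
      have h2 := mul_nonneg (slopeY_nonneg H) (sub_nonneg.2 hpq.2)
      simp only [detV]
      linarith
  | succ n ih => exact admissible_detJ₀ H ih

theorem detJ_le_detJ {w w' : ℝ × ℝ → ℝ} (hw : Admissible lam mu c m w)
    (hw' : Admissible lam mu c m w') (hle : ∀ p, w p ≤ w' p) (t : ℝ≥0∞) {p : ℝ × ℝ}
    (hp : 0 ≤ p) : detJ lam mu c m w t p ≤ detJ lam mu c m w' t p := by
  refine setIntegral_mono_on (costRate_integrableOn H hw hp t)
    (costRate_integrableOn H hw' hp t) (measurableSet_before t) fun u _ => ?_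
  refine mul_le_mul_of_nonneg_left (add_le_add_right ?_ _) (Real.exp_pos _).le
  exact mul_le_mul_of_nonneg_left (hle _) (by linarith [H.one_lt_mu])

theorem detJ₀_le_detJ₀ {w w' : ℝ × ℝ → ℝ} (hw : Admissible lam mu c m w)
    (hw' : Admissible lam mu c m w') (hle : ∀ p, w p ≤ w' p) (p : ℝ × ℝ) :
    detJ₀ lam mu c m w p ≤ detJ₀ lam mu c m w' p :=
  le_ciInf fun t => (detJ₀_le H hw t p).trans (detJ_le_detJ H hw hw' hle t le_sup_right)

theorem detV_succ_le (n : ℕ) (p : ℝ × ℝ) : detV lam mu c m (n + 1) p ≤ detV lam mu c m n p := by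
  induction n generalizing p with
  | zero => exact (admissible_detV H 1).nonpos p
  | succ n ih => exact detJ₀_le_detJ₀ H (admissible_detV H (n + 1)) (admissible_detV H n) ih p

theorem detV_antitone (p : ℝ × ℝ) : Antitone fun n => detV lam mu c m n p :=
  antitone_nat_of_succ_le fun n => detV_succ_le H n p

theorem detV_bddBelow (p : ℝ × ℝ) : BddBelow (range fun n => detV lam mu c m n p) :=
  ⟨_, by rintro _ ⟨n, rfl⟩; exact (admissible_detV H n).lower p⟩

theorem limV_le (n : ℕ) (p : ℝ × ℝ) : limV lam mu c m p ≤ detV lam mu c m n p :=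
  ciInf_le (detV_bddBelow H p) n

theorem tendsto_detV (p : ℝ × ℝ) :
    Tendsto (fun n => detV lam mu c m n p) atTop (𝓝 (limV lam mu c m p)) :=
  tendsto_atTop_ciInf (detV_antitone H p) (detV_bddBelow H p)

/-- The conditions are non-strict inequalities between finitely many values, with constants
independent of n, and so survive pointwise limits. -/
theorem admissible_limV : Admissible lam mu c m (limV lam mu c m) where
  nonpos p := (limV_le H 0 p).trans le_rfl
  lower p := le_ciInf fun n => (admissible_detV H n).lower p
  mono p q hpq := le_of_tendsto_of_tendsto' (tendsto_detV H p) (tendsto_detV H q)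
    fun n => (admissible_detV H n).mono p q hpq
  slope p q hpq := le_of_tendsto' ((tendsto_detV H q).sub (tendsto_detV H p))
    fun n => (admissible_detV H n).slope p q hpq
  concave := ⟨convex_Ici 0, fun p hp q hq a b ha hb hab =>
    le_of_tendsto_of_tendsto' (((tendsto_detV H p).const_smul a).add
      ((tendsto_detV H q).const_smul b)) (tendsto_detV H _)
      fun n => (admissible_detV H n).concave.2 hp hq ha hb hab⟩

theorem tendsto_detJ (t : ℝ≥0∞) {p : ℝ × ℝ} (hp : 0 ≤ p) :
    Tendsto (fun n => detJ lam mu c m (detV lam mu c m n) t p) atTop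
      (𝓝 (detJ lam mu c m (limV lam mu c m) t p)) := by
  refine tendsto_integral_of_dominated_convergence
    (fun u => (1 + level lam mu c) * size p * Real.exp (-(mu - 1) * u)) (fun n =>
      (costRate_continuous H (admissible_detV H n) p).aestronglyMeasurable)
    ((integrableOn_bound H p).mono_set (before_subset_Ici t)) (fun n => ?_) ?_
  · refine (ae_restrict_iff' (measurableSet_before t)).2 (Eventually.of_forall fun u hu => ?_)
    exact abs_costRate_le H (admissible_detV H n) hp hu.1
  · refine Eventually.of_forall fun u => ?_
    exact (((tendsto_detV H _).const_mul mu).const_add _).const_mul _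

/-- The limit of the successive approximations solves the dynamic programming equation. -/
theorem detJ₀_limV (p : ℝ × ℝ) : detJ₀ lam mu c m (limV lam mu c m) p = limV lam mu c m p := by
  apply le_antisymm
  · refine le_ciInf fun n => ?_
    refine le_trans ?_ (detV_succ_le H n p)
    exact detJ₀_le_detJ₀ H (admissible_limV H) (admissible_detV H n) (limV_le H n) p
  · refine le_ciInf fun t => ge_of_tendsto' (tendsto_detJ H t le_sup_right) fun n => ?_
    exact (limV_le H (n + 1) p).trans (detJ₀_le H (admissible_detV H n) t p)

theorem limV_le_detJ (t : ℝ≥0∞) {p : ℝ × ℝ} (hp : 0 ≤ p) :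
    limV lam mu c m p ≤ detJ lam mu c m (limV lam mu c m) t p := by
  have := detJ₀_le H (admissible_limV H) t p
  rwa [detJ₀_limV H, sup_of_le_left hp] at this

/-! ### Dynamic programming in time -/

omit H in
theorem costRate_add (w : ℝ × ℝ → ℝ) (p : ℝ × ℝ) (h u : ℝ) :
    costRate lam mu c m w p (u + h) =
      Real.exp (-(lam + mu) * h) * costRate lam mu c m w (flow lam m h p) u := by
  unfold costRate
  rw [flow_add, mul_add (-(lam + mu)), Real.exp_add]; ring

theorem detJ_add {w : ℝ × ℝ → ℝ} (hw : Admissible lam mu c m w) {h : ℝ} (hh : 0 ≤ h) (t : ℝ≥0∞)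
    {p : ℝ × ℝ} (hp : 0 ≤ p) :
    detJ lam mu c m w (ENNReal.ofReal h + t) p = detJ lam mu c m w (ENNReal.ofReal h) p +
      Real.exp (-(lam + mu) * h) * detJ lam mu c m w t (flow lam m h p) := by
  have hb : before (ENNReal.ofReal h + t) ∩ before (ENNReal.ofReal h) =
      before (ENNReal.ofReal h) := inter_eq_right.2 (before_mono le_self_add)
  have hd : ∀ u : ℝ, u + h ∈ before (ENNReal.ofReal h + t) \ before (ENNReal.ofReal h) ↔
      u ∈ before t := by
    intro u
    rw [before_ofReal]
    simp only [before, Set.mem_sdiff, mem_ofPred_eq, mem_Ico, not_and, not_lt]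
    constructor
    · rintro ⟨⟨h1, h2⟩, h3⟩
      have hu : 0 ≤ u := by linarith [h3 h1]
      rw [ENNReal.ofReal_add hu hh, add_comm] at h2
      exact ⟨hu, lt_of_add_lt_add_left h2⟩
    · rintro ⟨hu, h2⟩
      refine ⟨⟨by linarith, ?_⟩, fun _ => by linarith⟩
      rw [ENNReal.ofReal_add hu hh, add_comm]
      exact ENNReal.add_lt_add_left ENNReal.ofReal_ne_top h2
  have hm1 := measurableSet_before (ENNReal.ofReal h)
  have hm2 := measurableSet_before (ENNReal.ofReal h + t)
  unfold detJ
  rw [← integral_inter_add_sdiff hm1 (costRate_integrableOn H hw hp _), hb]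
  congr 1
  rw [← integral_const_mul, ← integral_indicator (hm2.diff hm1),
    ← integral_indicator (measurableSet_before t),
    ← integral_add_right_eq_self _ h]
  congr 1
  funext u
  by_cases hu : u ∈ before t
  · rw [indicator_of_mem hu, indicator_of_mem ((hd u).2 hu), costRate_add]
  · rw [indicator_of_notMem hu, indicator_of_notMem (fun h' => hu ((hd u).1 h'))]

/-- Continuing for a fixed time `h` and then optimally. -/
noncomputable def detStep (lam mu c m h : ℝ) (p : ℝ × ℝ) : ℝ :=
  detJ lam mu c m (limV lam mu c m) (ENNReal.ofReal h) p +
    Real.exp (-(lam + mu) * h) * limV lam mu c m (flow lam m h p)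

/-- The value at the endpoint of the flow is an infimum over times t, and every h + t is a competing
time for p. -/
theorem limV_le_detStep {h : ℝ} (hh : 0 ≤ h) {p : ℝ × ℝ} (hp : 0 ≤ p) :
    limV lam mu c m p ≤ detStep lam mu c m h p := by
  have hq := flow_nonneg H.lam_pos H.m_mem hh hp
  have hE := Real.exp_pos (-(lam + mu) * h)
  have key : (limV lam mu c m p - detJ lam mu c m (limV lam mu c m) (ENNReal.ofReal h) p) /
      Real.exp (-(lam + mu) * h) ≤ limV lam mu c m (flow lam m h p) := by
    rw [← detJ₀_limV H (flow lam m h p)]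
    refine le_ciInf fun t => ?_
    rw [sup_of_le_left hq, div_le_iff₀ hE]
    have := limV_le_detJ H (ENNReal.ofReal h + t) hp
    rw [detJ_add H (admissible_limV H) hh t hp] at this
    linarith
  rw [div_le_iff₀ hE] at key
  unfold detStep
  linarith

/-- The rate of cost is at least -`level`, so stopping before h gains at most `level` h. -/
theorem detJ_ofReal_lower {w : ℝ × ℝ → ℝ} (hw : Admissible lam mu c m w) {h : ℝ}
    (hh : 0 ≤ h) {t : ℝ≥0∞} (ht : t ≤ ENNReal.ofReal h) {p : ℝ × ℝ} (hp : 0 ≤ p) :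
    -(level lam mu c * h) ≤ detJ lam mu c m w t p := by
  have hK := level_pos H
  have hsub : before t ⊆ Ico 0 h := by rw [← before_ofReal]; exact before_mono ht
  have hi : IntegrableOn (fun _ : ℝ => level lam mu c) (Ico 0 h) := by simp
  have h1 : ∫ u in before t, -(level lam mu c) ≤ detJ lam mu c m w t p := by
    refine setIntegral_mono_on (hi.mono_set hsub).neg
      (costRate_integrableOn H hw hp t) (measurableSet_before t) fun u hu => ?_
    refine le_trans ?_ (costRate_ge_exp H hw hp hu.1)
    rw [neg_le_neg_iff]
    refine mul_le_of_le_one_right hK.le (Real.exp_le_one_iff.2 ?_)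
    have h1 := H.lam_pos
    have h2 := H.one_lt_mu
    have h3 := div_pos (drift_pos H) hK
    have hu0 : 0 ≤ u := hu.1
    nlinarith
  have h2 : ∫ u in before t, level lam mu c ≤ ∫ u in Ico 0 h, level lam mu c :=
    setIntegral_mono_set hi (Eventually.of_forall fun u => hK.le) hsub.eventuallyLE
  rw [integral_neg] at h1
  simp [hh] at h2
  rw [integral_const] at h1
  simp at h1
  linarith

/-- When the value is below -`level` h, no time t ≤ h comes close to it. A time doing better than
`detStep` would thus be h + s, and after time h it could not beat `limV` at the endpoint of the
flow. -/
theorem detStep_le_limV {h : ℝ} (hh : 0 ≤ h) {p : ℝ × ℝ} (hp : 0 ≤ p)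
    (hv : limV lam mu c m p < -(level lam mu c * h)) :
    detStep lam mu c m h p ≤ limV lam mu c m p := by
  have hw := admissible_limV H
  by_contra! hcon
  have : detJ₀ lam mu c m (limV lam mu c m) p <
      min (detStep lam mu c m h p) (-(level lam mu c * h)) := by
    rw [detJ₀_limV H]; exact lt_min hcon hv
  obtain ⟨t, ht⟩ := exists_lt_of_ciInf_lt this
  rw [sup_of_le_left hp] at ht
  rcases le_total t (ENNReal.ofReal h) with hle | hle
  · have h1 := detJ_ofReal_lower H hw hh hle hp
    linarith [ht.trans_le (min_le_right _ _)]
  · obtain ⟨s, rfl⟩ := exists_add_of_le hle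
    rw [detJ_add H hw hh s hp] at ht
    have h1 := limV_le_detJ H s (flow_nonneg H.lam_pos H.m_mem hh hp)
    have h2 := mul_le_mul_of_nonneg_left h1 (Real.exp_pos (-(lam + mu) * h)).le
    have h3 := ht.trans_le (min_le_left _ _)
    unfold detStep at h3
    linarith

/-! ### Where the value function vanishes and where it does not -/

/-- The rate of cost is nonnegative along the whole trajectory, so stopping at once is optimal. -/
theorem detJ₀_eq_zero {w : ℝ × ℝ → ℝ} (hw : Admissible lam mu c m w) {p : ℝ × ℝ} (hp : 0 ≤ p)
    (hflow : ∀ s, 0 ≤ s → level lam mu c - mu * (√2 / c - lossBound lam mu c m) ≤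
      (flow lam m s p).1 + (flow lam m s p).2) : detJ₀ lam mu c m w p = 0 := by
  refine le_antisymm ((admissible_detJ₀ H hw).nonpos p) (le_ciInf fun t => ?_)
  rw [sup_of_le_left hp]
  refine setIntegral_nonneg (measurableSet_before t) fun u hu => ?_
  refine mul_nonneg (Real.exp_pos _).le ?_
  linarith [cost_lower H hw (flow lam m u p), hflow u hu.1]

/-- As w ≤ 0, the rate at time 0 is at most the running cost at p, which is negative; by continuity
a short wait pays. -/
theorem detJ₀_neg {w : ℝ × ℝ → ℝ} (hw : Admissible lam mu c m w) {p : ℝ × ℝ} (hp : 0 ≤ p)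
    (hlt : p.1 + p.2 < lam / c * √2) : detJ₀ lam mu c m w p < 0 := by
  have hc := costRate_continuous H hw p
  have h0 : costRate lam mu c m w p 0 < 0 := by
    have h1 := hw.nonpos (jumpMap mu p)
    have h2 := mul_nonpos_of_nonneg_of_nonpos (by linarith [H.one_lt_mu] : 0 ≤ mu) h1
    simp only [costRate, runningCost, flow_zero, mul_zero, Real.exp_zero, one_mul]
    linarith
  obtain ⟨η, hη, hη'⟩ := exists_between h0
  have h1 : ∀ᶠ u in 𝓝 (0 : ℝ), costRate lam mu c m w p u < η :=
    (hc.tendsto 0).eventually_lt_const hη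
  obtain ⟨ε, hε, hball⟩ := Metric.eventually_nhds_iff.1 h1
  have h2 := detJ₀_le H hw (ENNReal.ofReal ε) p
  rw [sup_of_le_left hp] at h2
  refine h2.trans_lt ?_
  have h3 : detJ lam mu c m w (ENNReal.ofReal ε) p ≤ ∫ _ in Ico 0 ε, η := by
    have := costRate_integrableOn H hw hp (ENNReal.ofReal ε)
    unfold detJ
    rw [before_ofReal] at this ⊢
    refine setIntegral_mono_on this (by simp) measurableSet_Ico fun u hu => ?_
    refine (hball ?_).le
    rw [Real.dist_eq, sub_zero, abs_of_nonneg hu.1]; exact hu.2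
  refine h3.trans_lt ?_
  simp [hε.le]
  exact mul_neg_of_pos_of_neg hε hη'

end


theorem measurable_select_nat {α β : Type*} {mα : MeasurableSpace α} {mβ : MeasurableSpace β}
    {f : ℕ → α → β} {n : α → ℕ} (hf : ∀ k, Measurable (f k)) (hn : Measurable n) :
    Measurable fun a => f (n a) a :=
  (measurable_from_prod_countable_left (f := fun r : α × ℕ => f r.2 r.1) hf).comp
    (measurable_id.prodMk hn)

section

variable {Ω : Type*} [mΩ : MeasurableSpace Ω] {P : Measure Ω} {N : ℝ≥0 → Ω → ℕ} {mu : ℝ}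

section Paths

variable (hN : IsPoissonProcess N mu P)

include hN

/-! ### Jump times -/

/-- A right-continuous integer-valued path is constant on some interval [t, t + ε), so an infimum of
at most t is witnessed at t itself. -/
theorem jumpTime_le_iff (n : ℕ) (t : ℝ≥0) (ω : Ω) : jumpTime N n ω ≤ t ↔ n ≤ N t ω := by
  refine ⟨fun h => ?_, fun h => iInf₂_le t h⟩
  have hc := hN.rightCont ω t
  have h1 : ∀ᶠ s in 𝓝[≥] t, N s ω = N t ω := by
    have : {N t ω} ∈ 𝓝 (N t ω) := by simp
    exact hc this
  have h2 : ∀ᶠ s in 𝓝[>] t, N s ω = N t ω := h1.filter_mono (nhdsWithin_mono _ Ioi_subset_Ici_self)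
  obtain ⟨s, hs, hts⟩ := (h2.and self_mem_nhdsWithin).exists
  have h3 : jumpTime N n ω < s := h.trans_lt (ENNReal.coe_lt_coe.2 hts)
  unfold jumpTime at h3
  simp only [iInf_lt_iff] at h3
  obtain ⟨u, hu, hus⟩ := h3
  rw [← hs]
  exact hu.trans (hN.mono ω (ENNReal.coe_lt_coe.1 hus).le)

theorem lt_jumpTime_iff (n : ℕ) (t : ℝ≥0) (ω : Ω) : (t : ℝ≥0∞) < jumpTime N n ω ↔ N t ω < n := by
  rw [← not_le, jumpTime_le_iff hN, not_le]

theorem jumpTime_zero (ω : Ω) : jumpTime N 0 ω = 0 := by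
  have := (jumpTime_le_iff hN 0 0 ω).2 (Nat.zero_le _)
  simpa using this

omit mΩ hN in
theorem jumpTime_mono (ω : Ω) : Monotone fun n => jumpTime N n ω := fun _ _ hab =>
  iInf_mono fun _ => iInf_mono' fun h => ⟨hab.trans h, le_rfl⟩

theorem jumpTime_self_le (t : ℝ≥0) (ω : Ω) : jumpTime N (N t ω) ω ≤ t :=
  (jumpTime_le_iff hN _ t ω).2 le_rfl

theorem jumpTime_one_pos (ω : Ω) : 0 < jumpTime N 1 ω := by
  have := (lt_jumpTime_iff hN 1 0 ω).2 (by rw [hN.zero]; exact one_pos)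
  simpa using this

/-- Truncated at t, a jump time depends only on the path up to t; this is what makes the statistic
adapted. -/
theorem measurable_jumpTime_min {m : MeasurableSpace Ω} {t : ℝ≥0}
    (hm : ∀ s ≤ t, Measurable[m] (N s)) (n : ℕ) :
    Measurable[m] fun ω => min (jumpTime N n ω) t := by
  refine measurable_of_Iic fun x => ?_
  by_cases hx : (t : ℝ≥0∞) ≤ x
  · have : (fun ω => min (jumpTime N n ω) t) ⁻¹' Iic x = univ := by
      ext ω; simp [hx]
    rw [this]; exact MeasurableSet.univ
  · push Not at hx
    lift x to ℝ≥0 using hx.ne_top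
    have hxt : x ≤ t := (ENNReal.coe_lt_coe.1 hx).le
    have hiff := jumpTime_le_iff (mΩ := mΩ) hN n x
    have : (fun ω => min (jumpTime N n ω) t) ⁻¹' Iic (x : ℝ≥0∞) = N x ⁻¹' Ici n := by
      ext ω
      simp only [mem_preimage, mem_Iic, min_le_iff, mem_Ici, hiff]
      simp [not_le.2 hx]
    rw [this]
    exact hm x hxt measurableSet_Ici

theorem measurable_jumpTime (n : ℕ) : Measurable (jumpTime N n) := by
  refine measurable_of_Iic fun x => ?_
  induction x with
  | top => simp
  | coe x =>
    have : jumpTime N n ⁻¹' Iic (x : ℝ≥0∞) = N x ⁻¹' Ici n := by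
      ext ω
      simp [jumpTime_le_iff hN]
    rw [this]
    exact hN.measurable x measurableSet_Ici

theorem measurable_process : Measurable fun q : ℝ × Ω => N q.1.toNNReal q.2 := by
  refine measurable_of_Ici fun n => ?_
  have : (fun q : ℝ × Ω => N q.1.toNNReal q.2) ⁻¹' Ici n =
      {q : ℝ × Ω | jumpTime N n q.2 ≤ ENNReal.ofReal q.1} := by
    ext q
    simp only [mem_preimage, mem_Ici, mem_ofPred_eq]
    exact (jumpTime_le_iff hN n q.1.toNNReal q.2).symm
  rw [this]
  exact measurableSet_le ((measurable_jumpTime hN n).comp measurable_snd)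
    (ENNReal.measurable_ofReal.comp measurable_fst)

end Paths

/-! ### The chain of values at the jump times -/

/-- The values at the jump times, for a given sequence of jump times. -/
noncomputable def jumpChain (lam mu m : ℝ) (p : ℝ × ℝ) (σ : ℕ → ℝ≥0∞) : ℕ → ℝ × ℝ
  | 0 => p
  | n + 1 => jumpMap mu (flow lam m (σ (n + 1) - σ n).toReal (jumpChain lam mu m p σ n))

omit mΩ in
theorem postJump_eq (lam m : ℝ) (p : ℝ × ℝ) (n : ℕ) (ω : Ω) :
    postJump lam mu m N p n ω = jumpChain lam mu m p (fun k => jumpTime N k ω) n := by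
  induction n with
  | zero => rfl
  | succ n ih => simp only [postJump, jumpChain, ih]

theorem jumpChain_congr (lam m : ℝ) (p : ℝ × ℝ) {σ σ' : ℕ → ℝ≥0∞} {n : ℕ}
    (h : ∀ k ≤ n, σ k = σ' k) : jumpChain lam mu m p σ n = jumpChain lam mu m p σ' n := by
  induction n with
  | zero => rfl
  | succ n ih =>
    simp only [jumpChain, ih fun k hk => h k (hk.trans n.le_succ), h (n + 1) le_rfl,
      h n n.le_succ]

omit mΩ in
theorem measurable_jumpChain {lam : ℝ} (hlam : 0 < lam) (m : ℝ) (p : ℝ × ℝ)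
    {mm : MeasurableSpace Ω} {σ : Ω → ℕ → ℝ≥0∞} (hσ : ∀ k, Measurable[mm] fun ω => σ ω k) (n : ℕ) :
    Measurable[mm] fun ω => jumpChain lam mu m p (σ ω) n := by
  induction n with
  | zero => exact measurable_const
  | succ n ih =>
    have h1 : Measurable[mm] fun ω => ((σ ω (n + 1) - σ ω n).toReal,
        jumpChain lam mu m p (σ ω) n) :=
      (((hσ (n + 1)).sub (hσ n)).ennreal_toReal).prodMk ih
    exact (jumpMap_continuous.measurable.comp (flow_continuous hlam m).measurable).comp h1

/-! ### Paths of the statistic: restarting at time t, growth, measurability and adaptedness -/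

section Statistic

variable {lam c m : ℝ} (hN : IsPoissonProcess N mu P) (H : Params lam mu c m) (p : ℝ × ℝ)

include hN

omit mΩ hN in
theorem postJump_succ {n : ℕ} {ω : Ω} (h : jumpTime N (n + 1) ω ≠ ⊤) :
    postJump lam mu m N p (n + 1) ω = jumpMap mu (flow lam m
      ((jumpTime N (n + 1) ω).toReal - (jumpTime N n ω).toReal)
      (postJump lam mu m N p n ω)) := by
  rw [postJump, ENNReal.toReal_sub_of_le (jumpTime_mono ω n.le_succ) h]

omit mΩ hN in
theorem statistic_coe (t : ℝ≥0) (ω : Ω) : statistic lam mu m N p t ω =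
    flow lam m (t - (jumpTime N (N t ω) ω).toReal) (postJump lam mu m N p (N t ω) ω) := by
  simp [statistic]

theorem statistic_zero (ω : Ω) : statistic lam mu m N p 0 ω = p := by
  simp [statistic, hN.zero, jumpTime_zero hN, postJump]

theorem toReal_jumpTime_le {n : ℕ} {t : ℝ≥0} {ω : Ω} (h : n ≤ N t ω) :
    (jumpTime N n ω).toReal ≤ t := by
  have := ENNReal.toReal_mono ENNReal.coe_ne_top ((jumpTime_le_iff hN n t ω).2 h)
  simpa using this

theorem jumpTime_ne_top {n : ℕ} {t : ℝ≥0} {ω : Ω} (h : n ≤ N t ω) : jumpTime N n ω ≠ ⊤ :=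
  ne_top_of_le_ne_top ENNReal.coe_ne_top ((jumpTime_le_iff hN n t ω).2 h)

theorem le_toReal_jumpTime {n : ℕ} {t : ℝ≥0} {ω : Ω} (h : N t ω < n) (hn : jumpTime N n ω ≠ ⊤) :
    t ≤ (jumpTime N n ω).toReal := by
  have := ENNReal.toReal_mono hn ((lt_jumpTime_iff hN n t ω).2 h).le
  simpa using this

omit mΩ hN in
/-- Without a jump the statistic follows the flow. -/
theorem statistic_of_eq {t s : ℝ≥0} {ω : Ω} (h : N (t + s) ω = N t ω) :
    statistic lam mu m N p (t + s : ℝ) ω = flow lam m s (statistic lam mu m N p t ω) := by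
  rw [← NNReal.coe_add, statistic_coe, statistic_coe, h, ← flow_add]
  congr 1; push_cast; ring

omit mΩ hN in
/-- The value after the first jump after time `t`. -/
theorem postJump_succ_self {t : ℝ≥0} {ω : Ω} (h : jumpTime N (N t ω + 1) ω ≠ ⊤) :
    postJump lam mu m N p (N t ω + 1) ω = jumpMap mu (flow lam m
      ((jumpTime N (N t ω + 1) ω).toReal - t) (statistic lam mu m N p t ω)) := by
  rw [postJump_succ p h, statistic_coe, ← flow_add]
  congr 2; ring

/-- With exactly one jump. -/
theorem statistic_of_succ {t s : ℝ≥0} {ω : Ω} (h : N (t + s) ω = N t ω + 1) :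
    ∃ r : ℝ, 0 ≤ r ∧ r ≤ s ∧ statistic lam mu m N p (t + s : ℝ) ω =
      flow lam m (s - r) (jumpMap mu (flow lam m r (statistic lam mu m N p t ω))) := by
  have hfin : jumpTime N (N t ω + 1) ω ≠ ⊤ := jumpTime_ne_top hN h.ge
  refine ⟨(jumpTime N (N t ω + 1) ω).toReal - t, ?_, ?_, ?_⟩
  · exact sub_nonneg.2 (le_toReal_jumpTime hN (Nat.lt_add_one _) hfin)
  · have := toReal_jumpTime_le hN h.ge
    push_cast at this
    linarith
  · rw [← NNReal.coe_add, statistic_coe, h, postJump_succ_self p hfin]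
    congr 1; push_cast; ring

include H

variable {p}

omit mΩ hN in
theorem postJump_nonneg (hp : 0 ≤ p) (n : ℕ) (ω : Ω) : 0 ≤ postJump lam mu m N p n ω := by
  induction n with
  | zero => exact hp
  | succ n ih =>
    exact jumpMap_nonneg H.one_lt_mu (flow_nonneg H.lam_pos H.m_mem ENNReal.toReal_nonneg ih)

theorem statistic_nonneg (hp : 0 ≤ p) {t : ℝ} (ht : 0 ≤ t) (ω : Ω) :
    0 ≤ statistic lam mu m N p t ω := by
  lift t to ℝ≥0 using ht
  rw [statistic_coe]
  refine flow_nonneg H.lam_pos H.m_mem ?_ (postJump_nonneg H hp _ ω)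
  exact sub_nonneg.2 (toReal_jumpTime_le hN le_rfl)

/-- Each jump after t contributes a factor 1 + 1/μ, and the exponential factors multiply along the
waiting times. Finiteness is required since `toReal` sends ∞ to 0. -/
theorem size_postJump_le (hp : 0 ≤ p) (t : ℝ≥0) {ω : Ω} (k : ℕ)
    (hfin : jumpTime N (N t ω + 1 + k) ω ≠ ⊤) :
    size (postJump lam mu m N p (N t ω + 1 + k) ω) ≤
      Real.exp ((lam + 1) * ((jumpTime N (N t ω + 1 + k) ω).toReal - t)) *
        (1 + 1 / mu) ^ (k + 1) * size (statistic lam mu m N p t ω) := by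
  have hρ : 0 ≤ 1 + 1 / mu := by have := H.one_lt_mu; positivity
  induction k with
  | zero =>
    have hq := statistic_nonneg hN H hp t.2 ω
    simp only [add_zero] at hfin ⊢
    rw [postJump_succ_self p hfin]
    have h0 := sub_nonneg.2 (le_toReal_jumpTime hN (Nat.lt_add_one (N t ω)) hfin)
    have h1 := size_flow_le H.lam_pos H.m_mem h0 hq
    have h2 := size_jumpMap_le H.one_lt_mu (flow_nonneg H.lam_pos H.m_mem h0 hq)
    refine h2.trans ((mul_le_mul_of_nonneg_left h1 hρ).trans (le_of_eq ?_))
    rw [zero_add, pow_one, mul_comm (Real.exp _) (1 + 1 / mu), mul_assoc]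
    rfl
  | succ k ih =>
    have hle : jumpTime N (N t ω + 1 + k) ω ≤ jumpTime N (N t ω + 1 + (k + 1)) ω :=
      jumpTime_mono ω (by omega)
    have hfin' := ne_top_of_le_ne_top hfin hle
    have h0 := sub_nonneg.2 (ENNReal.toReal_mono hfin hle)
    have hq := postJump_nonneg (N := N) H hp (N t ω + 1 + k) ω
    have h1 := size_flow_le H.lam_pos H.m_mem h0 hq
    have h2 := size_jumpMap_le H.one_lt_mu (flow_nonneg H.lam_pos H.m_mem h0 hq)
    have h3 := ih hfin'
    show size (postJump lam mu m N p (N t ω + 1 + k + 1) ω) ≤ _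
    rw [postJump_succ p (n := N t ω + 1 + k) hfin]
    refine h2.trans ((mul_le_mul_of_nonneg_left (h1.trans
      (mul_le_mul_of_nonneg_left h3 (Real.exp_pos _).le)) hρ).trans (le_of_eq ?_))
    have e : Real.exp ((lam + 1) * ((jumpTime N (N t ω + 1 + (k + 1)) ω).toReal - t)) =
        Real.exp ((lam + 1) * ((jumpTime N (N t ω + 1 + (k + 1)) ω).toReal -
          (jumpTime N (N t ω + 1 + k) ω).toReal)) *
        Real.exp ((lam + 1) * ((jumpTime N (N t ω + 1 + k) ω).toReal - t)) := by
      rw [← Real.exp_add]; congr 1; ring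
    rw [e]; ring

/-- Growth of the statistic over an interval. -/
theorem size_statistic_le (hp : 0 ≤ p) (t s : ℝ≥0) (ω : Ω) :
    size (statistic lam mu m N p (t + s : ℝ) ω) ≤ Real.exp ((lam + 1) * s) *
      (1 + 1 / mu) ^ (N (t + s) ω - N t ω) * size (statistic lam mu m N p t ω) := by
  have hq := statistic_nonneg hN H hp t.2 ω
  have hle : N t ω ≤ N (t + s) ω := hN.mono ω le_self_add
  rcases hle.eq_or_lt with h | h
  · rw [statistic_of_eq p h.symm, ← h]
    simpa using size_flow_le H.lam_pos H.m_mem s.2 hq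
  · obtain ⟨k, hk⟩ := Nat.exists_eq_add_of_lt h
    have hk' : N (t + s) ω = N t ω + 1 + k := by omega
    have hfin : jumpTime N (N t ω + 1 + k) ω ≠ ⊤ := jumpTime_ne_top hN hk'.ge
    have hj := toReal_jumpTime_le hN hk'.ge
    have h1 := size_postJump_le hN H hp t k hfin
    rw [← NNReal.coe_add, statistic_coe, hk']
    have h2 := size_flow_le H.lam_pos H.m_mem (sub_nonneg.2 hj)
      (postJump_nonneg (N := N) H hp (N t ω + 1 + k) ω)
    refine (h2.trans (mul_le_mul_of_nonneg_left h1 (Real.exp_pos _).le)).trans (le_of_eq ?_)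
    have e : Real.exp ((lam + 1) * s) =
        Real.exp ((lam + 1) * (((t + s : ℝ≥0) : ℝ) - (jumpTime N (N t ω + 1 + k) ω).toReal)) *
        Real.exp ((lam + 1) * ((jumpTime N (N t ω + 1 + k) ω).toReal - t)) := by
      rw [← Real.exp_add]; congr 1; push_cast; ring
    have e2 : N t ω + 1 + k - N t ω = k + 1 := by omega
    rw [e, e2]; ring

theorem measurable_statistic (p : ℝ × ℝ) :
    Measurable fun q : ℝ × Ω => statistic lam mu m N p q.1 q.2 := by
  have h1 : ∀ n : ℕ, Measurable fun q : ℝ × Ω =>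
      flow lam m (q.1 - (jumpTime N n q.2).toReal) (postJump lam mu m N p n q.2) := by
    intro n
    have h2 : Measurable fun ω => postJump lam mu m N p n ω := by
      simp only [postJump_eq]
      exact measurable_jumpChain H.lam_pos m p (fun k => measurable_jumpTime hN k) n
    have h3 : Measurable fun q : ℝ × Ω => (q.1 - (jumpTime N n q.2).toReal,
        postJump lam mu m N p n q.2) :=
      (measurable_fst.sub ((measurable_jumpTime hN n).comp measurable_snd).ennreal_toReal).prodMk
        (h2.comp measurable_snd)
    exact (flow_continuous H.lam_pos m).measurable.comp h3
  exact measurable_select_nat h1 (measurable_process hN)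

/-- The statistic is adapted to every filtration to which `N` is adapted. -/
theorem measurable_statistic_adapted (p : ℝ × ℝ) {mm : MeasurableSpace Ω} {t : ℝ≥0}
    (hm : ∀ s ≤ t, Measurable[mm] (N s)) :
    Measurable[mm] fun ω => statistic lam mu m N p t ω := by
  have hmin := measurable_jumpTime_min (mΩ := mΩ) hN hm
  have h1 : ∀ n : ℕ, Measurable[mm] fun ω =>
      flow lam m (t - (min (jumpTime N n ω) t).toReal)
        (jumpChain lam mu m p (fun k => min (jumpTime N k ω) t) n) := by
    intro n
    have h3 : Measurable[mm] fun ω => ((t : ℝ) - (min (jumpTime N n ω) t).toReal,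
        jumpChain lam mu m p (fun k => min (jumpTime N k ω) t) n) :=
      (measurable_const.sub (hmin n).ennreal_toReal).prodMk
        (measurable_jumpChain H.lam_pos m p hmin n)
    exact (flow_continuous H.lam_pos m).measurable.comp h3
  -- The jump times with index at most N_t do not exceed t, so truncating them at t changes nothing.
  have h5 : (fun ω => statistic lam mu m N p t ω) = fun ω =>
      flow lam m (t - (min (jumpTime N (N t ω) ω) t).toReal)
        (jumpChain lam mu m p (fun k => min (jumpTime N k ω) t) (N t ω)) := by
    funext ω
    rw [statistic_coe, min_eq_left (jumpTime_self_le (mΩ := mΩ) hN t ω), postJump_eq]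
    congr 1
    refine jumpChain_congr lam m p fun k hk => ?_
    exact (min_eq_left ((jumpTime_le_iff (mΩ := mΩ) hN k t ω).2 hk)).symm
  rw [h5]
  exact measurable_select_nat h1 (hm t le_rfl)

end Statistic

end


section

variable {Ω : Type*} [mΩ : MeasurableSpace Ω] {P : Measure Ω} {N : ℝ≥0 → Ω → ℕ} {mu : ℝ}

/-! ### Independence of the past -/

/-- The σ-algebra generated by the process up to time `t`. -/
@[reducible] def past {Ω : Type*} (N : ℝ≥0 → Ω → ℕ) (t : ℝ≥0) : MeasurableSpace Ω :=
  ⨆ j ≤ t, MeasurableSpace.comap (N j) ⊤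

omit mΩ in
theorem measurable_past {s t : ℝ≥0} (h : s ≤ t) : Measurable[past N t] (N s) := by
  have : MeasurableSpace.comap (N s) ⊤ ≤ past N t :=
    le_iSup₂_of_le (f := fun j (_ : j ≤ t) => MeasurableSpace.comap (N j) ⊤) s h le_rfl
  exact (comap_measurable (N s)).mono this le_rfl

variable (hN : IsPoissonProcess N mu P)

include hN

theorem past_le (t : ℝ≥0) : past N t ≤ mΩ :=
  iSup₂_le fun j _ => (hN.measurable j).comap_le

/-- N at the times in S is a partial sum of increments over a grid through S, and these are
independent of the last increment, over (s, t]. -/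
theorem indep_finset_past [IsProbabilityMeasure P] {s t : ℝ≥0} (hst : s ≤ t) (S : Finset ℝ≥0)
    (hS : ∀ j ∈ S, j ≤ s) :
    Indep (⨆ j ∈ S, MeasurableSpace.comap (N j) ⊤)
      (MeasurableSpace.comap (fun ω => N t ω - N s ω) ⊤) P := by
  classical
  set n := S.card with hn
  set e := S.orderEmbOfFin hn.symm with he
  -- The grid is 0, the n sorted points of S at indices 1, …, n, then s at n + 1, then t forever.
  -- Increment n + 1 is the one over (s, t].
  set u : ℕ → ℝ≥0 := fun i => if i = 0 then 0 else
    if h : i - 1 < n then e ⟨i - 1, h⟩ else if i = n + 1 then s else t with hu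
  have hes : ∀ i, e i ≤ s := fun i => hS _ (S.orderEmbOfFin_mem _ i)
  have hmono : Monotone u := by
    refine monotone_nat_of_le_succ fun i => ?_
    simp only [hu]
    rcases Nat.eq_zero_or_pos i with rfl | hi
    · simp
    · rw [if_neg hi.ne', if_neg (Nat.succ_ne_zero i)]
      by_cases h1 : i < n
      · rw [dif_pos (by omega), dif_pos (show i + 1 - 1 < n by omega)]
        exact e.monotone (by simp [Fin.le_def])
      · rw [dif_neg (show ¬ (i + 1 - 1 < n) by omega)]
        by_cases h2 : i - 1 < n
        · rw [dif_pos h2]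
          split_ifs
          · exact hes _
          · exact (hes _).trans hst
        · rw [dif_neg h2]
          split_ifs <;> first | exact le_rfl | exact hst | omega
  have hind := hN.indep.nat hmono
  set X : ℕ → Ω → ℕ := fun i ω => N (u (i + 1)) ω - N (u i) ω with hX
  have hle : ∀ i, MeasurableSpace.comap (X i) ⊤ ≤ mΩ := fun i =>
    ((hN.measurable _).sub (hN.measurable _)).comap_le
  have hsum : ∀ k ω, N (u k) ω = ∑ i ∈ Finset.range k, X i ω := by
    intro k ω
    induction k with
    | zero => simp [hu, hN.zero]
    | succ k ih =>
      rw [Finset.sum_range_succ, ← ih]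
      have : N (u k) ω ≤ N (u (k + 1)) ω := hN.mono ω (hmono k.le_succ)
      simp only [hX]
      omega
  have hdis : Disjoint {i | i < n + 1} {n + 1} := by
    rw [Set.disjoint_singleton_right]; simp
  have key := indep_iSup_of_disjoint hle hind hdis
  refine indep_of_indep_of_le_left (indep_of_indep_of_le_right key ?_) ?_
  · have hl : X (n + 1) = fun ω => N t ω - N s ω := by
      funext ω
      simp [hX, hu]
    rw [← hl]
    exact le_iSup₂_of_le (f := fun i (_ : i ∈ ({n + 1} : Set ℕ)) =>
      MeasurableSpace.comap (X i) ⊤) (n + 1) rfl le_rfl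
  · refine iSup₂_le fun j hj => ?_
    obtain ⟨k, hk⟩ : ∃ k, e k = j := by
      have : j ∈ Set.range e := by rw [he, Finset.range_orderEmbOfFin]; exact hj
      exact this
    have huk : u (k + 1) = j := by
      simp [hu, hk]
    rw [← huk, ← measurable_iff_comap_le]
    have : N (u (k + 1)) = fun ω => ∑ i ∈ Finset.range (k + 1), X i ω := funext (hsum _)
    rw [this]
    refine Finset.measurable_sum _ fun i hi => ?_
    rw [measurable_iff_comap_le]
    refine le_iSup₂_of_le (f := fun i (_ : i ∈ {i | i < n + 1}) =>
      MeasurableSpace.comap (X i) ⊤) i ?_ le_rfl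
    have := Finset.mem_range.1 hi
    have := k.2
    show i < n + 1
    omega

/-- The past is a directed supremum of the σ-algebras of finitely many times. Filtering each finite
set by `≤ s` allows all finite sets as indices. -/
theorem indep_past [IsProbabilityMeasure P] {s t : ℝ≥0} (hst : s ≤ t) :
    Indep (past N s) (MeasurableSpace.comap (fun ω => N t ω - N s ω) ⊤) P := by
  classical
  set M : Finset ℝ≥0 → MeasurableSpace Ω := fun S =>
    ⨆ j ∈ S.filter (· ≤ s), MeasurableSpace.comap (N j) ⊤ with hM
  have h1 : past N s ≤ ⨆ S, M S := by
    refine iSup₂_le fun j hj => le_iSup_of_le {j} ?_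
    refine le_iSup₂_of_le (f := fun i (_ : i ∈ ({j} : Finset ℝ≥0).filter (· ≤ s)) =>
      MeasurableSpace.comap (N i) ⊤) j ?_ le_rfl
    simpa using hj
  refine indep_of_indep_of_le_left ?_ h1
  refine indep_iSup_of_monotone (fun S => indep_finset_past hN hst _ ?_) (fun S => ?_)
    ((hN.measurable t).sub (hN.measurable s)).comap_le ?_
  · intro j hj
    exact (Finset.mem_filter.1 hj).2
  · exact iSup₂_le fun j _ => (hN.measurable j).comap_le
  · intro S S' hSS
    exact biSup_mono fun j hj => Finset.filter_subset_filter _ hSS hj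

theorem integral_mul_increment [IsProbabilityMeasure P] {s t : ℝ≥0} (hst : s ≤ t) {X : Ω → ℝ}
    (hX : Measurable[past N s] X) (f : ℕ → ℝ) :
    ∫ ω, X ω * f (N t ω - N s ω) ∂P = (∫ ω, X ω ∂P) * ∫ ω, f (N t ω - N s ω) ∂P := by
  have hm : Measurable fun ω => N t ω - N s ω := (hN.measurable t).sub (hN.measurable s)
  have h1 : IndepFun X (fun ω => f (N t ω - N s ω)) P := by
    refine indep_of_indep_of_le_left (indep_of_indep_of_le_right (indep_past hN hst) ?_)
      hX.comap_le
    rw [← measurable_iff_comap_le]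
    exact (measurable_from_top (f := f)).comp (comap_measurable _)
  exact h1.integral_fun_mul_eq_mul_integral (hX.mono (past_le hN s) le_rfl).aestronglyMeasurable
    ((measurable_from_top (f := f)).comp hm).aestronglyMeasurable

omit hN in
/-- A set of the completed past agrees almost surely with a set of the past. -/
theorem exists_past_ae_eq {t : ℝ≥0} {A : Set Ω}
    (hA : MeasurableSet[past N t ⊔ nullSigma P] A) :
    ∃ B, MeasurableSet[past N t] B ∧ A =ᵐ[P] B := by
  -- The sets that are a.e. equal to a set of the past form a σ-algebra, and it contains the null
  -- sets.
  have h1 : past N t ⊔ nullSigma P ≤ eventuallyMeasurableSpace (past N t) (ae P) := by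
    refine sup_le (le_eventuallyMeasurableSpace) (MeasurableSpace.generateFrom_le ?_)
    rintro B ⟨_, hB⟩
    exact ⟨∅, @MeasurableSet.empty _ (past N t), ae_eq_empty.2 hB⟩
  exact h1 A hA

/-! ### Distribution of the increments -/

theorem measure_increment {s t : ℝ≥0} (hst : s ≤ t) (k : ℕ) (hmu : 0 ≤ mu) :
    P.real {ω | N t ω - N s ω = k} =
      Real.exp (-(mu * (t - s))) * (mu * (t - s)) ^ k / k.factorial := by
  have hm : Measurable fun ω => N t ω - N s ω := (hN.measurable t).sub (hN.measurable s)
  have h1 : P.real {ω | N t ω - N s ω = k} = (P.map fun ω => N t ω - N s ω).real {k} := by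
    rw [map_measureReal_apply hm (measurableSet_singleton k)]; rfl
  rw [h1, hN.law s t hst, poissonMeasure_real_singleton]
  simp [NNReal.coe_sub hst, Real.coe_toNNReal _ hmu]

/-- The generating function of the Poisson law. With ρ = 1 + 1/μ it controls the growth of the
statistic in mean. -/
theorem integral_pow_increment {s t : ℝ≥0} (hst : s ≤ t) (hmu : 0 ≤ mu) {ρ : ℝ} (hρ : 0 ≤ ρ) :
    Integrable (fun ω => ρ ^ (N t ω - N s ω)) P ∧
      ∫ ω, ρ ^ (N t ω - N s ω) ∂P = Real.exp (mu * (t - s) * (ρ - 1)) := by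
  have hm : Measurable fun ω => N t ω - N s ω := (hN.measurable t).sub (hN.measurable s)
  set r : ℝ≥0 := mu.toNNReal * (t - s) with hr
  have hr' : (r : ℝ) = mu * (t - s) := by
    simp [hr, NNReal.coe_sub hst, Real.coe_toNNReal _ hmu]
  have hsum : HasSum (fun n : ℕ => Real.exp (-(r : ℝ)) * (r : ℝ) ^ n / n.factorial * ρ ^ n)
      (Real.exp (-(r : ℝ)) * Real.exp (r * ρ)) := by
    have h := (NormedSpace.expSeries_div_hasSum_exp ((r : ℝ) * ρ)).mul_left (Real.exp (-(r : ℝ)))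
    rw [← Real.exp_eq_exp_ℝ] at h
    have e : (fun n : ℕ => Real.exp (-(r : ℝ)) * (r : ℝ) ^ n / n.factorial * ρ ^ n) =
        fun n : ℕ => Real.exp (-(r : ℝ)) * (((r : ℝ) * ρ) ^ n / n.factorial) := by
      funext n; rw [mul_pow]; ring
    rw [e]; exact h
  have hi : Integrable (fun n : ℕ => ρ ^ n) (poissonMeasure r) := by
    rw [integrable_poissonMeasure_iff]
    refine hsum.summable.congr fun n => ?_
    rw [Real.norm_of_nonneg (pow_nonneg hρ n)]
  rw [← hN.law s t hst] at hi
  refine ⟨(integrable_map_measure (measurable_from_top).aestronglyMeasurable hm.aemeasurable).1 hi,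
    ?_⟩
  have h1 : ∫ ω, ρ ^ (N t ω - N s ω) ∂P = ∫ n, ρ ^ n ∂(P.map fun ω => N t ω - N s ω) :=
    (integral_map hm.aemeasurable (measurable_from_top (f := fun n : ℕ => ρ ^ n)).aestronglyMeasurable).symm
  rw [h1, hN.law s t hst, ← hr, integral_poissonMeasure]
  simp only [smul_eq_mul]
  rw [hsum.tsum_eq, ← Real.exp_add, hr']
  congr 1; ring

/-- With r = μ(t - s), 1 - e^{-r}(1 + r) ≤ 1 - (1 - r)(1 + r) = r². -/
theorem measure_two_le_increment [IsProbabilityMeasure P] {s t : ℝ≥0} (hst : s ≤ t)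
    (hmu : 0 ≤ mu) :
    P.real {ω | 2 ≤ N t ω - N s ω} ≤ (mu * (t - s)) ^ 2 := by
  have hm : Measurable fun ω => N t ω - N s ω := (hN.measurable t).sub (hN.measurable s)
  have h0 := measure_increment hN hst 0 hmu
  have h1 := measure_increment hN hst 1 hmu
  set r := mu * ((t : ℝ) - s) with hr
  have hr0 : 0 ≤ r := mul_nonneg hmu (sub_nonneg.2 hst)
  have hc : {ω | 2 ≤ N t ω - N s ω} =
      ({ω | N t ω - N s ω = 0} ∪ {ω | N t ω - N s ω = 1})ᶜ := by
    ext ω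
    simp only [mem_ofPred_eq, mem_compl_iff, mem_union]
    omega
  have m0 : MeasurableSet {ω | N t ω - N s ω = 0} := hm (measurableSet_singleton 0)
  have m1 : MeasurableSet {ω | N t ω - N s ω = 1} := hm (measurableSet_singleton 1)
  have hd : Disjoint {ω | N t ω - N s ω = 0} {ω | N t ω - N s ω = 1} := by
    rw [Set.disjoint_left]
    intro ω h h'
    simp only [mem_ofPred_eq] at h h'
    omega
  rw [hc, probReal_compl_eq_one_sub (m0.union m1), measureReal_union hd m1, h0, h1]
  have h2 := Real.add_one_le_exp (-r)
  simp only [pow_zero, Nat.factorial, Nat.cast_one, pow_one]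
  norm_num
  nlinarith

/-! ### The first jump time -/

theorem measure_lt_jumpTime_one (t : ℝ≥0) (hmu : 0 ≤ mu) :
    P.real {ω | (t : ℝ≥0∞) < jumpTime N 1 ω} = Real.exp (-(mu * t)) := by
  have h := measure_increment hN (s := 0) (t := t) zero_le 0 hmu
  simp only [hN.zero] at h
  have : {ω | (t : ℝ≥0∞) < jumpTime N 1 ω} = {ω | N t ω - 0 = 0} := by
    ext ω; simp [lt_jumpTime_iff hN]
  rw [this, h]; simp

theorem jumpTime_one_ne_top [IsProbabilityMeasure P] (hmu : 0 < mu) :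
    ∀ᵐ ω ∂P, jumpTime N 1 ω ≠ ⊤ := by
  rw [ae_iff]
  simp only [not_not]
  rw [← measureReal_eq_zero_iff]
  refine le_antisymm ?_ measureReal_nonneg
  have h1 : Tendsto (fun n : ℕ => Real.exp (-(mu * n))) atTop (𝓝 0) :=
    Real.tendsto_exp_neg_atTop_nhds_zero.comp
      (tendsto_natCast_atTop_atTop.const_mul_atTop hmu)
  refine ge_of_tendsto' h1 fun n => ?_
  have h2 := measure_lt_jumpTime_one hN n hmu.le
  simp only [NNReal.coe_natCast] at h2
  rw [← h2]
  refine measureReal_mono fun ω hω => ?_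
  simp only [mem_ofPred_eq] at hω ⊢
  rw [hω]; simp

/-- A double first jump before T puts two jumps into one of M + 1 cells of length T/(M + 1), an
event of probability at most (μT)²/(M + 1). Ruling this out makes N equal to 1 at the first jump
time, so that the statistic there is the image of a single `jumpMap`. -/
theorem jumpTime_one_lt_two [IsProbabilityMeasure P] (hmu : 0 < mu) :
    ∀ᵐ ω ∂P, jumpTime N 1 ω < jumpTime N 2 ω := by
  have key : ∀ T : ℕ, P {ω | jumpTime N 2 ω ≤ jumpTime N 1 ω ∧ jumpTime N 1 ω ≤ T} = 0 := by
    intro T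
    rw [← measureReal_eq_zero_iff]
    refine le_antisymm ?_ measureReal_nonneg
    have hlim : Tendsto (fun M : ℕ => (mu * T) ^ 2 / ((M : ℝ) + 1)) atTop (𝓝 0) :=
      tendsto_const_nhds.div_atTop (tendsto_atTop_add_const_right _ _ tendsto_natCast_atTop_atTop)
    refine ge_of_tendsto' hlim fun M => ?_
    set h : ℝ≥0 := T / (M + 1) with hh
    have hMh : (M + 1) * h = T := by rw [hh]; field_simp
    have hsub : {ω | jumpTime N 2 ω ≤ jumpTime N 1 ω ∧ jumpTime N 1 ω ≤ T} ⊆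
        ⋃ k ∈ Finset.range (M + 1),
          {ω | 2 ≤ N (((k + 1 : ℕ) : ℝ≥0) * h) ω - N ((k : ℝ≥0) * h) ω} := by
      rintro ω ⟨h21, h1T⟩
      have hex : ∃ k : ℕ, jumpTime N 1 ω ≤ (((k : ℝ≥0) * h : ℝ≥0) : ℝ≥0∞) :=
        ⟨M + 1, by
          have : (((M + 1 : ℕ) : ℝ≥0) * h : ℝ≥0) = (T : ℝ≥0) := by push_cast; exact hMh
          rw [this]; exact_mod_cast h1T⟩
      classical
      -- The first grid point not before the first jump: N is 0 at the preceding grid point and at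
      -- least 2 at this one.
      have hk := Nat.find_spec hex
      have hk2 : Nat.find hex ≠ 0 := by
        intro h0
        rw [h0] at hk
        simp at hk
        exact (jumpTime_one_pos hN ω).ne' hk
      obtain ⟨k, hkk⟩ := Nat.exists_eq_succ_of_ne_zero hk2
      have hkM : k < M + 1 := by
        have : Nat.find hex ≤ M + 1 := Nat.find_min' hex (by
          have : (((M + 1 : ℕ) : ℝ≥0) * h : ℝ≥0) = (T : ℝ≥0) := by push_cast; exact hMh
          rw [this]; exact_mod_cast h1T)
        omega
      have hmin := Nat.find_min hex (show k < Nat.find hex by omega)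
      rw [not_le, lt_jumpTime_iff hN] at hmin
      rw [hkk] at hk
      have h3 := (jumpTime_le_iff hN 2 _ ω).1 (h21.trans hk)
      simp only [mem_iUnion, Finset.mem_range, mem_ofPred_eq]
      refine ⟨k, hkM, ?_⟩
      have : N ((k : ℝ≥0) * h) ω = 0 := by omega
      rw [this]; exact h3
    refine (measureReal_mono hsub (measure_ne_top _ _)).trans ((measureReal_biUnion_finset_le _ _).trans ?_)
    have hb : ∀ k ∈ Finset.range (M + 1),
        P.real {ω | 2 ≤ N (((k + 1 : ℕ) : ℝ≥0) * h) ω - N ((k : ℝ≥0) * h) ω} ≤ (mu * h) ^ 2 := by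
      intro k _
      have := measure_two_le_increment hN (s := (k : ℝ≥0) * h) (t := ((k + 1 : ℕ) : ℝ≥0) * h)
        (by gcongr; simp) hmu.le
      refine this.trans (le_of_eq ?_)
      push_cast; ring
    refine (Finset.sum_le_card_nsmul _ _ _ hb).trans (le_of_eq ?_)
    simp only [Finset.card_range, nsmul_eq_mul, hh]
    push_cast
    field_simp
  have hall : ∀ᵐ ω ∂P, ∀ T : ℕ, ¬ (jumpTime N 2 ω ≤ jumpTime N 1 ω ∧ jumpTime N 1 ω ≤ T) := by
    rw [ae_all_iff]
    intro T
    rw [ae_iff]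
    simpa using key T
  filter_upwards [hall, jumpTime_one_ne_top hN hmu] with ω h1 h2
  by_contra! hcon
  obtain ⟨T, hT⟩ := ENNReal.exists_nat_gt h2
  exact h1 T ⟨hcon, hT.le⟩

theorem map_jumpTime_one [IsProbabilityMeasure P] (hmu : 0 < mu) :
    P.map (fun ω => (jumpTime N 1 ω).toReal) = expMeasure mu := by
  have hm : Measurable fun ω => (jumpTime N 1 ω).toReal := (measurable_jumpTime hN 1).ennreal_toReal
  have := isProbabilityMeasure_expMeasure hmu
  have := Measure.isProbabilityMeasure_map (μ := P) hm.aemeasurable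
  refine Measure.eq_of_cdf _ _ (StieltjesFunction.ext fun x => ?_)
  rw [cdf_expMeasure_eq hmu, cdf_eq_real, map_measureReal_apply hm measurableSet_Iic]
  split_ifs with hx
  · lift x to ℝ≥0 using hx
    rw [← measure_lt_jumpTime_one hN x hmu.le]
    have h1 : MeasurableSet {ω | (x : ℝ≥0∞) < jumpTime N 1 ω} :=
      measurableSet_lt measurable_const (measurable_jumpTime hN 1)
    rw [← probReal_compl_eq_one_sub h1]
    refine measureReal_congr ?_
    filter_upwards [jumpTime_one_ne_top hN hmu] with ω hω
    refine propext ?_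
    show (jumpTime N 1 ω).toReal ≤ x ↔ ¬ ((x : ℝ≥0∞) < jumpTime N 1 ω)
    rw [not_lt, ← ENNReal.toReal_le_toReal hω ENNReal.coe_ne_top]
    simp
  · have : (fun ω => (jumpTime N 1 ω).toReal) ⁻¹' Iic x = ∅ := by
      ext ω
      simp only [mem_preimage, mem_Iic, mem_empty_iff_false, iff_false, not_le]
      exact (not_le.1 hx).trans_le ENNReal.toReal_nonneg
    rw [this]; simp

end


section

variable {Ω : Type*} [mΩ : MeasurableSpace Ω] {P : Measure Ω} [IsProbabilityMeasure P]
  {N : ℝ≥0 → Ω → ℕ} {lam mu c m : ℝ} (hN : IsPoissonProcess N mu P) (H : Params lam mu c m)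

/-! ### The deterministic form of the operator `J` -/

omit mΩ [IsProbabilityMeasure P] in
/-- Discounted running cost along the flow. -/
theorem costRate_zero (p : ℝ × ℝ) (u : ℝ) : costRate lam mu c m (fun _ => 0) p u =
    Real.exp (-mu * u) * (Real.exp (-lam * u) * runningCost lam c (flow lam m u p)) := by
  unfold costRate
  rw [← mul_assoc, ← Real.exp_add, mul_zero, add_zero]
  congr 2; ring

include hN

omit [IsProbabilityMeasure P] in
theorem statistic_before_jump (p : ℝ × ℝ) {u : ℝ} (hu : 0 ≤ u) {ω : Ω}
    (h : ENNReal.ofReal u < jumpTime N 1 ω) :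
    statistic lam mu m N p u ω = flow lam m u p := by
  lift u to ℝ≥0 using hu
  rw [ENNReal.ofReal_coe_nnreal, lt_jumpTime_iff hN] at h
  have h0 : N u ω = 0 := by omega
  rw [statistic_coe, h0, jumpTime_zero hN]
  simp [postJump]

omit [IsProbabilityMeasure P] in
theorem statistic_at_jump (p : ℝ × ℝ) {ω : Ω} (h1 : jumpTime N 1 ω ≠ ⊤)
    (h2 : jumpTime N 1 ω < jumpTime N 2 ω) :
    statistic lam mu m N p (jumpTime N 1 ω).toReal ω =
      jumpMap mu (flow lam m (jumpTime N 1 ω).toReal p) := by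
  set s := (jumpTime N 1 ω).toNNReal with hs
  have hs' : (s : ℝ≥0∞) = jumpTime N 1 ω := ENNReal.coe_toNNReal h1
  have e1 : 1 ≤ N s ω := (jumpTime_le_iff hN 1 s ω).1 hs'.ge
  have e2 : N s ω < 2 := (lt_jumpTime_iff hN 2 s ω).1 (hs'.le.trans_lt h2)
  have e3 : N s ω = 1 := by omega
  have e4 : (jumpTime N 1 ω).toReal = s := rfl
  rw [e4, statistic_coe, e3, e4, sub_self, flow_zero, postJump_succ p (n := 0) h1,
    jumpTime_zero hN]
  simp [postJump, e4]

include H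

/-- Fubini: time u counts with the probability e^{-μu} that no jump has occurred, which is the
weight in `costRate` for w = 0. -/
theorem integral_before_jump (p : ℝ × ℝ) (hp : 0 ≤ p) (t : ℝ≥0∞) :
    Integrable (fun ω => ∫ u in before (min t (jumpTime N 1 ω)),
      Real.exp (-lam * u) * runningCost lam c (flow lam m u p)) P ∧
    ∫ ω, (∫ u in before (min t (jumpTime N 1 ω)),
      Real.exp (-lam * u) * runningCost lam c (flow lam m u p)) ∂P =
      ∫ u in before t, costRate lam mu c m (fun _ => 0) p u := by
  have hmu : 0 < mu := by linarith [H.one_lt_mu]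
  set G : ℝ → ℝ := fun u => Real.exp (-lam * u) * runningCost lam c (flow lam m u p) with hG
  have hGc : Continuous G := by
    have h1 := flow_continuous_time H.lam_pos m p
    have h2 : Continuous fun u : ℝ => Real.exp (-lam * u) := by fun_prop
    exact h2.mul ((h1.fst.add h1.snd).sub continuous_const)
  set D : Set (Ω × ℝ) := {q | ENNReal.ofReal q.2 < jumpTime N 1 q.1} with hD
  have hDm : MeasurableSet D := measurableSet_lt (ENNReal.measurable_ofReal.comp measurable_snd)
    ((measurable_jumpTime hN 1).comp measurable_fst)
  set f : Ω × ℝ → ℝ := D.indicator fun q => G q.2 with hf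
  have hfm : Measurable f := (hGc.measurable.comp measurable_snd).indicator hDm
  have hsec : ∀ u : ℝ, MeasurableSet {ω | ENNReal.ofReal u < jumpTime N 1 ω} := fun u =>
    measurableSet_lt measurable_const (measurable_jumpTime hN 1)
  have hprob : ∀ u : ℝ, 0 ≤ u → P.real {ω | ENNReal.ofReal u < jumpTime N 1 ω} =
      Real.exp (-mu * u) := by
    intro u hu
    lift u to ℝ≥0 using hu
    rw [ENNReal.ofReal_coe_nnreal, measure_lt_jumpTime_one hN u hmu.le, neg_mul]
  have hfsec : ∀ u : ℝ, (fun ω => f (ω, u)) =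
      {ω | ENNReal.ofReal u < jumpTime N 1 ω}.indicator fun _ => G u := fun u => rfl
  have hint0 := costRate_integrableOn H (admissible_detV H 0) hp t
  have hprod : Integrable f (P.prod (volume.restrict (before t))) := by
    rw [integrable_prod_iff' hfm.aestronglyMeasurable]
    constructor
    · refine Eventually.of_forall fun u => ?_
      rw [hfsec]
      exact (integrable_const (G u)).indicator (hsec u)
    · refine hint0.norm.congr ?_
      refine (ae_restrict_iff' (measurableSet_before t)).2 (Eventually.of_forall fun u hu => ?_)
      have : (fun ω => ‖f (ω, u)‖) =
          {ω | ENNReal.ofReal u < jumpTime N 1 ω}.indicator fun _ => ‖G u‖ := by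
        funext ω
        rw [← norm_indicator_eq_indicator_norm]; rfl
      simp only
      rw [this, integral_indicator_const _ (hsec u), hprob u hu.1]
      show ‖costRate lam mu c m (fun _ => 0) p u‖ = _
      rw [costRate_zero, norm_mul, Real.norm_of_nonneg (Real.exp_pos _).le, smul_eq_mul]
  have hin : ∀ ω, ∫ u in before (min t (jumpTime N 1 ω)), G u =
      ∫ u in before t, f (ω, u) := by
    intro ω
    have hind : (fun u => f (ω, u)) = {u | ENNReal.ofReal u < jumpTime N 1 ω}.indicator G := rfl
    rw [hind, setIntegral_indicator (measurableSet_lt ENNReal.measurable_ofReal measurable_const)]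
    congr 2
    ext u
    simp only [before, lt_min_iff, mem_inter_iff, mem_ofPred_eq]
    tauto
  simp only [hin]
  refine ⟨hprod.integral_prod_left, ?_⟩
  rw [integral_integral_swap (f := fun ω u => f (ω, u)) hprod]
  refine setIntegral_congr_fun (measurableSet_before t) fun u hu => ?_
  rw [hfsec, integral_indicator_const _ (hsec u), hprob u hu.1, costRate_zero, smul_eq_mul]

/-- Integration against the density μe^{-μu} of the first jump time. The condition `≤ t` and the
half-open `before t` differ only at u = t, a null set. The form `ofReal (toReal _)` makes the
integrand a function of a real variable. -/
theorem integral_at_jump {w : ℝ × ℝ → ℝ} (hw : Admissible lam mu c m w) (p : ℝ × ℝ)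
    (t : ℝ≥0∞) :
    Integrable (fun ω => if ENNReal.ofReal (jumpTime N 1 ω).toReal ≤ t then
      Real.exp (-lam * (jumpTime N 1 ω).toReal) *
        w (jumpMap mu (flow lam m (jumpTime N 1 ω).toReal p)) else 0) P ∧
    ∫ ω, (if ENNReal.ofReal (jumpTime N 1 ω).toReal ≤ t then
      Real.exp (-lam * (jumpTime N 1 ω).toReal) *
        w (jumpMap mu (flow lam m (jumpTime N 1 ω).toReal p)) else 0) ∂P =
      ∫ u in before t, Real.exp (-(lam + mu) * u) * (mu * w (jumpMap mu (flow lam m u p))) := by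
  have hmu : 0 < mu := by linarith [H.one_lt_mu]
  set h : ℝ → ℝ := fun u => if ENNReal.ofReal u ≤ t then
    Real.exp (-lam * u) * w (jumpMap mu (flow lam m u p)) else 0 with hh
  have hwc : Continuous fun u => w (jumpMap mu (flow lam m u p)) :=
    (hw.continuous H).comp (jumpMap_continuous.comp (flow_continuous_time H.lam_pos m p))
  have hhm : Measurable h := by
    refine Measurable.ite (measurableSet_le ENNReal.measurable_ofReal measurable_const) ?_
      measurable_const
    exact ((by fun_prop : Measurable fun u : ℝ => Real.exp (-lam * u))).mul hwc.measurable
  have hm : Measurable fun ω => (jumpTime N 1 ω).toReal := (measurable_jumpTime hN 1).ennreal_toReal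
  constructor
  · refine (integrable_const (lossBound lam mu c m)).mono'
      (hhm.comp hm).aestronglyMeasurable (Eventually.of_forall fun ω => ?_)
    have hκ := lossBound_pos H
    split_ifs
    · have h1 := hw.lower (jumpMap mu (flow lam m (jumpTime N 1 ω).toReal p))
      have h2 := hw.nonpos (jumpMap mu (flow lam m (jumpTime N 1 ω).toReal p))
      rw [norm_mul, Real.norm_of_nonneg (Real.exp_pos _).le, Real.norm_of_nonpos h2]
      have h3 : Real.exp (-lam * (jumpTime N 1 ω).toReal) ≤ 1 := by
        rw [Real.exp_le_one_iff, neg_mul, neg_nonpos]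
        exact mul_nonneg H.lam_pos.le ENNReal.toReal_nonneg
      calc _ ≤ 1 * -w (jumpMap mu (flow lam m (jumpTime N 1 ω).toReal p)) :=
            mul_le_mul_of_nonneg_right h3 (by linarith)
        _ ≤ _ := by linarith
    · simpa using hκ.le
  · have e1 : ∫ ω, h (jumpTime N 1 ω).toReal ∂P = ∫ x, h x ∂(expMeasure mu) := by
      rw [← map_jumpTime_one hN hmu]
      exact (integral_map hm.aemeasurable hhm.aestronglyMeasurable).symm
    rw [e1, expMeasure, gammaMeasure]
    change ∫ x, h x ∂(volume.withDensity (exponentialPDF mu)) = _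
    have hpm : Measurable (exponentialPDF mu) := measurable_exponentialPDFReal mu |>.ennreal_ofReal
    rw [integral_withDensity_eq_integral_toReal_smul hpm (Eventually.of_forall fun x =>
      ENNReal.ofReal_lt_top), ← integral_indicator (measurableSet_before t)]
    refine integral_congr_ae ?_
    have hne : ∀ᵐ x : ℝ, x ≠ t.toReal := by
      rw [ae_iff]; simp
    filter_upwards [hne] with x hx
    rw [exponentialPDF_eq]
    by_cases hx0 : 0 ≤ x
    · by_cases hxt : ENNReal.ofReal x < t
      · rw [indicator_of_mem (show x ∈ before t from ⟨hx0, hxt⟩), if_pos hx0]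
        have e2 : Real.exp (-(lam + mu) * x) = Real.exp (-(mu * x)) * Real.exp (-lam * x) := by
          rw [← Real.exp_add]; congr 1; ring
        simp only [hh, if_pos hxt.le, smul_eq_mul]
        rw [ENNReal.toReal_ofReal (by positivity), e2]
        ring
      · have hxt' : ¬ ENNReal.ofReal x ≤ t := by
          intro hle
          have : ENNReal.ofReal x = t := le_antisymm hle (not_lt.1 hxt)
          apply hx
          rw [← this, ENNReal.toReal_ofReal hx0]
        rw [indicator_of_notMem (fun hmem => hxt hmem.2)]
        simp [hh, if_neg hxt']
    · rw [indicator_of_notMem (fun hmem => hx0 hmem.1), if_neg hx0]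
      simp

/-- The operator `J` in deterministic form. -/
theorem opJ_eq_detJ {w w' : ℝ × ℝ → ℝ} (hw : Admissible lam mu c m w)
    (heq : ∀ q, 0 ≤ q → w' q = w q) (t : ℝ≥0∞) {p : ℝ × ℝ} (hp : 0 ≤ p) :
    opJ P lam mu c m N w' t p = detJ lam mu c m w t p := by
  have hmu : 0 < mu := by linarith [H.one_lt_mu]
  obtain ⟨hA, hA'⟩ := integral_before_jump hN H p hp t
  obtain ⟨hB, hB'⟩ := integral_at_jump hN H hw p t
  have e : opJ P lam mu c m N w' t p = ∫ ω, ((∫ u in before (min t (jumpTime N 1 ω)),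
      Real.exp (-lam * u) * runningCost lam c (flow lam m u p)) +
      if ENNReal.ofReal (jumpTime N 1 ω).toReal ≤ t then
      Real.exp (-lam * (jumpTime N 1 ω).toReal) *
        w (jumpMap mu (flow lam m (jumpTime N 1 ω).toReal p)) else 0) ∂P := by
    refine integral_congr_ae ?_
    filter_upwards [jumpTime_one_ne_top hN hmu, jumpTime_one_lt_two hN hmu] with ω h1 h2
    rw [ENNReal.ofReal_toReal h1, statistic_at_jump hN p h1 h2,
      heq _ (jumpMap_nonneg H.one_lt_mu (flow_nonneg H.lam_pos H.m_mem ENNReal.toReal_nonneg hp))]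
    congr 1
    refine setIntegral_congr_fun (measurableSet_before _) fun u hu => ?_
    rw [statistic_before_jump hN p hu.1 (hu.2.trans_le (min_le_right _ _))]
  rw [e, integral_add hA hB, hA', hB']
  have h0 := costRate_integrableOn H (admissible_detV H 0) hp t
  have h1 := (costRate_integrableOn H hw hp t).sub h0
  have h2 : ∀ u, Real.exp (-(lam + mu) * u) * (mu * w (jumpMap mu (flow lam m u p))) =
      costRate lam mu c m w p u - costRate lam mu c m (fun _ => 0) p u := by
    intro u; unfold costRate; ring
  simp only [h2]
  have h3 := integral_sub (costRate_integrableOn H hw hp t) h0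
  have h4 : detV lam mu c m 0 = fun _ => 0 := rfl
  rw [h4] at h3
  rw [h3]
  unfold detJ
  ring

/-- `detV` projects onto the quadrant and `iterV` does not, so they are compared on the quadrant
only. The induction goes through because the statistic never leaves it. -/
theorem iterV_eq_detV (n : ℕ) {p : ℝ × ℝ} (hp : 0 ≤ p) :
    iterV P lam mu c m N n p = detV lam mu c m n p := by
  induction n generalizing p with
  | zero => rfl
  | succ n ih =>
    show ⨅ t, opJ P lam mu c m N (iterV P lam mu c m N n) t p = ⨅ t, _
    refine iInf_congr fun t => ?_
    rw [opJ_eq_detJ hN H (admissible_detV H n) (fun q hq => ih hq) t hp, sup_of_le_left hp]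

end


/-! ### One step of the time discretization -/

/-- Bound for the running cost relative to the size, over a time interval of length at most one. -/
noncomputable def costConst (lam mu c : ℝ) : ℝ := (1 + level lam mu c) * Real.exp (lam + 1)

/-- Bound for the displacement of the flow. -/
noncomputable def moveConst (lam : ℝ) : ℝ := (lam + 1) * Real.exp (lam + 1)

/-- Lipschitz constant of the value function. -/
noncomputable def lipConst (lam mu c m : ℝ) : ℝ := slopeX lam mu c m + slopeY lam mu c m

/-- The constant in the pathwise estimate. -/
noncomputable def pathConst (lam mu c m : ℝ) : ℝ :=
  costConst lam mu c * (1 + 1 / mu) +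
    lipConst lam mu c m * (2 * (1 + 1 / mu) * Real.exp (lam + 1) * moveConst lam) +
    (lam + 1) * lossBound lam mu c m

/-- The constant in the comparison of the deterministic quantities. -/
noncomputable def meanConst (lam mu c m : ℝ) : ℝ :=
  mu * (costConst lam mu c + lipConst lam mu c m * ((1 + 1 / mu) * moveConst lam) +
    (lam + mu) * lossBound lam mu c m)

/-- The constant in the one-step estimate. -/
noncomputable def stepConst (lam mu c m : ℝ) : ℝ :=
  pathConst lam mu c m * ((mu + 1) ^ 2 + mu) + meanConst lam mu c m

/-- Running cost followed by the value function when there is no jump. -/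
noncomputable def stayValue (lam mu c m h : ℝ) (q : ℝ × ℝ) : ℝ :=
  (∫ s in Ico 0 h, Real.exp (-lam * s) * runningCost lam c (flow lam m s q)) +
    Real.exp (-lam * h) * limV lam mu c m (flow lam m h q)

/-! ### One step of length h: mean value against `detStep` -/

section Deterministic

variable {lam mu c m : ℝ} (H : Params lam mu c m)

include H

theorem costConst_pos : 0 < costConst lam mu c := by
  have := level_pos H
  unfold costConst; positivity

theorem moveConst_pos : 0 < moveConst lam := by
  have := H.lam_pos
  unfold moveConst; positivity

theorem lipConst_nonneg : 0 ≤ lipConst lam mu c m := add_nonneg (slopeX_nonneg H) (slopeY_nonneg H)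

theorem pathConst_pos : 0 < pathConst lam mu c m := by
  have h1 := costConst_pos H
  have h2 := moveConst_pos H
  have h3 := lipConst_nonneg H
  have h4 := lossBound_pos H
  have h5 := H.lam_pos
  have h6 : 0 < mu := by linarith [H.one_lt_mu]
  unfold pathConst; positivity

theorem meanConst_pos : 0 < meanConst lam mu c m := by
  have h1 := costConst_pos H
  have h2 := moveConst_pos H
  have h3 := lipConst_nonneg H
  have h4 := lossBound_pos H
  have h5 := H.lam_pos
  have h6 : 0 < mu := by linarith [H.one_lt_mu]
  unfold meanConst; positivity

theorem stepConst_pos : 0 < stepConst lam mu c m := by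
  have h1 := pathConst_pos H
  have h2 := meanConst_pos H
  have h6 : 0 < mu := by linarith [H.one_lt_mu]
  unfold stepConst; positivity

theorem abs_limV_sub_le (p q : ℝ × ℝ) :
    |limV lam mu c m q - limV lam mu c m p| ≤
      lipConst lam mu c m * (|q.1 - p.1| + |q.2 - p.2|) := by
  refine ((admissible_limV H).abs_sub_le H p q).trans ?_
  have h1 := slopeX_nonneg H
  have h2 := slopeY_nonneg H
  unfold lipConst
  nlinarith [mul_nonneg h1 (abs_nonneg (q.2 - p.2)), mul_nonneg h2 (abs_nonneg (q.1 - p.1))]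

theorem abs_limV_le (p : ℝ × ℝ) : |limV lam mu c m p| ≤ lossBound lam mu c m := by
  rw [abs_of_nonpos ((admissible_limV H).nonpos p)]
  linarith [(admissible_limV H).lower p]

theorem jumpMap_displacement (p q : ℝ × ℝ) :
    |(jumpMap mu q).1 - (jumpMap mu p).1| + |(jumpMap mu q).2 - (jumpMap mu p).2| ≤
      (1 + 1 / mu) * (|q.1 - p.1| + |q.2 - p.2|) := by
  have h := inv_lt_one_of_rate H.one_lt_mu
  have h' : 0 < 1 / mu := by have := H.one_lt_mu; positivity
  simp only [jumpMap, ← mul_sub, abs_mul]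
  rw [abs_of_pos (by linarith : 0 < 1 - 1 / mu), abs_of_pos (by linarith : 0 < 1 + 1 / mu)]
  nlinarith [abs_nonneg (q.1 - p.1)]

theorem abs_runningCost_le {q : ℝ × ℝ} (hq : 0 ≤ q) :
    |runningCost lam c q| ≤ (1 + level lam mu c) * size q := by
  have := abs_cost_le H (admissible_detV H 0) hq
  simpa [detV] using this

omit H in
theorem abs_exp_neg_sub_exp_neg_le {a b : ℝ} (ha : 0 ≤ a) (hb : 0 ≤ b) :
    |Real.exp (-a) - Real.exp (-b)| ≤ |a - b| := by
  have key : ∀ {a b : ℝ}, 0 ≤ a → a ≤ b → |Real.exp (-a) - Real.exp (-b)| ≤ |a - b| := by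
    intro a b ha hab
    have h1 : Real.exp (-b) ≤ Real.exp (-a) := Real.exp_le_exp.2 (by linarith)
    have h2 := Real.add_one_le_exp (a - b)
    have h3 : Real.exp (-b) = Real.exp (-a) * Real.exp (a - b) := by
      rw [← Real.exp_add]; congr 1; ring
    have h4 : Real.exp (-a) ≤ 1 := Real.exp_le_one_iff.2 (by linarith)
    rw [abs_of_nonneg (by linarith), abs_of_nonpos (by linarith)]
    nlinarith [mul_le_mul_of_nonneg_left h2 (Real.exp_pos (-a)).le]
  rcases le_total a b with h | h
  · exact key ha h
  · rw [abs_sub_comm, abs_sub_comm a]; exact key hb h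

omit H in
theorem abs_exp_neg_sub_le {a b h : ℝ} (ha : 0 ≤ a) (hb : 0 ≤ b) (hah : a ≤ h) (hbh : b ≤ h) :
    |Real.exp (-a) - Real.exp (-b)| ≤ h :=
  (abs_exp_neg_sub_exp_neg_le ha hb).trans (abs_le.2 ⟨by linarith, by linarith⟩)

theorem size_flow_le_exp {s : ℝ} (hs : 0 ≤ s) (hs1 : s ≤ 1) {q : ℝ × ℝ} (hq : 0 ≤ q) :
    size (flow lam m s q) ≤ Real.exp (lam + 1) * size q := by
  refine (size_flow_le H.lam_pos H.m_mem hs hq).trans ?_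
  have h2 := two_le_size hq
  have h1 := H.lam_pos
  refine mul_le_mul_of_nonneg_right (Real.exp_le_exp.2 ?_) (by linarith)
  nlinarith

/-- The comparison of the one-step mean with the dynamic programming operator. -/
theorem abs_mean_sub_detStep_le {h : ℝ} (hh : 0 ≤ h) (hh1 : h ≤ 1) {q : ℝ × ℝ} (hq : 0 ≤ q) :
    |Real.exp (-(mu * h)) * stayValue lam mu c m h q +
      mu * h * Real.exp (-(mu * h)) * limV lam mu c m (jumpMap mu q) -
      detStep lam mu c m h q| ≤ meanConst lam mu c m * h ^ 2 * size q := by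
  have hlam := H.lam_pos
  have hmu : 0 < mu := by linarith [H.one_lt_mu]
  have hsz := two_le_size hq
  have hK := level_pos H
  have hκ := lossBound_pos H
  have hL := lipConst_nonneg H
  have hD := moveConst_pos H
  have hB := costConst_pos H
  have hw := admissible_limV H
  set G : ℝ → ℝ := fun s => Real.exp (-lam * s) * runningCost lam c (flow lam m s q) with hG
  have hGc : Continuous G := by
    have h1 := flow_continuous_time H.lam_pos m q
    have h2 : Continuous fun u : ℝ => Real.exp (-lam * u) := by fun_prop
    exact h2.mul ((h1.fst.add h1.snd).sub continuous_const)
  -- The terminal values cancel since e^{-(λ+μ)h} = e^{-μh} e^{-λh}, and the one-jump term is the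
  -- integral of a constant over [0, h). What is left is the integral of R over an interval of
  -- length h, so R = O(h) times the size suffices.
  set R : ℝ → ℝ := fun s => Real.exp (-(mu * h)) * G s +
    mu * Real.exp (-(mu * h)) * limV lam mu c m (jumpMap mu q) -
    costRate lam mu c m (limV lam mu c m) q s with hR
  have hGi : IntegrableOn G (Ico 0 h) := hGc.integrableOn_Icc.mono_set Ico_subset_Icc_self
  have hCi : IntegrableOn (costRate lam mu c m (limV lam mu c m) q) (Ico 0 h) :=
    (costRate_continuous H hw q).integrableOn_Icc.mono_set Ico_subset_Icc_self
  have hci : IntegrableOn (fun _ : ℝ => mu * Real.exp (-(mu * h)) *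
    limV lam mu c m (jumpMap mu q)) (Ico 0 h) :=
    continuous_const.integrableOn_Icc.mono_set Ico_subset_Icc_self
  have e : Real.exp (-(mu * h)) * stayValue lam mu c m h q +
      mu * h * Real.exp (-(mu * h)) * limV lam mu c m (jumpMap mu q) -
      detStep lam mu c m h q = ∫ s in Ico 0 h, R s := by
    have e1 : ∫ s in Ico 0 h, R s = (∫ s in Ico 0 h, Real.exp (-(mu * h)) * G s +
        mu * Real.exp (-(mu * h)) * limV lam mu c m (jumpMap mu q)) -
        ∫ s in Ico 0 h, costRate lam mu c m (limV lam mu c m) q s :=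
      integral_sub ((hGi.const_mul _).add hci) hCi
    rw [e1, integral_add (hGi.const_mul _) hci, integral_const_mul, setIntegral_const]
    have e2 : Real.exp (-(lam + mu) * h) = Real.exp (-(mu * h)) * Real.exp (-lam * h) := by
      rw [← Real.exp_add]; congr 1; ring
    simp only [Real.volume_real_Ico, sub_zero, max_eq_left hh, smul_eq_mul]
    unfold stayValue detStep detJ
    rw [before_ofReal, e2]
    ring
  have hbound : ∀ s ∈ Ico (0 : ℝ) h, ‖R s‖ ≤ meanConst lam mu c m * h * size q := by
    rintro s ⟨hs0, hsh⟩
    have hs1 : s ≤ 1 := by linarith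
    have hf := flow_nonneg H.lam_pos H.m_mem hs0 hq
    -- Three differences, each O(h): two of exponentials, and one of `limV` at nearby points.
    have eR : R s = G s * (Real.exp (-(mu * h)) - Real.exp (-(mu * s))) +
        mu * (Real.exp (-(mu * h)) *
          (limV lam mu c m (jumpMap mu q) - limV lam mu c m (jumpMap mu (flow lam m s q))) +
        limV lam mu c m (jumpMap mu (flow lam m s q)) *
          (Real.exp (-(mu * h)) - Real.exp (-((lam + mu) * s)))) := by
      have e2 : Real.exp (-((lam + mu) * s)) = Real.exp (-(mu * s)) * Real.exp (-lam * s) := by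
        rw [← Real.exp_add]; congr 1; ring
      have e3 : -(lam + mu) * s = -((lam + mu) * s) := by ring
      simp only [hR, hG, costRate]
      rw [e3, e2]; ring
    have b1 : |G s| ≤ costConst lam mu c * size q := by
      simp only [hG]
      rw [abs_mul, abs_of_pos (Real.exp_pos _)]
      have h1 : Real.exp (-lam * s) ≤ 1 := Real.exp_le_one_iff.2 (by nlinarith)
      have h2 := abs_runningCost_le H hf
      have h3 := size_flow_le_exp H hs0 hs1 hq
      calc _ ≤ 1 * ((1 + level lam mu c) * (Real.exp (lam + 1) * size q)) := by
            refine mul_le_mul h1 (h2.trans ?_) (abs_nonneg _) one_pos.le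
            gcongr
        _ = _ := by unfold costConst; ring
    have b2 : |Real.exp (-(mu * h)) - Real.exp (-(mu * s))| ≤ mu * h :=
      abs_exp_neg_sub_le (by positivity) (by positivity) le_rfl (by gcongr)
    have b3 : |Real.exp (-(mu * h)) - Real.exp (-((lam + mu) * s))| ≤ (lam + mu) * h :=
      abs_exp_neg_sub_le (by positivity) (by positivity) (by nlinarith) (by gcongr)
    have b4 : |limV lam mu c m (jumpMap mu q) - limV lam mu c m (jumpMap mu (flow lam m s q))| ≤
        lipConst lam mu c m * ((1 + 1 / mu) * (moveConst lam * h * size q)) := by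
      rw [abs_sub_comm]
      refine (abs_limV_sub_le H _ _).trans (mul_le_mul_of_nonneg_left ?_ hL)
      refine (jumpMap_displacement H _ _).trans (mul_le_mul_of_nonneg_left ?_ (by positivity))
      refine (flow_displacement H.lam_pos H.m_mem hs0 hs1 hq).trans ?_
      unfold moveConst
      gcongr
    have b5 := abs_limV_le H (jumpMap mu (flow lam m s q))
    have b6 : Real.exp (-(mu * h)) ≤ 1 := Real.exp_le_one_iff.2 (by nlinarith)
    rw [Real.norm_eq_abs, eR]
    refine (abs_add_le _ _).trans ?_
    rw [abs_mul, abs_mul mu, abs_of_pos hmu]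
    have c1 := mul_le_mul b1 b2 (abs_nonneg _) (by positivity)
    have c2 : |Real.exp (-(mu * h)) *
          (limV lam mu c m (jumpMap mu q) - limV lam mu c m (jumpMap mu (flow lam m s q))) +
        limV lam mu c m (jumpMap mu (flow lam m s q)) *
          (Real.exp (-(mu * h)) - Real.exp (-((lam + mu) * s)))| ≤
        lipConst lam mu c m * ((1 + 1 / mu) * (moveConst lam * h * size q)) +
          lossBound lam mu c m * ((lam + mu) * h) := by
      refine (abs_add_le _ _).trans (add_le_add ?_ ?_)
      · rw [abs_mul, abs_of_pos (Real.exp_pos _)]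
        exact (mul_le_mul b6 b4 (abs_nonneg _) one_pos.le).trans (one_mul _).le
      · rw [abs_mul]
        exact mul_le_mul b5 b3 (abs_nonneg _) hκ.le
    have c3 := mul_le_mul_of_nonneg_left c2 hmu.le
    have c4 : lossBound lam mu c m * ((lam + mu) * h) ≤
        lossBound lam mu c m * ((lam + mu) * h) * size q :=
      le_mul_of_one_le_right (by positivity) (by linarith)
    have c5 := mul_le_mul_of_nonneg_left c4 hmu.le
    refine (add_le_add c1 c3).trans ?_
    unfold meanConst
    linarith
  rw [e, ← Real.norm_eq_abs]
  refine (norm_setIntegral_le_of_norm_le_const (by simp) hbound).trans (le_of_eq ?_)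
  simp only [Real.volume_real_Ico, sub_zero, max_eq_left hh]
  ring

end Deterministic

/-! ### One step of length h: pathwise estimates -/

section Step

variable {Ω : Type*} [mΩ : MeasurableSpace Ω] {P : Measure Ω}
  {N : ℝ≥0 → Ω → ℕ} {lam mu c m : ℝ} (hN : IsPoissonProcess N mu P) (H : Params lam mu c m)
  {p : ℝ × ℝ}

/-- The cost over `[t, t + h)`, discounted to time `t`. -/
noncomputable def stepCost (lam mu c m : ℝ) (N : ℝ≥0 → Ω → ℕ) (p : ℝ × ℝ) (t h : ℝ≥0) (ω : Ω) : ℝ :=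
  ∫ s in Ico (0 : ℝ) h, Real.exp (-lam * s) * runningCost lam c (statistic lam mu m N p (t + s) ω)

include hN H

theorem measurable_stepCost (t h : ℝ≥0) : Measurable (stepCost lam mu c m N p t h) := by
  have h1 := measurable_statistic hN H p
  have h2 : Measurable fun q : Ω × ℝ => statistic lam mu m N p (t + q.2) q.1 :=
    h1.comp ((measurable_const.add measurable_snd).prodMk measurable_fst)
  have h3 : Measurable fun q : Ω × ℝ => Real.exp (-lam * q.2) *
      runningCost lam c (statistic lam mu m N p (t + q.2) q.1) := by
    have h4 : Measurable fun q : Ω × ℝ => Real.exp (-lam * q.2) := by fun_prop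
    exact h4.mul ((h2.fst.add h2.snd).sub_const _)
  exact h3.stronglyMeasurable.integral_prod_right.measurable

theorem size_statistic_step_le (hp : 0 ≤ p) {t h : ℝ≥0} (hh1 : h ≤ 1) {s : ℝ} (hs0 : 0 ≤ s)
    (hs : s ≤ h) (ω : Ω) :
    size (statistic lam mu m N p (t + s) ω) ≤ Real.exp (lam + 1) *
      (1 + 1 / mu) ^ (N (t + h) ω - N t ω) * size (statistic lam mu m N p t ω) := by
  lift s to ℝ≥0 using hs0
  have hs' : s ≤ h := hs
  have hq := two_le_size (statistic_nonneg hN H hp t.coe_nonneg ω)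
  have hmu : 0 < mu := by linarith [H.one_lt_mu]
  refine (size_statistic_le hN H hp t s ω).trans ?_
  have h1 : Real.exp ((lam + 1) * s) ≤ Real.exp (lam + 1) := by
    refine Real.exp_le_exp.2 ?_
    have : (s : ℝ) ≤ 1 := hs.trans hh1
    have := H.lam_pos
    nlinarith
  have h2 : (1 + 1 / mu) ^ (N (t + s) ω - N t ω) ≤ (1 + 1 / mu) ^ (N (t + h) ω - N t ω) := by
    refine pow_le_pow_right₀ ?_ (Nat.sub_le_sub_right (hN.mono ω (by gcongr)) _)
    have : 0 < 1 / mu := by positivity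
    linarith
  gcongr

theorem abs_discounted_cost_le (hp : 0 ≤ p) {t h : ℝ≥0} (hh1 : h ≤ 1) {s : ℝ} (hs0 : 0 ≤ s)
    (hs : s ≤ h) (ω : Ω) :
    |Real.exp (-lam * s) * runningCost lam c (statistic lam mu m N p (t + s) ω)| ≤
      costConst lam mu c * (1 + 1 / mu) ^ (N (t + h) ω - N t ω) *
        size (statistic lam mu m N p t ω) := by
  have hlam := H.lam_pos
  have h1 : Real.exp (-lam * s) ≤ 1 := Real.exp_le_one_iff.2 (by nlinarith)
  have h2 := abs_runningCost_le H (statistic_nonneg hN H hp (add_nonneg t.coe_nonneg hs0) ω)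
  have h3 := size_statistic_step_le hN H hp (t := t) hh1 hs0 hs ω
  have hK := level_pos H
  rw [abs_mul, abs_of_pos (Real.exp_pos _)]
  calc _ ≤ 1 * ((1 + level lam mu c) * (Real.exp (lam + 1) *
      (1 + 1 / mu) ^ (N (t + h) ω - N t ω) * size (statistic lam mu m N p t ω))) := by
        refine mul_le_mul h1 (h2.trans ?_) (abs_nonneg _) one_pos.le
        exact mul_le_mul_of_nonneg_left h3 (by linarith)
    _ = _ := by unfold costConst; ring

theorem abs_stepCost_le (hp : 0 ≤ p) {t h : ℝ≥0} (hh1 : h ≤ 1) (ω : Ω) :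
    |stepCost lam mu c m N p t h ω| ≤ costConst lam mu c * h *
      (1 + 1 / mu) ^ (N (t + h) ω - N t ω) * size (statistic lam mu m N p t ω) := by
  rw [← Real.norm_eq_abs]
  refine (norm_setIntegral_le_of_norm_le_const (C := costConst lam mu c *
    (1 + 1 / mu) ^ (N (t + h) ω - N t ω) * size (statistic lam mu m N p t ω))
    (by simp) fun s hs => ?_).trans (le_of_eq ?_)
  · exact abs_discounted_cost_le hN H hp hh1 hs.1 hs.2.le ω
  · simp only [Real.volume_real_Ico, sub_zero, max_eq_left h.coe_nonneg]
    ring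

open Classical in
/-- The error profile as a function of the number of jumps in a step. -/
noncomputable def stepError (mu h : ℝ) (j : ℕ) : ℝ :=
  (1 + 1 / mu) ^ j - (if j = 0 then 1 else 0) + (h - (1 + 1 / mu)) * (if j = 1 then 1 else 0)

open Classical in
-- By the number j of jumps in the step. For j = 0 the path is the flow and the error is zero. For j
-- = 1 the cost is O(h) and the endpoint is O(h) away from the image of the starting point under
-- `jumpMap`. For j ≥ 2 the growth bound is enough, such steps having probability O(h²).
theorem abs_step_sub_le (hp : 0 ≤ p) {t h : ℝ≥0} (hh1 : h ≤ 1) (ω : Ω) :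
    |stepCost lam mu c m N p t h ω +
        Real.exp (-lam * h) * limV lam mu c m (statistic lam mu m N p (t + h : ℝ) ω) -
      (stayValue lam mu c m h (statistic lam mu m N p t ω) *
        (if N (t + h) ω - N t ω = 0 then 1 else 0) +
       limV lam mu c m (jumpMap mu (statistic lam mu m N p t ω)) *
        (if N (t + h) ω - N t ω = 1 then 1 else 0))| ≤
      pathConst lam mu c m *
        (size (statistic lam mu m N p t ω) * stepError mu h (N (t + h) ω - N t ω)) := by
  have hlam := H.lam_pos
  have hmu : 0 < mu := by linarith [H.one_lt_mu]
  have hq := statistic_nonneg hN H hp t.coe_nonneg ω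
  have hsz := two_le_size hq
  have hκ := lossBound_pos H
  have hL := lipConst_nonneg H
  have hD := moveConst_pos H
  have hB := costConst_pos H
  have hρ : 0 < 1 + 1 / mu := by positivity
  have hh0 : (0 : ℝ) ≤ h := h.coe_nonneg
  have hh1' : (h : ℝ) ≤ 1 := hh1
  have hcost := abs_stepCost_le hN H hp (t := t) hh1 ω
  have hle : N t ω ≤ N (t + h) ω := hN.mono ω le_self_add
  set q := statistic lam mu m N p t ω with hqdef
  set j := N (t + h) ω - N t ω with hj
  rcases Nat.lt_trichotomy j 1 with hj1 | hj1 | hj1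
  · have hj0 : j = 0 := by omega
    have hN0 : N (t + h) ω = N t ω := by omega
    have hconst : ∀ s : ℝ, 0 ≤ s → s ≤ h →
        statistic lam mu m N p (t + s) ω = flow lam m s q := by
      intro s hs0 hs
      lift s to ℝ≥0 using hs0
      refine statistic_of_eq p (le_antisymm ?_ (hN.mono ω le_self_add))
      rw [← hN0]
      exact hN.mono ω (by gcongr; exact hs)
    have e1 : stepCost lam mu c m N p t h ω =
        ∫ s in Ico (0 : ℝ) h, Real.exp (-lam * s) * runningCost lam c (flow lam m s q) := by
      refine setIntegral_congr_fun measurableSet_Ico fun s hs => ?_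
      simp only [hconst s hs.1 hs.2.le]
    rw [e1, hconst h hh0 le_rfl, hj0]
    simp [stayValue, stepError]
  · have hN1 : N (t + h) ω = N t ω + 1 := by omega
    obtain ⟨r, hr0, hrh, hr⟩ := statistic_of_succ hN p (lam := lam) (m := m) hN1
    have hr1 : r ≤ 1 := hrh.trans hh1'
    rw [hr, hj1]
    simp only [stepError, one_ne_zero, if_false, if_true, mul_zero, mul_one, zero_add, pow_one,
      sub_zero]
    rw [hj1, pow_one] at hcost
    have hf := flow_nonneg H.lam_pos H.m_mem hr0 hq
    have hSf := jumpMap_nonneg H.one_lt_mu hf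
    set a := flow lam m (h - r) (jumpMap mu (flow lam m r q)) with ha
    have d1 := flow_displacement H.lam_pos H.m_mem (t := h - r) (by linarith) (by linarith) hSf
    rw [← ha] at d1
    have d2 := (jumpMap_displacement H q (flow lam m r q)).trans (mul_le_mul_of_nonneg_left
      (flow_displacement H.lam_pos H.m_mem hr0 hr1 hq) hρ.le)
    have s1 : size (jumpMap mu (flow lam m r q)) ≤
        (1 + 1 / mu) * (Real.exp (lam + 1) * size q) :=
      (size_jumpMap_le H.one_lt_mu hf).trans
        (mul_le_mul_of_nonneg_left (size_flow_le_exp H hr0 hr1 hq) hρ.le)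
    have hexp1 : 1 ≤ Real.exp (lam + 1) := Real.one_le_exp (by linarith)
    have d1' : |a.1 - (jumpMap mu (flow lam m r q)).1| + |a.2 - (jumpMap mu (flow lam m r q)).2| ≤
        moveConst lam * h * ((1 + 1 / mu) * (Real.exp (lam + 1) * size q)) := by
      refine d1.trans ?_
      change moveConst lam * (h - r) * _ ≤ _
      refine mul_le_mul (mul_le_mul_of_nonneg_left (by linarith) hD.le) s1 ?_ (by positivity)
      exact (zero_le_two.trans (two_le_size hSf))
    have d2' : |(jumpMap mu (flow lam m r q)).1 - (jumpMap mu q).1| +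
        |(jumpMap mu (flow lam m r q)).2 - (jumpMap mu q).2| ≤
        moveConst lam * h * ((1 + 1 / mu) * (Real.exp (lam + 1) * size q)) := by
      refine d2.trans ?_
      change (1 + 1 / mu) * (moveConst lam * r * size q) ≤ _
      have : moveConst lam * r * size q ≤ moveConst lam * h * (Real.exp (lam + 1) * size q) := by
        refine mul_le_mul (mul_le_mul_of_nonneg_left hrh hD.le) ?_ (by linarith) (by positivity)
        exact le_mul_of_one_le_left (by linarith) hexp1
      calc _ ≤ (1 + 1 / mu) * (moveConst lam * h * (Real.exp (lam + 1) * size q)) :=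
            mul_le_mul_of_nonneg_left this hρ.le
        _ = _ := by ring
    have t1 := abs_sub_le a.1 (jumpMap mu (flow lam m r q)).1 (jumpMap mu q).1
    have t2 := abs_sub_le a.2 (jumpMap mu (flow lam m r q)).2 (jumpMap mu q).2
    have b1 := (abs_limV_sub_le H (jumpMap mu q) a).trans (mul_le_mul_of_nonneg_left
      (show _ ≤ 2 * (moveConst lam * h * ((1 + 1 / mu) * (Real.exp (lam + 1) * size q))) by
        linarith) hL)
    have b2 : |(Real.exp (-lam * h) - 1) * limV lam mu c m a| ≤
        lam * h * lossBound lam mu c m := by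
      rw [abs_mul]
      refine mul_le_mul ?_ (abs_limV_le H a) (abs_nonneg _) (by positivity)
      have := abs_exp_neg_sub_exp_neg_le (a := lam * h) (b := 0) (by positivity) le_rfl
      rwa [neg_zero, Real.exp_zero, sub_zero, abs_of_nonneg (show 0 ≤ lam * (h : ℝ) by positivity),
        ← neg_mul] at this
    have e : stepCost lam mu c m N p t h ω + Real.exp (-lam * h) * limV lam mu c m a -
        limV lam mu c m (jumpMap mu q) = stepCost lam mu c m N p t h ω +
        (Real.exp (-lam * h) - 1) * limV lam mu c m a +
        (limV lam mu c m a - limV lam mu c m (jumpMap mu q)) := by ring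
    rw [e]
    refine (abs_add_le _ _).trans ((add_le_add_left (abs_add_le _ _) _).trans ?_)
    have c1 : lam * h * lossBound lam mu c m ≤ (lam + 1) * lossBound lam mu c m * (size q * h) := by
      have : lam * h * lossBound lam mu c m ≤ (lam + 1) * lossBound lam mu c m * (1 * h) := by
        nlinarith [mul_nonneg hh0 hκ.le]
      refine this.trans ?_
      gcongr
      linarith
    have e2 : (1 + 1 / mu - 0 + (h - (1 + 1 / mu))) = (h : ℝ) := by ring
    refine (add_le_add (add_le_add hcost (b2.trans c1)) b1).trans (le_of_eq ?_)
    unfold pathConst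
    ring
  · have hj0 : j ≠ 0 := by omega
    have hj1' : j ≠ 1 := by omega
    simp only [stepError, if_neg hj0, if_neg hj1', mul_zero, add_zero, sub_zero]
    have hρ1 : 1 ≤ (1 + 1 / mu) ^ j := one_le_pow₀ (by
      have : 0 < 1 / mu := by positivity
      linarith)
    refine (abs_add_le _ _).trans ?_
    have b2 : |Real.exp (-lam * h) * limV lam mu c m (statistic lam mu m N p (t + h : ℝ) ω)| ≤
        1 * lossBound lam mu c m := by
      rw [abs_mul, abs_of_pos (Real.exp_pos _)]
      exact mul_le_mul (Real.exp_le_one_iff.2 (by nlinarith)) (abs_limV_le H _) (abs_nonneg _)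
        one_pos.le
    have hX : 1 ≤ size q * (1 + 1 / mu) ^ j := by nlinarith
    have c1 : costConst lam mu c * h * (1 + 1 / mu) ^ j * size q ≤
        costConst lam mu c * (1 + 1 / mu) * (size q * (1 + 1 / mu) ^ j) := by
      have h1 : (h : ℝ) ≤ 1 + 1 / mu := by
        have : 0 < 1 / mu := by positivity
        linarith
      have := mul_le_mul_of_nonneg_left h1 (mul_nonneg hB.le (by linarith : 0 ≤ size q * (1 + 1 / mu) ^ j))
      linarith
    have c2 : 1 * lossBound lam mu c m ≤
        (lam + 1) * lossBound lam mu c m * (size q * (1 + 1 / mu) ^ j) := by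
      have := mul_le_mul_of_nonneg_left hX (by positivity : 0 ≤ (lam + 1) * lossBound lam mu c m)
      nlinarith
    have c3 : 0 ≤ lipConst lam mu c m * (2 * (1 + 1 / mu) * Real.exp (lam + 1) * moveConst lam) *
        (size q * (1 + 1 / mu) ^ j) := by positivity
    refine (add_le_add (hcost.trans c1) (b2.trans c2)).trans ?_
    unfold pathConst
    linarith

/-- Every value of the statistic has integrable size. -/
theorem integrable_size_bound [IsProbabilityMeasure P] (p : ℝ × ℝ) (t : ℝ≥0) :
    Integrable (fun ω => Real.exp ((lam + 1) * t) * (1 + 1 / mu) ^ (N t ω) * size p) P ∧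
    ∫ ω, Real.exp ((lam + 1) * t) * (1 + 1 / mu) ^ (N t ω) * size p ∂P =
      Real.exp ((lam + 2) * t) * size p := by
  have hmu : 0 < mu := by linarith [H.one_lt_mu]
  obtain ⟨h1, h2⟩ := integral_pow_increment hN (s := 0) (t := t) zero_le hmu.le
    (ρ := 1 + 1 / mu) (by positivity)
  simp only [hN.zero, Nat.sub_zero] at h1 h2
  refine ⟨(h1.const_mul _).mul_const _, ?_⟩
  -- The flow contributes the rate λ + 1 and the jumps μ · (1/μ) = 1, in total λ + 2.
  rw [integral_mul_const, integral_const_mul, h2, ← Real.exp_add]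
  congr 2
  simp
  field_simp
  ring

theorem size_statistic_le' (hp : 0 ≤ p) (t : ℝ≥0) (ω : Ω) :
    size (statistic lam mu m N p t ω) ≤
      Real.exp ((lam + 1) * t) * (1 + 1 / mu) ^ (N t ω) * size p := by
  have h := size_statistic_le hN H hp 0 t ω
  simpa [hN.zero, statistic_zero hN] using h

theorem measurable_size_statistic (t : ℝ) :
    Measurable fun ω => size (statistic lam mu m N p t ω) := by
  have h1 : Measurable fun ω => statistic lam mu m N p t ω :=
    (measurable_statistic hN H p).comp (measurable_const.prodMk measurable_id)
  exact (measurable_const.add h1.fst).add h1.snd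

theorem integrable_size [IsProbabilityMeasure P] (hp : 0 ≤ p) (t : ℝ≥0) :
    Integrable (fun ω => size (statistic lam mu m N p t ω)) P ∧
    ∫ ω, size (statistic lam mu m N p t ω) ∂P ≤ Real.exp ((lam + 2) * t) * size p := by
  obtain ⟨h1, h2⟩ := integrable_size_bound hN H p t
  have h0 : ∀ ω, 0 ≤ size (statistic lam mu m N p t ω) := fun ω =>
    zero_le_two.trans (two_le_size (statistic_nonneg hN H hp t.coe_nonneg ω))
  have h3 : Integrable (fun ω => size (statistic lam mu m N p t ω)) P := by
    refine h1.mono' (measurable_size_statistic hN H t).aestronglyMeasurable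
      (Eventually.of_forall fun ω => ?_)
    rw [Real.norm_of_nonneg (h0 ω)]
    exact size_statistic_le' hN H hp t ω
  exact ⟨h3, h2 ▸ integral_mono h3 h1 (size_statistic_le' hN H hp t)⟩

theorem integrable_pow_mul_size [IsProbabilityMeasure P] (hp : 0 ≤ p) (t h : ℝ≥0) :
    Integrable (fun ω => (1 + 1 / mu) ^ (N (t + h) ω - N t ω) *
      size (statistic lam mu m N p t ω)) P := by
  have hmu : 0 < mu := by linarith [H.one_lt_mu]
  obtain ⟨h1, _⟩ := integral_pow_increment hN (s := 0) (t := t + h) zero_le hmu.le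
    (ρ := 1 + 1 / mu) (by positivity)
  simp only [hN.zero, Nat.sub_zero] at h1
  have hm : Measurable fun ω => N (t + h) ω - N t ω :=
    (hN.measurable (t + h)).sub (hN.measurable t)
  refine (h1.const_mul (Real.exp ((lam + 1) * t) * size p)).mono'
    (((measurable_from_top (f := fun j : ℕ => (1 + 1 / mu) ^ j)).comp hm).mul
      (measurable_size_statistic hN H t)).aestronglyMeasurable (Eventually.of_forall fun ω => ?_)
  have h0 := zero_le_two.trans (two_le_size (statistic_nonneg (lam := lam) (m := m) hN H hp t.coe_nonneg ω))
  rw [Real.norm_of_nonneg (by positivity)]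
  have h2 := size_statistic_le' hN H hp t ω
  have h3 : N t ω + (N (t + h) ω - N t ω) = N (t + h) ω :=
    Nat.add_sub_cancel' (hN.mono ω le_self_add)
  calc _ ≤ (1 + 1 / mu) ^ (N (t + h) ω - N t ω) *
        (Real.exp ((lam + 1) * t) * (1 + 1 / mu) ^ (N t ω) * size p) := by gcongr
    _ = Real.exp ((lam + 1) * t) * size p *
        (1 + 1 / mu) ^ (N t ω + (N (t + h) ω - N t ω)) := by rw [pow_add]; ring
    _ = _ := by rw [h3]

end Step


/-! ### One step of length h: averaging over events of the past -/

section

variable {Ω : Type*} [mΩ : MeasurableSpace Ω] {P : Measure Ω} [IsProbabilityMeasure P]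
  {N : ℝ≥0 → Ω → ℕ} {lam mu c m : ℝ} (hN : IsPoissonProcess N mu P) (H : Params lam mu c m)
  {p : ℝ × ℝ}

section Increment

include hN

/-- Up to a null set A belongs to the uncompleted past, so X restricted to A is independent of the
increment. -/
theorem setIntegral_mul_increment {s t : ℝ≥0} (hst : s ≤ t) {A : Set Ω}
    (hA : MeasurableSet[past N s ⊔ nullSigma P] A) {X : Ω → ℝ} (hX : Measurable[past N s] X)
    (f : ℕ → ℝ) : ∫ ω in A, X ω * f (N t ω - N s ω) ∂P =
      (∫ ω in A, X ω ∂P) * ∫ ω, f (N t ω - N s ω) ∂P := by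
  obtain ⟨B, hB, hAB⟩ := exists_past_ae_eq hA
  have hB' : MeasurableSet B := past_le hN s B hB
  rw [setIntegral_congr_set hAB, setIntegral_congr_set hAB, ← integral_indicator hB',
    ← integral_indicator hB', ← integral_mul_increment hN hst (hX.indicator hB)]
  congr 1
  funext ω
  by_cases h : ω ∈ B <;> simp [h]

omit [IsProbabilityMeasure P] in
theorem completedPast_le (t : ℝ≥0) : past N t ⊔ nullSigma P ≤ mΩ :=
  sup_le (past_le hN t) (nullSigma_le P)

omit [IsProbabilityMeasure P] in
open Classical in
theorem integral_increment_eq (t h : ℝ≥0) (k : ℕ) (hmu : 0 ≤ mu) :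
    ∫ ω, (if N (t + h) ω - N t ω = k then (1 : ℝ) else 0) ∂P =
      Real.exp (-(mu * h)) * (mu * h) ^ k / k.factorial := by
  have hm : Measurable fun ω => N (t + h) ω - N t ω :=
    (hN.measurable (t + h)).sub (hN.measurable t)
  have h1 := measure_increment hN (le_self_add : t ≤ t + h) k hmu
  have e : ((t + h : ℝ≥0) : ℝ) - t = h := by push_cast; ring
  rw [e] at h1
  rw [← h1]
  have h2 : (fun ω => if N (t + h) ω - N t ω = k then (1 : ℝ) else 0) =
      {ω | N (t + h) ω - N t ω = k}.indicator 1 := by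
    funext ω; simp [Set.indicator]
  have h3 : MeasurableSet {ω | N (t + h) ω - N t ω = k} := hm (measurableSet_singleton k)
  rw [h2, integral_indicator_one h3]

open Classical in
theorem integrable_increment_eq (t h : ℝ≥0) (k : ℕ) :
    Integrable (fun ω => if N (t + h) ω - N t ω = k then (1 : ℝ) else 0) P := by
  have hm : Measurable fun ω => N (t + h) ω - N t ω :=
    (hN.measurable (t + h)).sub (hN.measurable t)
  refine (integrable_const (1 : ℝ)).mono'
    ((measurable_from_top (f := fun j : ℕ => if j = k then (1 : ℝ) else 0)).comp
      hm).aestronglyMeasurable (Eventually.of_forall fun ω => ?_)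
  split_ifs <;> simp

open Classical in
-- With z = (μ+1)h the mean is e^{-μh}(e^z - 1 - z + μh²). The terms j = 0 and j = 1 remove the
-- first two terms of the exponential series, leaving a remainder of second order.
theorem integral_stepError_le (hmu : 0 < mu) (t : ℝ≥0) {h : ℝ≥0} (hh : (mu + 1) * h ≤ 1) :
    ∫ ω, stepError mu h (N (t + h) ω - N t ω) ∂P ≤ ((mu + 1) ^ 2 + mu) * h ^ 2 := by
  obtain ⟨h1, h2⟩ := integral_pow_increment hN (le_self_add : t ≤ t + h) hmu.le
    (ρ := 1 + 1 / mu) (by positivity)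
  have e : ((t + h : ℝ≥0) : ℝ) - t = h := by push_cast; ring
  rw [e] at h2
  have i0 := integrable_increment_eq hN t h 0
  have i1 := integrable_increment_eq hN t h 1
  have j0 := integral_increment_eq hN t h 0 hmu.le
  have j1 := integral_increment_eq hN t h 1 hmu.le
  have hh0 : (0 : ℝ) ≤ h := h.coe_nonneg
  simp only [stepError]
  have i2 : Integrable (fun ω => (1 + 1 / mu) ^ (N (t + h) ω - N t ω) -
    (if N (t + h) ω - N t ω = 0 then (1 : ℝ) else 0)) P := h1.sub i0
  rw [integral_add i2 (i1.const_mul _), integral_sub h1 i0, integral_const_mul, h2, j0, j1]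
  simp only [pow_zero, Nat.factorial, Nat.cast_one, pow_one, mul_one, div_one]
  have e1 : mu * h * (1 + 1 / mu - 1) = (mu + 1) * h - mu * h := by field_simp
  have e2 : Real.exp ((mu + 1) * h - mu * h) =
      Real.exp (-(mu * h)) * Real.exp ((mu + 1) * h) := by
    rw [← Real.exp_add]; congr 1; ring
  rw [e1, e2]
  have hz0 : 0 ≤ (mu + 1) * (h : ℝ) := by positivity
  have b1 := Real.abs_exp_sub_one_sub_id_le (x := (mu + 1) * h) (by rwa [abs_of_nonneg hz0])
  have b2 := le_of_abs_le b1
  have b3 : Real.exp (-(mu * h)) ≤ 1 := Real.exp_le_one_iff.2 (by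
    have : 0 ≤ mu * (h : ℝ) := by positivity
    linarith)
  have e3 : (1 + 1 / mu) * (mu * h) = (mu + 1) * (h : ℝ) := by field_simp
  have b4 : Real.exp ((mu + 1) * h) - 1 - (mu + 1) * h + mu * h ^ 2 ≤
      ((mu + 1) ^ 2 + mu) * h ^ 2 := by nlinarith
  have b5 : 0 ≤ ((mu + 1) ^ 2 + mu) * (h : ℝ) ^ 2 := by positivity
  calc _ = Real.exp (-(mu * h)) *
        (Real.exp ((mu + 1) * h) - 1 - (1 + 1 / mu) * (mu * h) + mu * h ^ 2) := by
        ring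
    _ ≤ Real.exp (-(mu * h)) * (((mu + 1) ^ 2 + mu) * h ^ 2) := by
        rw [e3]; exact mul_le_mul_of_nonneg_left b4 (Real.exp_pos _).le
    _ ≤ 1 * (((mu + 1) ^ 2 + mu) * h ^ 2) := mul_le_mul_of_nonneg_right b3 b5
    _ = _ := one_mul _

end Increment

include H in
theorem measurable_stayValue (h : ℝ) : Measurable (stayValue lam mu c m h) := by
  have h1 : Measurable fun q : (ℝ × ℝ) × ℝ => flow lam m q.2 q.1 :=
    (flow_continuous H.lam_pos m).measurable.comp (measurable_snd.prodMk measurable_fst)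
  have h2 : Measurable fun q : (ℝ × ℝ) × ℝ => Real.exp (-lam * q.2) *
      runningCost lam c (flow lam m q.2 q.1) := by
    have h4 : Measurable fun q : (ℝ × ℝ) × ℝ => Real.exp (-lam * q.2) := by fun_prop
    exact h4.mul ((h1.fst.add h1.snd).sub_const _)
  have h3 : Measurable fun q : ℝ × ℝ => limV lam mu c m (flow lam m h q) :=
    ((admissible_limV H).continuous H).measurable.comp
      ((flow_continuous H.lam_pos m).measurable.comp (measurable_const.prodMk measurable_id))
  exact h2.stronglyMeasurable.integral_prod_right.measurable.add (h3.const_mul _)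

include H in
theorem abs_stayValue_le {h : ℝ} (hh : 0 ≤ h) (hh1 : h ≤ 1) {q : ℝ × ℝ} (hq : 0 ≤ q) :
    |stayValue lam mu c m h q| ≤ costConst lam mu c * size q + lossBound lam mu c m := by
  have hlam := H.lam_pos
  have hK := level_pos H
  have hsz := two_le_size hq
  have hB := costConst_pos H
  unfold stayValue
  refine (abs_add_le _ _).trans (add_le_add ?_ ?_)
  · rw [← Real.norm_eq_abs]
    refine (norm_setIntegral_le_of_norm_le_const (C := costConst lam mu c * size q)
      (by simp) fun s hs => ?_).trans ?_
    · rw [Real.norm_eq_abs, abs_mul, abs_of_pos (Real.exp_pos _)]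
      have h1 : Real.exp (-lam * s) ≤ 1 := Real.exp_le_one_iff.2 (by nlinarith [hs.1])
      have h2 := abs_runningCost_le H (flow_nonneg H.lam_pos H.m_mem hs.1 hq)
      have h3 := size_flow_le_exp H hs.1 (hs.2.le.trans hh1) hq
      calc _ ≤ 1 * ((1 + level lam mu c) * (Real.exp (lam + 1) * size q)) := by
            refine mul_le_mul h1 (h2.trans ?_) (abs_nonneg _) one_pos.le
            exact mul_le_mul_of_nonneg_left h3 (by linarith)
        _ = _ := by unfold costConst; ring
    · simp only [Real.volume_real_Ico, sub_zero, max_eq_left hh]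
      exact mul_le_of_le_one_right (by positivity) hh1
  · rw [abs_mul, abs_of_pos (Real.exp_pos _)]
    have h1 : Real.exp (-lam * h) ≤ 1 := Real.exp_le_one_iff.2 (by nlinarith)
    exact (mul_le_mul h1 (abs_limV_le H _) (abs_nonneg _) one_pos.le).trans (one_mul _).le

/-- Value of a step: running cost and then the value function, discounted to the start. -/
noncomputable def stepValue (lam mu c m : ℝ) (N : ℝ≥0 → Ω → ℕ) (p : ℝ × ℝ) (t h : ℝ≥0) (ω : Ω) : ℝ :=
  stepCost lam mu c m N p t h ω +
    Real.exp (-lam * h) * limV lam mu c m (statistic lam mu m N p (t + h : ℝ) ω)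

include hN H

omit [IsProbabilityMeasure P] in
theorem measurable_limV_statistic (t : ℝ) :
    Measurable fun ω => limV lam mu c m (statistic lam mu m N p t ω) :=
  ((admissible_limV H).continuous H).measurable.comp
    ((measurable_statistic hN H p).comp (measurable_const.prodMk measurable_id))

theorem integrable_limV_statistic (t : ℝ) :
    Integrable (fun ω => limV lam mu c m (statistic lam mu m N p t ω)) P :=
  (integrable_const (lossBound lam mu c m)).mono'
    (measurable_limV_statistic hN H t).aestronglyMeasurable
    (Eventually.of_forall fun _ => abs_limV_le H _)

theorem integrable_stepCost (hp : 0 ≤ p) {t h : ℝ≥0} (hh1 : h ≤ 1) :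
    Integrable (stepCost lam mu c m N p t h) P := by
  refine ((integrable_pow_mul_size hN H hp t h).const_mul (costConst lam mu c * h)).mono'
    (measurable_stepCost hN H t h).aestronglyMeasurable (Eventually.of_forall fun ω => ?_)
  refine (abs_stepCost_le hN H hp hh1 ω).trans (le_of_eq (by ring))

theorem integrable_stepValue (hp : 0 ≤ p) {t h : ℝ≥0} (hh1 : h ≤ 1) :
    Integrable (stepValue lam mu c m N p t h) P :=
  (integrable_stepCost hN H hp hh1).add ((integrable_limV_statistic hN H _).const_mul _)

open Classical in
-- Independence of the increment from the past, even on A, turns the indicators of zero and one jump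
-- into e^{-μh} and μh e^{-μh}. The pathwise error also factorizes into a mean size times the mean
-- of `stepError`.
theorem abs_setIntegral_stepValue_sub_le (hp : 0 ≤ p) {t h : ℝ≥0} (hh1 : h ≤ 1)
    (hh2 : (mu + 1) * h ≤ 1) {A : Set Ω} (hA : MeasurableSet[past N t ⊔ nullSigma P] A) :
    |(∫ ω in A, stepValue lam mu c m N p t h ω ∂P) -
      ∫ ω in A, (Real.exp (-(mu * h)) * stayValue lam mu c m h (statistic lam mu m N p t ω) +
        mu * h * Real.exp (-(mu * h)) *
          limV lam mu c m (jumpMap mu (statistic lam mu m N p t ω))) ∂P| ≤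
      pathConst lam mu c m * ((mu + 1) ^ 2 + mu) * h ^ 2 *
        ∫ ω, size (statistic lam mu m N p t ω) ∂P := by
  have hmu : 0 < mu := by linarith [H.one_lt_mu]
  have hh1' : (h : ℝ) ≤ 1 := hh1
  have hh0 : (0 : ℝ) ≤ h := h.coe_nonneg
  have hm : Measurable fun ω => N (t + h) ω - N t ω :=
    (hN.measurable (t + h)).sub (hN.measurable t)
  have hle : t ≤ t + h := le_self_add
  obtain ⟨hsi, _⟩ := integrable_size hN H hp t
  have hC := pathConst_pos H
  have hpm : Measurable[past N t] fun ω => statistic lam mu m N p t ω :=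
    measurable_statistic_adapted hN H p fun s hs => measurable_past hs
  have hvc : Measurable (limV lam mu c m) := ((admissible_limV H).continuous H).measurable
  set S0 : Ω → ℝ := fun ω => stayValue lam mu c m h (statistic lam mu m N p t ω) with hS0
  set S1 : Ω → ℝ := fun ω => limV lam mu c m (jumpMap mu (statistic lam mu m N p t ω)) with hS1
  set I0 : Ω → ℝ := fun ω => if N (t + h) ω - N t ω = 0 then 1 else 0 with hI0
  set I1 : Ω → ℝ := fun ω => if N (t + h) ω - N t ω = 1 then 1 else 0 with hI1
  have m0 : Measurable[past N t] S0 := (measurable_stayValue H h).comp hpm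
  have m1 : Measurable[past N t] S1 := (hvc.comp jumpMap_continuous.measurable).comp hpm
  have i0 : Integrable S0 P := by
    refine ((hsi.const_mul (costConst lam mu c)).add
      (integrable_const (lossBound lam mu c m))).mono'
      (m0.mono (past_le hN t) le_rfl).aestronglyMeasurable (Eventually.of_forall fun ω => ?_)
    exact abs_stayValue_le H hh0 hh1' (statistic_nonneg hN H hp t.coe_nonneg ω)
  have i1 : Integrable S1 P :=
    (integrable_const (lossBound lam mu c m)).mono'
      (m1.mono (past_le hN t) le_rfl).aestronglyMeasurable
      (Eventually.of_forall fun _ => abs_limV_le H _)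
  have mI : ∀ k : ℕ, Measurable fun ω => if N (t + h) ω - N t ω = k then (1 : ℝ) else 0 :=
    fun k => (measurable_from_top (f := fun j : ℕ => if j = k then (1 : ℝ) else 0)).comp hm
  have i0' : Integrable (fun ω => S0 ω * I0 ω) P :=
    i0.mul_bdd (c := 1) (mI 0).aestronglyMeasurable (Eventually.of_forall fun ω => by
      simp only [hI0]; split_ifs <;> simp)
  have i1' : Integrable (fun ω => S1 ω * I1 ω) P :=
    i1.mul_bdd (c := 1) (mI 1).aestronglyMeasurable (Eventually.of_forall fun ω => by
      simp only [hI1]; split_ifs <;> simp)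
  have i01 : Integrable (fun ω => S0 ω * I0 ω + S1 ω * I1 ω) P := i0'.add i1'
  have iY := integrable_stepValue hN H hp (t := t) hh1
  have eM : ∫ ω in A, (Real.exp (-(mu * h)) * S0 ω + mu * h * Real.exp (-(mu * h)) * S1 ω) ∂P =
      ∫ ω in A, (S0 ω * I0 ω + S1 ω * I1 ω) ∂P := by
    rw [integral_add (i0.const_mul _).integrableOn (i1.const_mul _).integrableOn,
      integral_add i0'.integrableOn i1'.integrableOn, integral_const_mul, integral_const_mul]
    have k0 := setIntegral_mul_increment hN hle hA m0 (fun j => if j = 0 then 1 else 0)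
    have k1 := setIntegral_mul_increment hN hle hA m1 (fun j => if j = 1 then 1 else 0)
    rw [integral_increment_eq hN t h 0 hmu.le] at k0
    rw [integral_increment_eq hN t h 1 hmu.le] at k1
    rw [k0, k1]
    simp
    ring
  rw [eM, ← integral_sub iY.integrableOn i01.integrableOn]
  have iE : Integrable (fun ω => size (statistic lam mu m N p t ω) *
      stepError mu h (N (t + h) ω - N t ω)) P := by
    have hb := ((integrable_pow_mul_size hN H hp t h).add hsi).add
      (hsi.const_mul (|(h : ℝ) - (1 + 1 / mu)|))
    refine hb.mono' ((measurable_size_statistic hN H t).mul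
      ((measurable_from_top (f := stepError mu h)).comp hm)).aestronglyMeasurable
      (Eventually.of_forall fun ω => ?_)
    have hsz := zero_le_two.trans (two_le_size
      (statistic_nonneg (lam := lam) (m := m) hN H hp t.coe_nonneg ω))
    rw [norm_mul, Real.norm_of_nonneg hsz, Real.norm_eq_abs]
    have hs : |stepError mu h (N (t + h) ω - N t ω)| ≤
        (1 + 1 / mu) ^ (N (t + h) ω - N t ω) + 1 + |(h : ℝ) - (1 + 1 / mu)| := by
      unfold stepError
      refine (abs_add_le _ _).trans (add_le_add ((abs_sub _ _).trans (add_le_add ?_ ?_)) ?_)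
      · rw [abs_of_nonneg (by positivity)]
      · split_ifs <;> simp
      · rw [abs_mul]
        refine mul_le_of_le_one_right (abs_nonneg _) ?_
        split_ifs <;> simp
    refine (mul_le_mul_of_nonneg_left hs hsz).trans (le_of_eq ?_)
    simp only [Pi.add_apply]
    ring
  have hpath := fun ω => abs_step_sub_le hN H hp (t := t) hh1 ω
  rw [← Real.norm_eq_abs]
  refine (norm_integral_le_integral_norm _).trans ?_
  have hAm := completedPast_le (P := P) hN t A hA
  calc _ ≤ ∫ ω in A, pathConst lam mu c m * (size (statistic lam mu m N p t ω) *
        stepError mu h (N (t + h) ω - N t ω)) ∂P := by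
        refine integral_mono (iY.sub i01).norm.integrableOn
          (iE.const_mul _).integrableOn fun ω => ?_
        exact hpath ω
    _ ≤ ∫ ω, pathConst lam mu c m * (size (statistic lam mu m N p t ω) *
        stepError mu h (N (t + h) ω - N t ω)) ∂P := by
        refine setIntegral_le_integral (iE.const_mul _) (Eventually.of_forall fun ω => ?_)
        exact (abs_nonneg _).trans (hpath ω)
    _ = pathConst lam mu c m * ((∫ ω, size (statistic lam mu m N p t ω) ∂P) *
        ∫ ω, stepError mu h (N (t + h) ω - N t ω) ∂P) := by
        have hps : Measurable[past N t] fun ω => size (statistic lam mu m N p t ω) :=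
          (measurable_const.add hpm.fst).add hpm.snd
        rw [integral_const_mul, integral_mul_increment hN hle hps]
    _ ≤ pathConst lam mu c m * ((∫ ω, size (statistic lam mu m N p t ω) ∂P) *
        (((mu + 1) ^ 2 + mu) * h ^ 2)) := by
        refine mul_le_mul_of_nonneg_left (mul_le_mul_of_nonneg_left
          (integral_stepError_le hN hmu t hh2) ?_) hC.le
        exact integral_nonneg fun ω => zero_le_two.trans (two_le_size
          (statistic_nonneg hN H hp t.coe_nonneg ω))
    _ = _ := by ring

theorem integrable_meanValue (hp : 0 ≤ p) {t h : ℝ≥0} (hh1 : h ≤ 1) :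
    Integrable (fun ω => Real.exp (-(mu * h)) *
      stayValue lam mu c m h (statistic lam mu m N p t ω) + mu * h * Real.exp (-(mu * h)) *
          limV lam mu c m (jumpMap mu (statistic lam mu m N p t ω))) P := by
  have hpm : Measurable fun ω => statistic lam mu m N p t ω :=
    (measurable_statistic hN H p).comp (measurable_const.prodMk measurable_id)
  have hvc : Measurable (limV lam mu c m) := ((admissible_limV H).continuous H).measurable
  obtain ⟨hsi, _⟩ := integrable_size hN H hp t
  refine Integrable.add (Integrable.const_mul ?_ _) (Integrable.const_mul ?_ _)
  · refine ((hsi.const_mul (costConst lam mu c)).add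
      (integrable_const (lossBound lam mu c m))).mono'
      ((measurable_stayValue H h).comp hpm).aestronglyMeasurable
      (Eventually.of_forall fun ω => ?_)
    exact abs_stayValue_le H h.coe_nonneg hh1 (statistic_nonneg hN H hp t.coe_nonneg ω)
  · exact (integrable_const (lossBound lam mu c m)).mono'
      ((hvc.comp jumpMap_continuous.measurable).comp hpm).aestronglyMeasurable
      (Eventually.of_forall fun _ => abs_limV_le H _)

theorem setIntegral_size_le (hp : 0 ≤ p) (t : ℝ≥0) (A : Set Ω) {C : ℝ} (hC : 0 ≤ C) :
    ∫ ω in A, C * size (statistic lam mu m N p t ω) ∂P ≤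
      C * ∫ ω, size (statistic lam mu m N p t ω) ∂P := by
  rw [integral_const_mul]
  refine mul_le_mul_of_nonneg_left (setIntegral_le_integral (integrable_size hN H hp t).1
    (Eventually.of_forall fun ω => zero_le_two.trans (two_le_size
      (statistic_nonneg hN H hp t.coe_nonneg ω)))) hC

/-- One step of the value process does not decrease much in mean. -/
theorem setIntegral_stepValue_ge (hp : 0 ≤ p) {t h : ℝ≥0} (hh1 : h ≤ 1)
    (hh2 : (mu + 1) * h ≤ 1) {A : Set Ω} (hA : MeasurableSet[past N t ⊔ nullSigma P] A) :
    (∫ ω in A, limV lam mu c m (statistic lam mu m N p t ω) ∂P) -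
      stepConst lam mu c m * h ^ 2 * ∫ ω, size (statistic lam mu m N p t ω) ∂P ≤
    ∫ ω in A, stepValue lam mu c m N p t h ω ∂P := by
  have h1 := abs_le.1 (abs_setIntegral_stepValue_sub_le hN H hp hh1 hh2 hA)
  have hM := meanConst_pos H
  have h2 := setIntegral_size_le hN H hp t A (C := meanConst lam mu c m * h ^ 2) (by positivity)
  have hV := integrable_limV_statistic hN H (p := p) (t : ℝ)
  have hS := (integrable_size hN H hp t).1.const_mul (meanConst lam mu c m * (h : ℝ) ^ 2)
  have h3 : ∫ ω in A, (limV lam mu c m (statistic lam mu m N p t ω) -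
      meanConst lam mu c m * h ^ 2 * size (statistic lam mu m N p t ω)) ∂P ≤ _ :=
    integral_mono (hV.sub hS).integrableOn (integrable_meanValue hN H hp (t := t) hh1).integrableOn
      fun ω => by
        have hq := statistic_nonneg (lam := lam) (m := m) hN H hp t.coe_nonneg ω
        have k1 := abs_le.1 (abs_mean_sub_detStep_le H h.coe_nonneg hh1 hq)
        -- Valid at every point, hence a lower bound on every event of the past; the converse
        -- inequality needs the value to be away from zero.
        have k2 := limV_le_detStep H h.coe_nonneg hq
        beta_reduce
        linarith [k1.1]
  rw [integral_sub hV.integrableOn hS.integrableOn] at h3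
  unfold stepConst
  linarith [h1.1]

/-- While the value is negative enough, it does not increase much in mean. -/
theorem setIntegral_stepValue_le (hp : 0 ≤ p) {t h : ℝ≥0} (hh1 : h ≤ 1)
    (hh2 : (mu + 1) * h ≤ 1) {A : Set Ω} (hA : MeasurableSet[past N t ⊔ nullSigma P] A)
    (hneg : ∀ ω ∈ A, limV lam mu c m (statistic lam mu m N p t ω) < -(level lam mu c * h)) :
    ∫ ω in A, stepValue lam mu c m N p t h ω ∂P ≤
    (∫ ω in A, limV lam mu c m (statistic lam mu m N p t ω) ∂P) +
      stepConst lam mu c m * h ^ 2 * ∫ ω, size (statistic lam mu m N p t ω) ∂P := by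
  have h1 := abs_le.1 (abs_setIntegral_stepValue_sub_le hN H hp hh1 hh2 hA)
  have hM := meanConst_pos H
  have h2 := setIntegral_size_le hN H hp t A (C := meanConst lam mu c m * h ^ 2) (by positivity)
  have hV := integrable_limV_statistic hN H (p := p) (t : ℝ)
  have hS := (integrable_size hN H hp t).1.const_mul (meanConst lam mu c m * (h : ℝ) ^ 2)
  have h3 : _ ≤ ∫ ω in A, (limV lam mu c m (statistic lam mu m N p t ω) +
      meanConst lam mu c m * h ^ 2 * size (statistic lam mu m N p t ω)) ∂P :=
    setIntegral_mono_on (integrable_meanValue hN H hp (t := t) hh1).integrableOn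
      (hV.add hS).integrableOn (completedPast_le (P := P) hN t A hA) fun ω hω => by
        have hq := statistic_nonneg (lam := lam) (m := m) hN H hp t.coe_nonneg ω
        have k1 := abs_le.1 (abs_mean_sub_detStep_le H h.coe_nonneg hh1 hq)
        have k2 := detStep_le_limV H h.coe_nonneg hq (hneg ω hω)
        linarith [k1.2]
  rw [integral_add hV.integrableOn hS.integrableOn] at h3
  unfold stepConst
  linarith [h1.2]

end


/-! ### The cost as an integral over a region of `Ω × ℝ` -/

section

variable {Ω : Type*} [mΩ : MeasurableSpace Ω] {P : Measure Ω} [IsProbabilityMeasure P]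
  {N : ℝ≥0 → Ω → ℕ} {lam mu c m : ℝ} (hN : IsPoissonProcess N mu P) (H : Params lam mu c m)
  {p : ℝ × ℝ}

/-- The discounted running cost. -/
noncomputable def discCost (lam mu c m : ℝ) (N : ℝ≥0 → Ω → ℕ) (p : ℝ × ℝ) (z : Ω × ℝ) : ℝ :=
  Real.exp (-lam * z.2) * runningCost lam c (statistic lam mu m N p z.2 z.1)

/-- The stochastic interval `[0, τ)`. -/
def region (τ : Ω → ℝ≥0∞) : Set (Ω × ℝ) := {z | z.2 ∈ before (τ z.1)}

/-- The stochastic interval made of the cells `A k × [k h, (k + 1) h)`, `k < M`. -/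
def gridRegion (A : ℕ → Set Ω) (h : ℝ≥0) (M : ℕ) : Set (Ω × ℝ) :=
  ⋃ k ∈ Finset.range M, A k ×ˢ Ico ((k * h : ℝ≥0) : ℝ) ((k * h : ℝ≥0) + h)

theorem measurableSet_region {τ : Ω → ℝ≥0∞} (hτ : Measurable τ) : MeasurableSet (region τ) :=
  (measurableSet_le measurable_const measurable_snd).inter
    (measurableSet_lt (ENNReal.measurable_ofReal.comp measurable_snd) (hτ.comp measurable_fst))

omit [IsProbabilityMeasure P] in
theorem lintegral_region [SFinite P] {τ : Ω → ℝ≥0∞} (hτ : Measurable τ) {f : Ω × ℝ → ℝ≥0∞}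
    (hf : Measurable f) : ∫⁻ ω, (∫⁻ s in before (τ ω), f (ω, s)) ∂P =
      ∫⁻ z in region τ, f z ∂(P.prod volume) := by
  have hE := measurableSet_region hτ
  rw [← lintegral_indicator hE, lintegral_prod _ (hf.indicator hE).aemeasurable]
  refine lintegral_congr fun ω => ?_
  rw [← lintegral_indicator (measurableSet_before _)]
  rfl

include hN H

omit [IsProbabilityMeasure P] in
theorem measurable_discCost : Measurable (discCost lam mu c m N p) := by
  have h1 : Measurable fun z : Ω × ℝ => statistic lam mu m N p z.2 z.1 :=
    (measurable_statistic hN H p).comp (measurable_snd.prodMk measurable_fst)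
  have h2 : Measurable fun z : Ω × ℝ => Real.exp (-lam * z.2) := by fun_prop
  exact h2.mul ((h1.fst.add h1.snd).sub_const _)

theorem expectedCost_eq {τ : Ω → ℝ≥0∞} (hτ : Measurable τ) :
    expectedCost P lam mu c m N p τ =
      ((∫⁻ z in region τ, ENNReal.ofReal (discCost lam mu c m N p z) ∂(P.prod volume) : ℝ≥0∞) :
        EReal) -
      ((∫⁻ z in region τ, ENNReal.ofReal (-discCost lam mu c m N p z) ∂(P.prod volume) : ℝ≥0∞) :
        EReal) := by
  have hm := measurable_discCost hN H (p := p)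
  have h1 := lintegral_region (P := P) hτ hm.ennreal_ofReal
  have h2 := lintegral_region (P := P) hτ hm.neg.ennreal_ofReal
  simp only [Pi.neg_apply] at h2
  rw [← h1, ← h2]
  rfl

/-- For integrable costs, in particular over bounded horizons, the extended-real difference is an
ordinary integral. -/
theorem expectedCost_eq_integral {τ : Ω → ℝ≥0∞} (hτ : Measurable τ)
    (hi : IntegrableOn (discCost lam mu c m N p) (region τ) (P.prod volume)) :
    expectedCost P lam mu c m N p τ =
      ((∫ z in region τ, discCost lam mu c m N p z ∂(P.prod volume) : ℝ) : EReal) := by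
  rw [expectedCost_eq hN H hτ, integral_eq_lintegral_pos_part_sub_lintegral_neg_part hi]
  have h1 := hi.lintegral_lt_top.ne
  have h2 := hi.neg.lintegral_lt_top.ne
  simp only [Pi.neg_apply] at h2
  rw [EReal.coe_sub, EReal.coe_ennreal_toReal h1, EReal.coe_ennreal_toReal h2]

omit [IsProbabilityMeasure P] in
theorem abs_discCost_le (hp : 0 ≤ p) {T : ℝ≥0} {s : ℝ} (hs : s ∈ Ico (0 : ℝ) T) (ω : Ω) :
    |discCost lam mu c m N p (ω, s)| ≤ (1 + level lam mu c) *
      (Real.exp ((lam + 1) * T) * (1 + 1 / mu) ^ (N T ω) * size p) := by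
  have hlam := H.lam_pos
  have hmu : 0 < mu := by linarith [H.one_lt_mu]
  have hK := level_pos H
  have hsz := zero_le_two.trans (two_le_size hp)
  obtain ⟨hs0, hsT⟩ := hs
  lift s to ℝ≥0 using hs0
  have h1 := abs_runningCost_le H (statistic_nonneg (lam := lam) (m := m) hN H hp s.coe_nonneg ω)
  have h2 := size_statistic_le' hN H hp s ω
  have h3 : Real.exp ((lam + 1) * s) * (1 + 1 / mu) ^ (N s ω) * size p ≤
      Real.exp ((lam + 1) * T) * (1 + 1 / mu) ^ (N T ω) * size p := by
    have hmm : N s ω ≤ N T ω := hN.mono ω (by exact_mod_cast hsT.le)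
    gcongr
    exact le_add_of_nonneg_right (by positivity)
  unfold discCost
  rw [abs_mul, abs_of_pos (Real.exp_pos _)]
  have h4 : Real.exp (-lam * s) ≤ 1 := Real.exp_le_one_iff.2 (by
    have := s.coe_nonneg
    nlinarith)
  calc _ ≤ 1 * ((1 + level lam mu c) * size (statistic lam mu m N p s ω)) :=
        mul_le_mul h4 h1 (abs_nonneg _) one_pos.le
    _ ≤ _ := by
        rw [one_mul]
        exact mul_le_mul_of_nonneg_left (h2.trans h3) (by linarith)

theorem integrable_discCost (hp : 0 ≤ p) (T : ℝ≥0) :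
    IntegrableOn (discCost lam mu c m N p) (univ ×ˢ Ico (0 : ℝ) T) (P.prod volume) := by
  obtain ⟨h1, _⟩ := integrable_size_bound hN H p T
  have h2 : Integrable ((Ico (0 : ℝ) T).indicator fun _ => (1 : ℝ)) volume :=
    (integrable_indicator_iff measurableSet_Ico).2 (by simp)
  rw [← integrable_indicator_iff (MeasurableSet.univ.prod measurableSet_Ico)]
  refine ((h1.const_mul (1 + level lam mu c)).mul_prod h2).mono'
    ((measurable_discCost hN H).indicator
      (MeasurableSet.univ.prod measurableSet_Ico)).aestronglyMeasurable
    (Eventually.of_forall fun z => ?_)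
  by_cases hz : z.2 ∈ Ico (0 : ℝ) T
  · have : z ∈ (univ : Set Ω) ×ˢ Ico (0 : ℝ) T := ⟨mem_univ _, hz⟩
    rw [indicator_of_mem this, indicator_of_mem hz, mul_one]
    exact abs_discCost_le hN H hp hz z.1
  · have : z ∉ (univ : Set Ω) ×ˢ Ico (0 : ℝ) T := fun h => hz h.2
    rw [indicator_of_notMem this, indicator_of_notMem hz]
    simp

theorem setIntegral_cell (hp : 0 ≤ p) (A : Set Ω) (t h : ℝ≥0) :
    ∫ z in A ×ˢ Ico (t : ℝ) (t + h), discCost lam mu c m N p z ∂(P.prod volume) =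
      Real.exp (-lam * t) * ∫ ω in A, stepCost lam mu c m N p t h ω ∂P := by
  have hsub : A ×ˢ Ico (t : ℝ) (t + h) ⊆ univ ×ˢ Ico (0 : ℝ) ((t + h : ℝ≥0) : ℝ) := by
    rintro ⟨ω, s⟩ ⟨_, hs1, hs2⟩
    exact ⟨mem_univ _, t.coe_nonneg.trans hs1, by push_cast; exact hs2⟩
  rw [setIntegral_prod _ ((integrable_discCost hN H hp (t + h)).mono_set hsub),
    ← integral_const_mul]
  congr 1
  funext ω
  have e := (measurePreserving_add_left volume (t : ℝ)).setIntegral_preimage_emb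
    (measurableEmbedding_addLeft (t : ℝ)) (fun s => discCost lam mu c m N p (ω, s))
    (Ico (t : ℝ) (t + h))
  have e2 : (fun s : ℝ => (t : ℝ) + s) ⁻¹' Ico (t : ℝ) (t + h) = Ico 0 (h : ℝ) := by
    ext s; simp
  rw [← e, e2, stepCost, ← integral_const_mul]
  congr 1
  funext s
  simp only [discCost]
  rw [← mul_assoc, ← Real.exp_add]
  congr 2
  ring

omit mΩ [IsProbabilityMeasure P] hN H in
theorem gridRegion_subset (A : ℕ → Set Ω) (h : ℝ≥0) (M : ℕ) :
    gridRegion A h M ⊆ univ ×ˢ Ico (0 : ℝ) ((M * h : ℝ≥0) : ℝ) := by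
  rintro ⟨ω, s⟩ hz
  simp only [gridRegion, mem_iUnion, Finset.mem_range, exists_prop] at hz
  obtain ⟨k, hk, _, hs1, hs2⟩ := hz
  refine ⟨mem_univ _, (k * h : ℝ≥0).coe_nonneg.trans hs1, hs2.trans_le ?_⟩
  have : ((k : ℝ) + 1) ≤ M := by exact_mod_cast hk
  have h0 := h.coe_nonneg
  push_cast
  nlinarith

theorem setIntegral_gridRegion (hp : 0 ≤ p) {A : ℕ → Set Ω} (hA : ∀ k, MeasurableSet (A k))
    (h : ℝ≥0) (M : ℕ) :
    ∫ z in gridRegion A h M, discCost lam mu c m N p z ∂(P.prod volume) =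
      ∑ k ∈ Finset.range M, Real.exp (-lam * (k * h : ℝ≥0)) *
        ∫ ω in A k, stepCost lam mu c m N p (k * h) h ω ∂P := by
  unfold gridRegion
  rw [integral_biUnion_finset]
  · exact Finset.sum_congr rfl fun k _ => setIntegral_cell hN H hp _ _ _
  · exact fun k _ => (hA k).prod measurableSet_Ico
  · have key : ∀ i j : ℕ, i < j → Disjoint
        (A i ×ˢ Ico ((i * h : ℝ≥0) : ℝ) ((i * h : ℝ≥0) + h))
        (A j ×ˢ Ico ((j * h : ℝ≥0) : ℝ) ((j * h : ℝ≥0) + h)) := by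
      intro i j hij
      refine Set.disjoint_left.2 ?_
      rintro ⟨ω, s⟩ ⟨_, _, h2⟩ ⟨_, h3, _⟩
      have : ((i : ℝ) + 1) ≤ j := by exact_mod_cast hij
      have h0 := h.coe_nonneg
      push_cast at h2 h3
      nlinarith
    intro i _ j _ hij
    rcases lt_or_gt_of_ne hij with hlt | hlt
    · exact key i j hlt
    · exact (key j i hlt).symm
  · intro k hk
    refine (integrable_discCost hN H hp (M * h)).mono_set (subset_trans ?_
      (gridRegion_subset A h M))
    exact subset_biUnion_of_mem (u := fun k : ℕ =>
      A k ×ˢ Ico ((k * h : ℝ≥0) : ℝ) ((k * h : ℝ≥0) + h)) hk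

/-- The value of the statistic at grid times, discounted to time zero. -/
noncomputable def gridValue (lam mu c m : ℝ) (N : ℝ≥0 → Ω → ℕ) (p : ℝ × ℝ) (h : ℝ≥0) (k : ℕ)
    (ω : Ω) : ℝ :=
  Real.exp (-lam * (k * h : ℝ≥0)) *
    limV lam mu c m (statistic lam mu m N p ((k * h : ℝ≥0) : ℝ) ω)

theorem integrable_gridValue (h : ℝ≥0) (k : ℕ) : Integrable (gridValue lam mu c m N p h k) P :=
  (integrable_limV_statistic hN H _).const_mul _

omit mΩ hN [IsProbabilityMeasure P] in
theorem gridValue_nonpos (h : ℝ≥0) (k : ℕ) (ω : Ω) : gridValue lam mu c m N p h k ω ≤ 0 :=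
  mul_nonpos_of_nonneg_of_nonpos (Real.exp_pos _).le ((admissible_limV H).nonpos _)

omit H [IsProbabilityMeasure P] in
theorem gridValue_zero (h : ℝ≥0) (ω : Ω) :
    gridValue lam mu c m N p h 0 ω = limV lam mu c m p := by
  simp [gridValue, statistic_zero hN]

/-- The cost of a step is its `stepValue` minus the discounted value at the next grid time. Once
`stepValue` is replaced by the current value, the sum over k telescopes. -/
theorem setIntegral_stepCost_eq (hp : 0 ≤ p) {h : ℝ≥0} (hh1 : h ≤ 1) (A : Set Ω) (k : ℕ) :
    Real.exp (-lam * (k * h : ℝ≥0)) * ∫ ω in A, stepCost lam mu c m N p (k * h) h ω ∂P =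
      Real.exp (-lam * (k * h : ℝ≥0)) * (∫ ω in A, stepValue lam mu c m N p (k * h) h ω ∂P) -
        ∫ ω in A, gridValue lam mu c m N p h (k + 1) ω ∂P := by
  have e : ∫ ω in A, stepValue lam mu c m N p (k * h) h ω ∂P =
      (∫ ω in A, stepCost lam mu c m N p (k * h) h ω ∂P) +
      ∫ ω in A, Real.exp (-lam * h) * limV lam mu c m
        (statistic lam mu m N p ((k * h : ℝ≥0) + h : ℝ) ω) ∂P :=
    integral_add (integrable_stepCost hN H hp hh1).integrableOn
      ((integrable_limV_statistic hN H _).const_mul _).integrableOn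
  have e1 : (((k + 1 : ℕ) * h : ℝ≥0) : ℝ) = (k * h : ℝ≥0) + h := by push_cast; ring
  have e2 : ∫ ω in A, gridValue lam mu c m N p h (k + 1) ω ∂P =
      Real.exp (-lam * (k * h : ℝ≥0)) * ∫ ω in A, Real.exp (-lam * h) * limV lam mu c m
        (statistic lam mu m N p ((k * h : ℝ≥0) + h : ℝ) ω) ∂P := by
    rw [← integral_const_mul]
    congr 1
    funext ω
    simp only [gridValue, e1]
    rw [← mul_assoc, ← Real.exp_add]
    congr 2
    ring
  rw [e, e2]
  ring

end


section

variable {Ω : Type*} [mΩ : MeasurableSpace Ω] {P : Measure Ω}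
  {N : ℝ≥0 → Ω → ℕ} {lam mu c m : ℝ}

/-! ### The observation filtration -/

theorem past_sup_le_observationFiltration (hN : ∀ t, Measurable (N t)) (t : ℝ≥0) :
    past N t ⊔ nullSigma P ≤ observationFiltration P N hN t := by
  unfold observationFiltration
  exact Filtration.le_rightCont
    (Filtration.natural N (fun t => (hN t).stronglyMeasurable) ⊔
      Filtration.const ℝ≥0 (nullSigma P) (nullSigma_le P)) t

theorem observationFiltration_le {hN : ∀ t, Measurable (N t)} {s t : ℝ≥0} (hst : s < t) :
    observationFiltration P N hN s ≤ past N t ⊔ nullSigma P := by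
  unfold observationFiltration
  rw [Filtration.rightCont_eq]
  exact iInf₂_le t hst

theorem _root_.MeasureTheory.IsStoppingTime.measurable_ennreal {f : Filtration ℝ≥0 mΩ}
    {τ : Ω → ℝ≥0∞} (hτ : IsStoppingTime (ι := ℝ≥0) f τ) : Measurable τ := by
  refine measurable_of_Iic fun x => ?_
  induction x with
  | top => simp
  | coe x => exact f.le x _ (hτ x)

/-- The event τ < t is a countable union of events τ ≤ q with q < t, each decided strictly before t.
So the right-continuous enlargement adds nothing here. -/
theorem measurableSet_le_stoppingTime {hN : ∀ t, Measurable (N t)} {τ : Ω → ℝ≥0∞}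
    (hτ : IsStoppingTime (ι := ℝ≥0) (observationFiltration P N hN) τ) (t : ℝ≥0) :
    MeasurableSet[past N t ⊔ nullSigma P] {ω | (t : ℝ≥0∞) ≤ τ ω} := by
  have e : {ω | (t : ℝ≥0∞) ≤ τ ω} =
      (⋃ q : {q : ℚ // Real.toNNReal q < t}, {ω | τ ω ≤ (Real.toNNReal q : ℝ≥0)})ᶜ := by
    ext ω
    simp only [mem_ofPred_eq, mem_compl_iff, mem_iUnion, not_exists, not_le]
    refine ⟨fun h q => lt_of_lt_of_le (ENNReal.coe_lt_coe.2 q.2) h, fun h => ?_⟩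
    by_contra! hlt
    obtain ⟨q, _, hq1, hq2⟩ := ENNReal.lt_iff_exists_rat_btwn.1 hlt
    exact lt_asymm hq1 (h ⟨q, ENNReal.coe_lt_coe.1 hq2⟩)
  rw [e]
  exact MeasurableSet.compl (MeasurableSet.iUnion fun q =>
    observationFiltration_le (hN := hN) q.2 _ (hτ _))

/-! ### Telescoping along the grid -/

variable [IsProbabilityMeasure P] (hN : IsPoissonProcess N mu P) (H : Params lam mu c m)
  {p : ℝ × ℝ}

include hN H

/-- One error bound for all M steps. Their sum is of order M h², that is, T h when M h = T. -/
theorem discount_stepConst_le (hp : 0 ≤ p) {h : ℝ≥0} {k M : ℕ} (hk : k ≤ M) :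
    Real.exp (-lam * (k * h : ℝ≥0)) * (stepConst lam mu c m * h ^ 2 *
      ∫ ω, size (statistic lam mu m N p ((k * h : ℝ≥0) : ℝ) ω) ∂P) ≤
    stepConst lam mu c m * h ^ 2 * (Real.exp ((lam + 2) * (M * h : ℝ≥0)) * size p) := by
  have hlam := H.lam_pos
  have hC := stepConst_pos H
  have hsz := zero_le_two.trans (two_le_size hp)
  have hkh : ((k * h : ℝ≥0) : ℝ) ≤ (M * h : ℝ≥0) := by
    have : (k : ℝ≥0) * h ≤ M * h := by gcongr
    exact_mod_cast this
  have h1 := (integrable_size hN H hp (k * h)).2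
  have h2 : Real.exp (-lam * (k * h : ℝ≥0)) ≤ 1 := Real.exp_le_one_iff.2 (by
    have := (k * h : ℝ≥0).coe_nonneg
    nlinarith)
  have h3 : Real.exp ((lam + 2) * (k * h : ℝ≥0)) * size p ≤
      Real.exp ((lam + 2) * (M * h : ℝ≥0)) * size p := by gcongr
  refine (mul_le_of_le_one_left ?_ h2).trans
    (mul_le_mul_of_nonneg_left (h1.trans h3) (by positivity))
  exact mul_nonneg (by positivity) (integral_nonneg fun ω => zero_le_two.trans (two_le_size
    (statistic_nonneg hN H hp (k * h : ℝ≥0).coe_nonneg ω)))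

omit [IsProbabilityMeasure P] hN H in
theorem setIntegral_gridValue_eq (A : Set Ω) (h : ℝ≥0) (k : ℕ) :
    Real.exp (-lam * (k * h : ℝ≥0)) *
      ∫ ω in A, limV lam mu c m (statistic lam mu m N p ((k * h : ℝ≥0) : ℝ) ω) ∂P =
    ∫ ω in A, gridValue lam mu c m N p h k ω ∂P := by
  rw [← integral_const_mul]; rfl

/-- The sum telescopes up to replacing `A k` by the smaller `A (k + 1)`, and this has the right sign
because the values are nonpositive. -/
theorem sum_setIntegral_gridValue_ge {A : ℕ → Set Ω}
    (hA0 : A 0 = univ) (hanti : Antitone A) (h : ℝ≥0) (M : ℕ) :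
    limV lam mu c m p - ∫ ω in A M, gridValue lam mu c m N p h M ω ∂P ≤
      ∑ k ∈ Finset.range M, ((∫ ω in A k, gridValue lam mu c m N p h k ω ∂P) -
        ∫ ω in A k, gridValue lam mu c m N p h (k + 1) ω ∂P) := by
  induction M with
  | zero => simp [hA0, gridValue_zero hN]
  | succ M ih =>
    rw [Finset.sum_range_succ]
    have h1 : ∫ ω in A (M + 1), -gridValue lam mu c m N p h (M + 1) ω ∂P ≤
        ∫ ω in A M, -gridValue lam mu c m N p h (M + 1) ω ∂P :=
      setIntegral_mono_set (integrable_gridValue hN H h (M + 1)).neg.integrableOn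
        (Eventually.of_forall fun ω => neg_nonneg.2 (gridValue_nonpos H h (M + 1) ω))
        (LE.le.eventuallyLE (hanti M.le_succ))
    rw [integral_neg, integral_neg] at h1
    linarith

theorem setIntegral_gridRegion_ge (hp : 0 ≤ p) {h : ℝ≥0} (hh1 : h ≤ 1)
    (hh2 : (mu + 1) * h ≤ 1) {A : ℕ → Set Ω}
    (hA : ∀ k : ℕ, MeasurableSet[past N (k * h) ⊔ nullSigma P] (A k))
    (hA0 : A 0 = univ) (hanti : Antitone A) (M : ℕ) :
    limV lam mu c m p - M * (stepConst lam mu c m * h ^ 2 *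
      (Real.exp ((lam + 2) * (M * h : ℝ≥0)) * size p)) ≤
    ∫ z in gridRegion A h M, discCost lam mu c m N p z ∂(P.prod volume) := by
  have hA' : ∀ k, MeasurableSet (A k) := fun k => completedPast_le hN _ _ (hA k)
  rw [setIntegral_gridRegion hN H hp hA']
  have h1 := sum_setIntegral_gridValue_ge hN H (p := p) hA0 hanti h M
  have h2 : ∫ ω in A M, gridValue lam mu c m N p h M ω ∂P ≤ 0 :=
    integral_nonpos fun ω => gridValue_nonpos H h M ω
  have h3 : ∑ k ∈ Finset.range M, (((∫ ω in A k, gridValue lam mu c m N p h k ω ∂P) -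
        ∫ ω in A k, gridValue lam mu c m N p h (k + 1) ω ∂P) - stepConst lam mu c m * h ^ 2 *
      (Real.exp ((lam + 2) * (M * h : ℝ≥0)) * size p)) ≤
      ∑ k ∈ Finset.range M, Real.exp (-lam * (k * h : ℝ≥0)) *
        ∫ ω in A k, stepCost lam mu c m N p (k * h) h ω ∂P := by
    refine Finset.sum_le_sum fun k hk => ?_
    rw [setIntegral_stepCost_eq hN H hp hh1, ← setIntegral_gridValue_eq (A k) h k]
    have k1 := mul_le_mul_of_nonneg_left (setIntegral_stepValue_ge hN H hp hh1 hh2 (hA k))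
      (Real.exp_pos (-lam * (k * h : ℝ≥0))).le
    have k2 := discount_stepConst_le hN H hp (h := h) (Finset.mem_range.1 hk).le
    rw [mul_sub] at k1
    linarith
  rw [Finset.sum_sub_distrib, Finset.sum_const, Finset.card_range, nsmul_eq_mul] at h3
  linarith

/-- The event that the value has stayed away from zero at the first grid times. -/
def awayEvent (lam mu c m : ℝ) (N : ℝ≥0 → Ω → ℕ) (p : ℝ × ℝ) (h : ℝ≥0) (k : ℕ) : Set Ω :=
  {ω | ∀ j ≤ k, limV lam mu c m (statistic lam mu m N p ((j * h : ℝ≥0) : ℝ) ω) <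
    -(level lam mu c * h)}

omit mΩ hN H in
theorem awayEvent_antitone (h : ℝ≥0) : Antitone (awayEvent lam mu c m N p h) :=
  fun _ _ hij _ hω j hj => hω j (hj.trans hij)

omit [IsProbabilityMeasure P] in
theorem measurableSet_awayEvent (h : ℝ≥0) (k : ℕ) :
    MeasurableSet[past N (k * h)] (awayEvent lam mu c m N p h k) := by
  have e : awayEvent lam mu c m N p h k = ⋂ j : ℕ, ⋂ _ : j ≤ k,
      (fun ω => limV lam mu c m (statistic lam mu m N p ((j * h : ℝ≥0) : ℝ) ω)) ⁻¹'
        Iio (-(level lam mu c * h)) := by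
    ext ω; simp [awayEvent]
  rw [e]
  refine MeasurableSet.iInter fun j => MeasurableSet.iInter fun hj => ?_
  have hjk : (j : ℝ≥0) * h ≤ k * h := by gcongr
  have h1 : Measurable[past N (k * h)]
      fun ω => statistic lam mu m N p ((j * h : ℝ≥0) : ℝ) ω :=
    measurable_statistic_adapted (mΩ := mΩ) hN H p fun s hs => measurable_past (hs.trans hjk)
  exact (((admissible_limV H).continuous H).measurable.comp h1) measurableSet_Iio

omit [IsProbabilityMeasure P] in
open Classical in
-- Pathwise the sum runs up to the first exit from the away events and equals the initial value
-- minus the value at exit. The latter is at least -`level` h, or at least the discounted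
-- -`lossBound` if there was no exit before the horizon.
theorem sum_gridValue_le (h : ℝ≥0) (M : ℕ) (ω : Ω) :
    ∑ k ∈ Finset.range M, (awayEvent lam mu c m N p h k).indicator
      (fun ω => gridValue lam mu c m N p h k ω - gridValue lam mu c m N p h (k + 1) ω) ω ≤
    limV lam mu c m p + level lam mu c * h +
      Real.exp (-lam * (M * h : ℝ≥0)) * lossBound lam mu c m := by
  have hK := level_pos H
  have hκ := lossBound_pos H
  have hlam := H.lam_pos
  set D : ℕ → ℝ := fun M => ∑ k ∈ Finset.range M, (awayEvent lam mu c m N p h k).indicator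
      (fun ω => gridValue lam mu c m N p h k ω - gridValue lam mu c m N p h (k + 1) ω) ω with hD
  have hu : ∀ k : ℕ, -(level lam mu c * h) ≤
      limV lam mu c m (statistic lam mu m N p ((k * h : ℝ≥0) : ℝ) ω) →
      -(level lam mu c * h) ≤ gridValue lam mu c m N p h k ω := by
    intro k hk
    have h1 : Real.exp (-lam * (k * h : ℝ≥0)) ≤ 1 := Real.exp_le_one_iff.2 (by
      have := (k * h : ℝ≥0).coe_nonneg
      nlinarith)
    have h2 := (admissible_limV H).nonpos (statistic lam mu m N p ((k * h : ℝ≥0) : ℝ) ω)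
    unfold gridValue
    nlinarith
  -- Before the exit the sum has telescoped exactly; from the exit on it is frozen, and only its
  -- bound is kept.
  have claim : ∀ M, (ω ∈ awayEvent lam mu c m N p h M ∧
      D M = limV lam mu c m p - gridValue lam mu c m N p h M ω) ∨
      (ω ∉ awayEvent lam mu c m N p h M ∧ D M ≤ limV lam mu c m p + level lam mu c * h) := by
    intro M
    induction M with
    | zero =>
      by_cases hω : ω ∈ awayEvent lam mu c m N p h 0
      · exact Or.inl ⟨hω, by simp [hD, gridValue_zero hN]⟩
      · refine Or.inr ⟨hω, ?_⟩
        have : ¬ limV lam mu c m p < -(level lam mu c * h) := fun hlt => hω fun j hj => by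
          obtain rfl := Nat.le_zero.1 hj
          simpa [statistic_zero hN] using hlt
        simp only [hD, Finset.range_zero, Finset.sum_empty]
        linarith
    | succ M ih =>
      have e : D (M + 1) = D M + (awayEvent lam mu c m N p h M).indicator
        (fun ω => gridValue lam mu c m N p h M ω - gridValue lam mu c m N p h (M + 1) ω) ω :=
        Finset.sum_range_succ _ _
      rcases ih with ⟨hω, hM⟩ | ⟨hω, hM⟩
      · rw [indicator_of_mem hω, hM] at e
        by_cases hω' : ω ∈ awayEvent lam mu c m N p h (M + 1)
        · exact Or.inl ⟨hω', by rw [e]; ring⟩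
        · refine Or.inr ⟨hω', ?_⟩
          have : -(level lam mu c * h) ≤ limV lam mu c m
              (statistic lam mu m N p (((M + 1 : ℕ) * h : ℝ≥0) : ℝ) ω) := by
            by_contra! hlt
            refine hω' fun j hj => ?_
            rcases hj.lt_or_eq with hj | rfl
            · exact hω j (Nat.lt_succ_iff.1 hj)
            · exact hlt
          have := hu (M + 1) this
          rw [e]; linarith
      · refine Or.inr ⟨fun h' => hω (awayEvent_antitone h M.le_succ h'), ?_⟩
        rw [e, indicator_of_notMem hω, add_zero]
        exact hM
  have hfin : 0 ≤ Real.exp (-lam * (M * h : ℝ≥0)) * lossBound lam mu c m := by positivity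
  have hKh : 0 ≤ level lam mu c * h := by positivity
  change D M ≤ _
  rcases claim M with ⟨_, hM⟩ | ⟨_, hM⟩
  · have h1 := (admissible_limV H).lower (statistic lam mu m N p ((M * h : ℝ≥0) : ℝ) ω)
    have h2 := mul_le_mul_of_nonneg_left h1 (Real.exp_pos (-lam * (M * h : ℝ≥0))).le
    rw [hM]
    unfold gridValue
    linarith
  · linarith

/-- On the away events continuing for one more step is optimal for `limV`, so the lower bound for
all strategies is nearly attained. -/
theorem setIntegral_gridRegion_le (hp : 0 ≤ p) {h : ℝ≥0} (hh1 : h ≤ 1)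
    (hh2 : (mu + 1) * h ≤ 1) (M : ℕ) :
    ∫ z in gridRegion (awayEvent lam mu c m N p h) h M, discCost lam mu c m N p z
      ∂(P.prod volume) ≤
    limV lam mu c m p + level lam mu c * h +
      Real.exp (-lam * (M * h : ℝ≥0)) * lossBound lam mu c m +
      M * (stepConst lam mu c m * h ^ 2 *
        (Real.exp ((lam + 2) * (M * h : ℝ≥0)) * size p)) := by
  have hA : ∀ k : ℕ, MeasurableSet[past N (k * h) ⊔ nullSigma P]
      (awayEvent lam mu c m N p h k) := fun k =>
    (le_sup_left : past N (k * h) ≤ past N (k * h) ⊔ nullSigma P) _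
      (measurableSet_awayEvent hN H h k)
  have hA' : ∀ k, MeasurableSet (awayEvent lam mu c m N p h k) := fun k =>
    completedPast_le hN _ _ (hA k)
  have hi := fun k => integrable_gridValue hN H (p := p) h k
  have hi' : ∀ k, Integrable (fun ω => (awayEvent lam mu c m N p h k).indicator (fun ω =>
      gridValue lam mu c m N p h k ω - gridValue lam mu c m N p h (k + 1) ω) ω) P :=
    fun k => ((hi k).sub (hi (k + 1))).indicator (hA' k)
  rw [setIntegral_gridRegion hN H hp hA']
  have h3 : ∑ k ∈ Finset.range M, Real.exp (-lam * (k * h : ℝ≥0)) *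
        ∫ ω in awayEvent lam mu c m N p h k, stepCost lam mu c m N p (k * h) h ω ∂P ≤
      ∑ k ∈ Finset.range M, ((∫ ω, (awayEvent lam mu c m N p h k).indicator (fun ω =>
        gridValue lam mu c m N p h k ω - gridValue lam mu c m N p h (k + 1) ω) ω ∂P) +
        stepConst lam mu c m * h ^ 2 *
      (Real.exp ((lam + 2) * (M * h : ℝ≥0)) * size p)) := by
    refine Finset.sum_le_sum fun k hk => ?_
    rw [integral_indicator (hA' k), integral_sub (hi k).integrableOn (hi (k + 1)).integrableOn,
      setIntegral_stepCost_eq hN H hp hh1, ← setIntegral_gridValue_eq _ h k]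
    have k1 := mul_le_mul_of_nonneg_left (setIntegral_stepValue_le hN H hp hh1 hh2 (hA k)
      fun ω hω => hω k le_rfl) (Real.exp_pos (-lam * (k * h : ℝ≥0))).le
    have k2 := discount_stepConst_le hN H hp (h := h) (Finset.mem_range.1 hk).le
    rw [mul_add] at k1
    linarith
  rw [Finset.sum_add_distrib, Finset.sum_const, Finset.card_range, nsmul_eq_mul,
    ← integral_finsetSum _ fun k _ => hi' k] at h3
  have h4 := integral_mono (μ := P) (integrable_finsetSum (Finset.range M) fun k _ => hi' k) (integrable_const _)
    fun ω => sum_gridValue_le hN H (p := p) h M ω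
  rw [integral_const, probReal_univ, one_smul] at h4
  exact h3.trans (add_le_add_left h4 _)

end


section

variable {Ω : Type*} [mΩ : MeasurableSpace Ω] {P : Measure Ω} [IsProbabilityMeasure P]
  {N : ℝ≥0 → Ω → ℕ} {lam mu c m : ℝ} (hN : IsPoissonProcess N mu P) (H : Params lam mu c m)
  {p : ℝ × ℝ}

/-! ### No stopping time does better than the value -/

omit mΩ in
theorem region_min_subset (τ : Ω → ℝ≥0∞) (T : ℝ≥0) :
    region (fun ω => min (τ ω) T) ⊆ univ ×ˢ Ico (0 : ℝ) T := by
  rintro ⟨ω, s⟩ ⟨hs0, hs⟩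
  refine ⟨mem_univ _, hs0, ?_⟩
  have h1 := hs.trans_le (min_le_right _ _)
  rw [← ENNReal.ofReal_coe_nnreal] at h1
  exact (ENNReal.ofReal_lt_ofReal_iff_of_nonneg hs0).1 h1

omit mΩ in
-- A time s < τ lies in the cell k = ⌊s/h⌋, and k h ≤ s < τ.
theorem region_min_subset_gridRegion (τ : Ω → ℝ≥0∞) {h : ℝ≥0} (hh : 0 < h) (M : ℕ) :
    region (fun ω => min (τ ω) (M * h : ℝ≥0)) ⊆
      gridRegion (fun k => {ω | ((k * h : ℝ≥0) : ℝ≥0∞) ≤ τ ω}) h M := by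
  rintro ⟨ω, s⟩ hz
  have h2 := (region_min_subset τ (M * h) hz).2.2
  obtain ⟨hs0, hs⟩ := hz
  simp only at hs0 hs h2
  have hh' : (0 : ℝ) < h := hh
  have k1 : (⌊s / h⌋₊ : ℝ) * h ≤ s := (le_div_iff₀ hh').1 (Nat.floor_le (by positivity))
  have k2 : s < (⌊s / h⌋₊ : ℝ) * h + h := by
    have := (div_lt_iff₀ hh').1 (Nat.lt_floor_add_one (s / h))
    linarith
  simp only [gridRegion, mem_iUnion, Finset.mem_range, exists_prop]
  refine ⟨⌊s / h⌋₊, ?_, ?_, by push_cast; exact ⟨k1, k2⟩⟩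
  · push_cast at h2
    have : (⌊s / h⌋₊ : ℝ) < M := lt_of_mul_lt_mul_right (k1.trans_lt h2) hh'.le
    exact_mod_cast this
  · refine le_of_lt (lt_of_le_of_lt ?_ (hs.trans_le (min_le_left _ _)))
    rw [← ENNReal.ofReal_coe_nnreal]
    exact ENNReal.ofReal_le_ofReal (by push_cast; exact k1)

omit mΩ in
-- An excess point s satisfies k h ≤ τ ≤ s < (k + 1) h, so rounding up to the grid adds less than
-- one cell. There τ is finite, hence `toReal` is faithful.
theorem gridRegion_diff_subset (τ : Ω → ℝ≥0∞) (h : ℝ≥0) (M : ℕ) :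
    gridRegion (fun k => {ω | ((k * h : ℝ≥0) : ℝ≥0∞) ≤ τ ω}) h M \
      region (fun ω => min (τ ω) (M * h : ℝ≥0)) ⊆
    {z | z.2 ∈ Ico (τ z.1).toReal ((τ z.1).toReal + h)} := by
  rintro ⟨ω, s⟩ ⟨hz, hn⟩
  have hT := (gridRegion_subset _ h M hz).2
  simp only [gridRegion, mem_iUnion, Finset.mem_range, exists_prop] at hz
  obtain ⟨k, _, hk, _, hs2⟩ := hz
  have hle : τ ω ≤ ENNReal.ofReal s := by
    by_contra! hlt
    refine hn ⟨hT.1, lt_min hlt ?_⟩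
    rw [← ENNReal.ofReal_coe_nnreal]
    exact (ENNReal.ofReal_lt_ofReal_iff_of_nonneg hT.1).2 hT.2
  have hfin : τ ω ≠ ⊤ := (hle.trans_lt ENNReal.ofReal_lt_top).ne
  refine ⟨ENNReal.toReal_le_of_le_ofReal hT.1 hle, hs2.trans_le (add_le_add_left ?_ _)⟩
  have := ENNReal.toReal_mono hfin hk
  exact this

include hN H

/-- Every section of E has length at most h, and the cost up to T is dominated by an integrable
function of ω alone. -/
theorem abs_setIntegral_le_of_thin (hp : 0 ≤ p) {T h : ℝ≥0} {E : Set (Ω × ℝ)}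
    (hE : MeasurableSet E) (hET : E ⊆ univ ×ˢ Ico (0 : ℝ) T) {θ : Ω → ℝ}
    (hthin : E ⊆ {z | z.2 ∈ Ico (θ z.1) (θ z.1 + h)}) :
    |∫ z in E, discCost lam mu c m N p z ∂(P.prod volume)| ≤
      h * ((1 + level lam mu c) * (Real.exp ((lam + 2) * T) * size p)) := by
  have hK := level_pos H
  have hsz := zero_le_two.trans (two_le_size hp)
  have hmu : 0 < mu := by linarith [H.one_lt_mu]
  have hi := ((integrable_discCost hN H hp T).mono_set hET).integrable_indicator hE
  obtain ⟨d1, d2⟩ := integrable_size_bound hN H p T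
  rw [← integral_indicator hE, integral_prod _ hi, ← Real.norm_eq_abs, ← d2,
    ← integral_const_mul, ← integral_const_mul]
  refine (norm_integral_le_integral_norm _).trans (integral_mono hi.integral_prod_left.norm
    ((d1.const_mul _).const_mul _) fun ω => ?_)
  have hsl : MeasurableSet (Prod.mk ω ⁻¹' E) := measurable_prodMk_left hE
  have e : ∫ s, E.indicator (discCost lam mu c m N p) (ω, s) =
      ∫ s in Prod.mk ω ⁻¹' E, discCost lam mu c m N p (ω, s) := by
    rw [← integral_indicator hsl]; rfl
  beta_reduce
  rw [e]
  have hv : volume.real (Prod.mk ω ⁻¹' E) ≤ h := by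
    have h1 : Prod.mk ω ⁻¹' E ⊆ Ico (θ ω) (θ ω + h) := fun s hs => hthin hs
    refine (measureReal_mono h1 (by simp)).trans ?_
    simp
  have hfin : volume (Prod.mk ω ⁻¹' E) < ⊤ := by
    have h1 : Prod.mk ω ⁻¹' E ⊆ Ico (θ ω) (θ ω + h) := fun s hs => hthin hs
    exact (measure_mono h1).trans_lt (by simp)
  refine (norm_setIntegral_le_of_norm_le_const hfin fun s hs =>
    abs_discCost_le hN H hp (hET hs).2 ω).trans ?_
  rw [mul_comm]
  exact mul_le_mul_of_nonneg_right hv (by positivity)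

/-- With h = T/M, the M one-step errors of order h² and the O(h) cost of rounding τ up to the grid
add up to (T/M) C, which vanishes as M grows. -/
theorem limV_le_integral_region (hp : 0 ≤ p) {τ : Ω → ℝ≥0∞}
    (hτ : IsStoppingTime (ι := ℝ≥0) (observationFiltration P N hN.measurable) τ) (T : ℝ≥0) :
    limV lam mu c m p ≤ ∫ z in region (fun ω => min (τ ω) T),
      discCost lam mu c m N p z ∂(P.prod volume) := by
  have hmu : 0 < mu := by linarith [H.one_lt_mu]
  have hτm : Measurable τ := hτ.measurable_ennreal
  rcases eq_zero_or_pos T with rfl | hT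
  · have : region (fun ω => min (τ ω) ((0 : ℝ≥0) : ℝ≥0∞)) = ∅ := by
      ext z; simp [region]
    rw [this]
    simpa using (admissible_limV H).nonpos p
  set C : ℝ := T * (stepConst lam mu c m * (Real.exp ((lam + 2) * T) * size p)) +
    (1 + level lam mu c) * (Real.exp ((lam + 2) * T) * size p) with hC
  have hlim : Tendsto (fun M : ℕ => limV lam mu c m p - (T : ℝ) / M * C) atTop
      (𝓝 (limV lam mu c m p - 0 * C)) :=
    ((tendsto_const_div_atTop_nhds_zero_nat (T : ℝ)).mul_const C).const_sub _
  rw [zero_mul, sub_zero] at hlim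
  refine le_of_tendsto hlim ?_
  obtain ⟨M₀, hM₀⟩ := exists_nat_gt ((mu + 1) * T)
  filter_upwards [eventually_ge_atTop M₀, eventually_gt_atTop 0] with M hM hM0
  have hM0' : (0 : ℝ) < M := by exact_mod_cast hM0
  set h : ℝ≥0 := T / M with hh
  have hhr : (h : ℝ) = T / M := by simp [hh]
  have hMh : (M : ℝ≥0) * h = T := by
    rw [hh]; field_simp
  have hh0 : 0 < h := by rw [hh]; positivity
  have hh2 : (mu + 1) * h ≤ 1 := by
    rw [hhr, ← mul_div_assoc, div_le_one hM0']
    exact hM₀.le.trans (by exact_mod_cast hM)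
  have hh1 : h ≤ 1 := by
    have : (h : ℝ) ≤ 1 := by
      have := h.coe_nonneg
      nlinarith
    exact_mod_cast this
  set A : ℕ → Set Ω := fun k => {ω | ((k * h : ℝ≥0) : ℝ≥0∞) ≤ τ ω} with hA
  have hAm : ∀ k : ℕ, MeasurableSet[past N (k * h) ⊔ nullSigma P] (A k) := fun k =>
    measurableSet_le_stoppingTime hτ _
  have hA0 : A 0 = univ := by ext ω; simp [hA]
  have hanti : Antitone A := by
    intro i j hij ω hω
    refine le_trans ?_ (show ((j * h : ℝ≥0) : ℝ≥0∞) ≤ τ ω from hω)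
    have : (i : ℝ≥0) * h ≤ j * h := by gcongr
    exact_mod_cast this
  have key := setIntegral_gridRegion_ge hN H hp hh1 hh2 hAm hA0 hanti M
  have hsub := region_min_subset_gridRegion τ hh0 M
  have hdiff := gridRegion_diff_subset τ h M
  have hgT := gridRegion_subset A h M
  rw [hMh] at key hsub hdiff hgT
  have hEm : MeasurableSet (region fun ω => min (τ ω) T) :=
    measurableSet_region (hτm.min measurable_const)
  have hGm : MeasurableSet (gridRegion A h M) := by
    refine MeasurableSet.biUnion (Finset.range M).countable_toSet fun k _ => ?_
    exact (completedPast_le hN _ _ (hAm k)).prod measurableSet_Ico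
  have hgi := (integrable_discCost hN H hp T).mono_set hgT
  have hthin := abs_le.1 (abs_setIntegral_le_of_thin hN H hp (hGm.diff hEm)
    (sdiff_subset.trans hgT)
    (θ := fun ω => (τ ω).toReal) hdiff)
  have hd := setIntegral_sdiff hEm hgi hsub
  have e : (M : ℝ) * (stepConst lam mu c m * h ^ 2 * (Real.exp ((lam + 2) * T) * size p)) +
      h * ((1 + level lam mu c) * (Real.exp ((lam + 2) * T) * size p)) = T / M * C := by
    rw [hC, hhr]; field_simp
  linarith [hthin.2]

theorem lintegral_discCost_neg_lt_top (hp : 0 ≤ p) {τ : Ω → ℝ≥0∞} (hτ : Measurable τ) :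
    ∫⁻ z in region τ, ENNReal.ofReal (-discCost lam mu c m N p z) ∂(P.prod volume) < ⊤ := by
  have hlam := H.lam_pos
  have hc := H.c_pos
  have hi : IntegrableOn (fun s => lam / c * √2 * Real.exp (-lam * s)) (Ici (0 : ℝ)) volume := by
    rw [integrableOn_Ici_iff_integrableOn_Ioi]
    exact (integrableOn_exp_mul_Ioi (neg_lt_zero.2 hlam) 0).const_mul _
  have hr := lintegral_region (P := P) hτ
    (measurable_discCost hN H (p := p)).neg.ennreal_ofReal
  simp only [Pi.neg_apply] at hr
  rw [← hr]
  have h1 : ∀ ω, ∫⁻ s in before (τ ω), ENNReal.ofReal (-discCost lam mu c m N p (ω, s)) ≤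
      ∫⁻ s in Ici (0 : ℝ), ENNReal.ofReal (lam / c * √2 * Real.exp (-lam * s)) := by
    intro ω
    refine (setLIntegral_mono (by fun_prop) fun s hs => ENNReal.ofReal_le_ofReal ?_).trans
      (lintegral_mono_set (before_subset_Ici _))
    have h2 := statistic_nonneg (lam := lam) (m := m) hN H hp hs.1 ω
    have h3 : -runningCost lam c (statistic lam mu m N p s ω) ≤ lam / c * √2 := by
      unfold runningCost
      linarith [h2.1, h2.2, show (0 : ℝ × ℝ).1 = 0 from rfl, show (0 : ℝ × ℝ).2 = 0 from rfl]
    have := mul_le_mul_of_nonneg_left h3 (Real.exp_pos (-lam * s)).le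
    unfold discCost
    simp only
    linarith
  refine (lintegral_mono h1).trans_lt ?_
  rw [lintegral_const, measure_univ, mul_one]
  exact hi.lintegral_lt_top

/-- For each truncation at n the negative part is at most the positive part, hence at most the full
positive part. Monotone convergence of the negative part removes the truncation, even if the
positive part is infinite. -/
theorem expectedCost_nonneg (hp : 0 ≤ p) (hv : limV lam mu c m p = 0) {τ : Ω → ℝ≥0∞}
    (hτ : IsStoppingTime (ι := ℝ≥0) (observationFiltration P N hN.measurable) τ) :
    0 ≤ expectedCost P lam mu c m N p τ := by
  have hτm : Measurable τ := hτ.measurable_ennreal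
  have hB := lintegral_discCost_neg_lt_top hN H hp hτm
  rw [expectedCost_eq hN H hτm, EReal.sub_nonneg (Or.inr (by simpa using hB.ne))
    (Or.inr (EReal.coe_ennreal_ne_bot _)), EReal.coe_ennreal_le_coe_ennreal_iff]
  have hU : region τ = ⋃ n : ℕ, region fun ω => min (τ ω) ((n : ℝ≥0) : ℝ≥0∞) := by
    ext ⟨ω, s⟩
    simp only [region, before_min, mem_iUnion, mem_ofPred_eq, mem_inter_iff]
    refine ⟨fun h => ?_, fun ⟨_, h⟩ => h.1⟩
    obtain ⟨n, hn⟩ := exists_nat_gt s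
    refine ⟨n, h, h.1, ?_⟩
    rw [← ENNReal.ofReal_coe_nnreal]
    exact (ENNReal.ofReal_lt_ofReal_iff_of_nonneg h.1).2 (by simpa using hn)
  have hmono : Monotone fun n : ℕ => region fun ω => min (τ ω) ((n : ℝ≥0) : ℝ≥0∞) := by
    intro i j hij z hz
    refine before_mono (min_le_min_left _ ?_) hz
    exact_mod_cast hij
  rw [hU, setLIntegral_iUnion_of_directed _ hmono.directed_le, ← hU]
  refine iSup_le fun n => ?_
  have h1 := limV_le_integral_region hN H hp hτ n
  have hi := (integrable_discCost hN H hp n).mono_set (region_min_subset τ n)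
  rw [hv, integral_eq_lintegral_pos_part_sub_lintegral_neg_part hi, sub_nonneg] at h1
  have h2 := hi.lintegral_lt_top.ne
  have h3 := hi.neg.lintegral_lt_top.ne
  simp only [Pi.neg_apply] at h3
  refine ((ENNReal.toReal_le_toReal h3 h2).1 h1).trans (lintegral_mono_set fun z hz => ?_)
  exact before_mono (min_le_left _ _) hz

theorem valueFunction_eq_zero (hp : 0 ≤ p) (hv : limV lam mu c m p = 0) :
    valueFunction P lam mu c m N hN.measurable p = 0 := by
  refine le_antisymm ?_ (le_iInf₂ fun τ hτ => expectedCost_nonneg hN H hp hv hτ)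
  have h0 : IsStoppingTime (ι := ℝ≥0) (observationFiltration P N hN.measurable)
      (fun _ : Ω => (0 : ℝ≥0∞)) := isStoppingTime_const _ (0 : ℝ≥0)
  refine (iInf₂_le _ h0).trans (le_of_eq ?_)
  simp [expectedCost]

/-! ### Waiting while the value is away from zero -/

omit mΩ [IsProbabilityMeasure P] hN H in
open Classical in
-- For decreasing events the indices below M whose event contains ω form an initial segment, so
-- their number is the index of first exit, capped at M.
theorem card_filter_antitone {A : ℕ → Set Ω} (hA : Antitone A) {M k : ℕ} (hk : k < M) (ω : Ω) :
    k < ((Finset.range M).filter fun k => ω ∈ A k).card ↔ ω ∈ A k := by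
  refine ⟨fun h => ?_, fun h => ?_⟩
  · by_contra hω
    have hs : ((Finset.range M).filter fun k => ω ∈ A k) ⊆ Finset.range k := fun j hj => by
      rw [Finset.mem_range]
      by_contra! hkj
      exact hω (hA hkj (Finset.mem_filter.1 hj).2)
    have := Finset.card_le_card hs
    rw [Finset.card_range] at this
    exact absurd h (not_lt.2 this)
  · have hs : Finset.range (k + 1) ⊆ (Finset.range M).filter fun k => ω ∈ A k := fun j hj => by
      have hj' := Nat.lt_succ_iff.1 (Finset.mem_range.1 hj)
      exact Finset.mem_filter.2 ⟨Finset.mem_range.2 (hj'.trans_lt hk), hA hj' h⟩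
    have := Finset.card_le_card hs
    rwa [Finset.card_range] at this

open Classical in
/-- The end of the last consecutive cell `[k h, (k + 1) h)`, `k < M`, with `ω ∈ A k`. -/
noncomputable def gridTime (A : ℕ → Set Ω) (h : ℝ≥0) (M : ℕ) (ω : Ω) : ℝ≥0 :=
  ((Finset.range M).filter fun k => ω ∈ A k).card * h

omit mΩ [IsProbabilityMeasure P] hN H in
theorem lt_gridTime_iff {A : ℕ → Set Ω} (hA : Antitone A) {h : ℝ≥0} (hh : 0 < h) (M : ℕ) (ω : Ω)
    (s : ℝ≥0) : s < gridTime A h M ω ↔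
      ∃ k < M, ω ∈ A k ∧ ((k * h : ℝ≥0) : ℝ) ≤ s ∧ (s : ℝ) < (k * h : ℝ≥0) + h := by
  classical
  have hh' : (0 : ℝ) < h := hh
  have hcard : ((Finset.range M).filter fun k => ω ∈ A k).card ≤ M := by
    simpa using Finset.card_filter_le (Finset.range M) fun k => ω ∈ A k
  rw [← NNReal.coe_lt_coe]
  unfold gridTime
  push_cast
  constructor
  · intro hs
    have k1 : (⌊(s : ℝ) / h⌋₊ : ℝ) * h ≤ s := (le_div_iff₀ hh').1 (Nat.floor_le (by positivity))
    have k2 : (s : ℝ) < (⌊(s : ℝ) / h⌋₊ : ℝ) * h + h := by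
      have := (div_lt_iff₀ hh').1 (Nat.lt_floor_add_one ((s : ℝ) / h))
      linarith
    have k3 : ⌊(s : ℝ) / h⌋₊ < ((Finset.range M).filter fun k => ω ∈ A k).card := by
      have := lt_of_mul_lt_mul_right (k1.trans_lt hs) hh'.le
      exact_mod_cast this
    have k4 := k3.trans_le hcard
    exact ⟨_, k4, (card_filter_antitone hA k4 ω).1 k3, k1, k2⟩
  · rintro ⟨k, hk, hω, _, hs⟩
    have k3 := (card_filter_antitone hA hk ω).2 hω
    have : ((k : ℝ) + 1) ≤ ((Finset.range M).filter fun k => ω ∈ A k).card := by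
      exact_mod_cast k3
    nlinarith

omit mΩ [IsProbabilityMeasure P] hN H in
theorem region_gridTime {A : ℕ → Set Ω} (hA : Antitone A) {h : ℝ≥0} (hh : 0 < h) (M : ℕ) :
    region (fun ω => (gridTime A h M ω : ℝ≥0∞)) = gridRegion A h M := by
  ext ⟨ω, s⟩
  simp only [region, before, gridRegion, mem_iUnion, Finset.mem_range, exists_prop,
    mem_ofPred_eq]
  constructor
  · rintro ⟨hs0, hs⟩
    lift s to ℝ≥0 using hs0
    rw [ENNReal.ofReal_coe_nnreal, ENNReal.coe_lt_coe, lt_gridTime_iff hA hh] at hs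
    obtain ⟨k, hk, h1, h2⟩ := hs
    exact ⟨k, hk, h1, h2⟩
  · rintro ⟨k, hk, h1, h2⟩
    have hs0 : 0 ≤ s := (k * h : ℝ≥0).coe_nonneg.trans h2.1
    refine ⟨hs0, ?_⟩
    lift s to ℝ≥0 using hs0
    rw [ENNReal.ofReal_coe_nnreal, ENNReal.coe_lt_coe, lt_gridTime_iff hA hh]
    exact ⟨k, hk, h1, h2⟩

omit [IsProbabilityMeasure P] in
-- Whether the time exceeds t is decided by the event of the cell [k h, (k + 1) h) containing t,
-- which is known at k h ≤ t.
theorem isStoppingTime_gridTime {h : ℝ≥0} (hh : 0 < h) (M : ℕ) :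
    IsStoppingTime (ι := ℝ≥0) (observationFiltration P N hN.measurable)
      (fun ω => (gridTime (awayEvent lam mu c m N p h) h M ω : ℝ≥0∞)) := by
  intro t
  have e : {ω | (gridTime (awayEvent lam mu c m N p h) h M ω : ℝ≥0∞) ≤ (t : ℝ≥0∞)} =
      (⋃ k : ℕ, ⋃ _ : k < M ∧ ((k * h : ℝ≥0) : ℝ) ≤ t ∧ (t : ℝ) < (k * h : ℝ≥0) + h,
        awayEvent lam mu c m N p h k)ᶜ := by
    ext ω
    rw [mem_compl_iff, mem_ofPred_eq, ENNReal.coe_le_coe, ← not_lt,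
      lt_gridTime_iff (awayEvent_antitone h) hh, not_iff_not]
    simp only [mem_iUnion, exists_prop]
    exact exists_congr fun k => by tauto
  refine (past_sup_le_observationFiltration hN.measurable t) _ ?_
  refine (le_sup_left : past N t ≤ past N t ⊔ nullSigma P) _ ?_
  change MeasurableSet[past N t] {ω | (gridTime (awayEvent lam mu c m N p h) h M ω : ℝ≥0∞) ≤
    (t : ℝ≥0∞)}
  rw [e]
  refine MeasurableSet.compl (MeasurableSet.iUnion fun k => MeasurableSet.iUnion fun hk => ?_)
  have hle : (k * h : ℝ≥0) ≤ t := by exact_mod_cast hk.2.1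
  have hmono : past N (k * h) ≤ past N t :=
    biSup_mono fun _ hj => le_trans hj hle
  exact hmono _ (measurableSet_awayEvent hN H h k)

theorem valueFunction_neg (hp : 0 ≤ p) (hv : limV lam mu c m p < 0) :
    valueFunction P lam mu c m N hN.measurable p < 0 := by
  have hmu : 0 < mu := by linarith [H.one_lt_mu]
  have hlam := H.lam_pos
  -- The horizon is fixed first, to make the discounted tail harmless; the error constant depends on
  -- T, so the mesh is chosen afterwards.
  obtain ⟨T, hT0, hT⟩ : ∃ T : ℝ≥0, 0 < T ∧
      limV lam mu c m p + Real.exp (-lam * T) * lossBound lam mu c m < 0 := by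
    have h1 : Tendsto (fun T : ℝ => limV lam mu c m p +
        Real.exp (-lam * T) * lossBound lam mu c m) atTop
        (𝓝 (limV lam mu c m p + 0 * lossBound lam mu c m)) := by
      refine ((Real.tendsto_exp_atBot.comp ?_).mul_const _).const_add _
      exact tendsto_id.const_mul_atTop_of_neg (neg_lt_zero.2 hlam)
    rw [zero_mul, add_zero] at h1
    obtain ⟨T, hT, hT0⟩ := ((h1.eventually_lt_const hv).and (eventually_gt_atTop 0)).exists
    exact ⟨⟨T, hT0.le⟩, hT0, hT⟩
  set C : ℝ := level lam mu c +
    T * (stepConst lam mu c m * (Real.exp ((lam + 2) * T) * size p)) with hC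
  have hlim : Tendsto (fun M : ℕ => limV lam mu c m p +
      Real.exp (-lam * T) * lossBound lam mu c m + (T : ℝ) / M * C) atTop
      (𝓝 (limV lam mu c m p + Real.exp (-lam * T) * lossBound lam mu c m + 0 * C)) :=
    ((tendsto_const_div_atTop_nhds_zero_nat (T : ℝ)).mul_const C).const_add _
  rw [zero_mul, add_zero] at hlim
  obtain ⟨M₀, hM₀⟩ := exists_nat_gt ((mu + 1) * T)
  obtain ⟨M, ⟨hneg, hM⟩, hM0⟩ := (((hlim.eventually_lt_const hT).and
    (eventually_ge_atTop M₀)).and (eventually_gt_atTop 0)).exists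
  have hM0' : (0 : ℝ) < M := by exact_mod_cast hM0
  set h : ℝ≥0 := T / M with hh
  have hhr : (h : ℝ) = T / M := by simp [hh]
  have hMh : (M : ℝ≥0) * h = T := by
    rw [hh]; field_simp
  have hh0 : 0 < h := by rw [hh]; positivity
  have hh2 : (mu + 1) * h ≤ 1 := by
    rw [hhr, ← mul_div_assoc, div_le_one hM0']
    exact hM₀.le.trans (by exact_mod_cast hM)
  have hh1 : h ≤ 1 := by
    have : (h : ℝ) ≤ 1 := by
      have := h.coe_nonneg
      nlinarith
    exact_mod_cast this
  have hst := isStoppingTime_gridTime hN H (p := p) hh0 M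
  refine (iInf₂_le _ hst).trans_lt ?_
  have hreg := region_gridTime (awayEvent_antitone (lam := lam) (mu := mu) (c := c) (m := m)
    (N := N) (p := p) h) hh0 M
  have hi : IntegrableOn (discCost lam mu c m N p)
      (region fun ω => (gridTime (awayEvent lam mu c m N p h) h M ω : ℝ≥0∞)) (P.prod volume) := by
    rw [hreg]
    exact (integrable_discCost hN H hp (M * h)).mono_set (gridRegion_subset _ h M)
  rw [expectedCost_eq_integral hN H hst.measurable_ennreal hi, hreg]
  have key := setIntegral_gridRegion_le hN H hp hh1 hh2 M
  rw [hMh] at key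
  have e : level lam mu c * h + (M : ℝ) * (stepConst lam mu c m * h ^ 2 *
      (Real.exp ((lam + 2) * T) * size p)) = T / M * C := by
    rw [hC, hhr]; field_simp
  have : ∫ z in gridRegion (awayEvent lam mu c m N p h) h M, discCost lam mu c m N p z
      ∂(P.prod volume) < 0 := by linarith
  exact_mod_cast this

theorem mem_stopRegion_iff :
    p ∈ stopRegion P lam mu c m N hN.measurable ↔ 0 ≤ p ∧ limV lam mu c m p = 0 := by
  constructor
  · rintro ⟨h1, h2, h3⟩
    have hp : (0 : ℝ × ℝ) ≤ p := ⟨h1, h2⟩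
    refine ⟨hp, le_antisymm ((admissible_limV H).nonpos p) ?_⟩
    by_contra! hlt
    exact (valueFunction_neg hN H hp hlt).ne h3
  · rintro ⟨hp, hv⟩
    exact ⟨hp.1, hp.2, valueFunction_eq_zero hN H hp hv⟩

end


/-! ### The boundary of the zero set of a concave function -/

/-- A nonpositive, increasing, concave and continuous function on the quadrant that is negative
near the origin and vanishes far away. -/
structure HasBoundary (w : ℝ × ℝ → ℝ) (L M : ℝ) : Prop where
  nonpos : ∀ p, w p ≤ 0
  mono : Monotone w
  cont : Continuous w
  concave : ConcaveOn ℝ (Ici 0) w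
  neg : ∀ p, 0 ≤ p → p.1 + p.2 < L → w p < 0
  nonneg : 0 ≤ M
  zero_fst : w (M, 0) = 0
  zero_snd : w (0, M) = 0

/-- The boundary function of the zero set. -/
noncomputable def boundary (w : ℝ × ℝ → ℝ) (x : ℝ) : ℝ := sInf {y | 0 ≤ y ∧ w (x, y) = 0}

/-- The first zero on the horizontal axis. -/
noncomputable def firstZero (w : ℝ × ℝ → ℝ) : ℝ := sInf {x | 0 ≤ x ∧ w (x, 0) = 0}

/-- The zeros in [0, ∞) form a closed, upward closed, nonempty set, so their infimum is itself a
zero. -/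
theorem csInf_le_iff_of_upward {f : ℝ → ℝ} (hf : Monotone f) (hc : Continuous f)
    (hn : ∀ y, f y ≤ 0) {b : ℝ} (hb : 0 ≤ b) (hfb : f b = 0) {y : ℝ} (hy : 0 ≤ y) :
    sInf {y | 0 ≤ y ∧ f y = 0} ≤ y ↔ f y = 0 := by
  have hcl : IsClosed {y | 0 ≤ y ∧ f y = 0} :=
    isClosed_Ici.inter (isClosed_eq hc continuous_const)
  have hbd : BddBelow {y | 0 ≤ y ∧ f y = 0} := ⟨0, fun y hy => hy.1⟩
  have hmem := hcl.csInf_mem ⟨b, hb, hfb⟩ hbd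
  refine ⟨fun h => le_antisymm (hn y) ?_, fun h => csInf_le hbd ⟨hy, h⟩⟩
  rw [← hmem.2]
  exact hf h

namespace HasBoundary

variable {w : ℝ × ℝ → ℝ} {L M : ℝ} (hw : HasBoundary w L M)

include hw

theorem zero_of_le {p q : ℝ × ℝ} (h : w p = 0) (hpq : p ≤ q) : w q = 0 :=
  le_antisymm (hw.nonpos q) (h.symm.le.trans (hw.mono hpq))

theorem mono_snd (x : ℝ) : Monotone fun y => w (x, y) := fun _ _ h => hw.mono ⟨le_rfl, h⟩

theorem cont_snd (x : ℝ) : Continuous fun y => w (x, y) := hw.cont.comp (by fun_prop)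

theorem eq_zero_snd {x : ℝ} (hx : 0 ≤ x) : w (x, M) = 0 := hw.zero_of_le hw.zero_snd ⟨hx, le_rfl⟩

theorem boundary_le_iff {x y : ℝ} (hx : 0 ≤ x) (hy : 0 ≤ y) : boundary w x ≤ y ↔ w (x, y) = 0 :=
  csInf_le_iff_of_upward (hw.mono_snd x) (hw.cont_snd x) (fun _ => hw.nonpos _) hw.nonneg
    (hw.eq_zero_snd hx) hy

theorem firstZero_le_iff {x : ℝ} (hx : 0 ≤ x) : firstZero w ≤ x ↔ w (x, 0) = 0 :=
  csInf_le_iff_of_upward (f := fun x => w (x, 0)) (fun _ _ h => hw.mono ⟨h, le_rfl⟩)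
    (hw.cont.comp (by fun_prop)) (fun _ => hw.nonpos _) hw.nonneg hw.zero_fst hx

omit hw in
theorem boundary_nonneg (w : ℝ × ℝ → ℝ) (x : ℝ) : 0 ≤ boundary w x :=
  Real.sInf_nonneg fun _ hy => hy.1

omit hw in
theorem firstZero_nonneg (w : ℝ × ℝ → ℝ) : 0 ≤ firstZero w :=
  Real.sInf_nonneg fun _ hy => hy.1

theorem apply_boundary {x : ℝ} (hx : 0 ≤ x) : w (x, boundary w x) = 0 :=
  (hw.boundary_le_iff hx (boundary_nonneg w x)).1 le_rfl

theorem apply_firstZero : w (firstZero w, 0) = 0 :=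
  (hw.firstZero_le_iff (firstZero_nonneg w)).1 le_rfl

theorem boundary_antitoneOn : AntitoneOn (boundary w) (Ici 0) := fun _ hx _ hy hxy =>
  (hw.boundary_le_iff hy (boundary_nonneg w _)).2
    (hw.zero_of_le (hw.apply_boundary hx) ⟨hxy, le_rfl⟩)

/-- A nonpositive concave function vanishes on the segment joining two of its zeros; this is applied
to two boundary points. -/
theorem boundary_convexOn : ConvexOn ℝ (Ici 0) (boundary w) := by
  refine ⟨convex_Ici 0, fun x hx y hy a b ha hb hab => ?_⟩
  have hx' : (0 : ℝ) ≤ x := hx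
  have hy' : (0 : ℝ) ≤ y := hy
  have hbx := boundary_nonneg w x
  have hby := boundary_nonneg w y
  have h1 := hw.concave.2 (show ((x, boundary w x) : ℝ × ℝ) ∈ Ici 0 from ⟨hx, hbx⟩)
    (show ((y, boundary w y) : ℝ × ℝ) ∈ Ici 0 from ⟨hy, hby⟩) ha hb hab
  rw [hw.apply_boundary hx, hw.apply_boundary hy] at h1
  simp only [smul_zero, add_zero] at h1
  simp only [smul_eq_mul]
  rw [hw.boundary_le_iff (by positivity) (by positivity)]
  exact le_antisymm (hw.nonpos _) h1

/-- Convexity gives continuity in the interior only. At 0 monotonicity gives the upper bound; for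
the lower one, w(0, a) < 0 persists at nearby (y, a) and keeps the boundary above a. -/
theorem boundary_continuousOn : ContinuousOn (boundary w) (Ici 0) := by
  intro x hx
  rcases (show (0 : ℝ) ≤ x from hx).eq_or_lt with rfl | hpos
  · refine tendsto_order.2 ⟨fun a ha => ?_, fun a ha => ?_⟩
    · by_cases ha0 : a < 0
      · exact Eventually.of_forall fun y => ha0.trans_le (boundary_nonneg w y)
      · push Not at ha0
        have h1 : w (0, a) < 0 := lt_of_le_of_ne (hw.nonpos _) fun h =>
          not_lt.2 ((hw.boundary_le_iff le_rfl ha0).2 h) ha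
        have h2 : Tendsto (fun y => w (y, a)) (𝓝 0) (𝓝 (w (0, a))) :=
          (hw.cont.comp (by fun_prop : Continuous fun y : ℝ => (y, a))).tendsto 0
        filter_upwards [(h2.eventually_lt_const h1).filter_mono nhdsWithin_le_nhds,
          self_mem_nhdsWithin] with y hy hy0
        by_contra! hle
        exact hy.ne ((hw.boundary_le_iff hy0 ha0).1 hle)
    · filter_upwards [self_mem_nhdsWithin] with y hy
      exact (hw.boundary_antitoneOn (mem_Ici.2 (le_refl (0 : ℝ))) hy hy).trans_lt ha
  · have h1 := hw.boundary_convexOn.continuousOn_interior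
    rw [interior_Ici] at h1
    exact (h1.continuousAt (Ioi_mem_nhds hpos)).continuousWithinAt

theorem boundary_eq_zero {x : ℝ} (hx : firstZero w ≤ x) : boundary w x = 0 := by
  have hx0 := (firstZero_nonneg w).trans hx
  exact le_antisymm ((hw.boundary_le_iff hx0 le_rfl).2 ((hw.firstZero_le_iff hx0).1 hx))
    (boundary_nonneg w x)

theorem boundary_pos {x : ℝ} (hx0 : 0 ≤ x) (hx : x < firstZero w) : 0 < boundary w x := by
  by_contra! h
  exact not_lt.2 ((hw.firstZero_le_iff hx0).2 ((hw.boundary_le_iff hx0 le_rfl).1 h)) hx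

/-- Convexity puts the boundary below the chord from a point where it is positive to the first zero,
and this chord is strictly decreasing. -/
theorem boundary_strictAntiOn : StrictAntiOn (boundary w) (Icc 0 (firstZero w)) := by
  intro x hx y hy hxy
  have hlt : x < firstZero w := hxy.trans_le hy.2
  have hpos := hw.boundary_pos hx.1 hlt
  have hd : 0 < firstZero w - x := sub_pos.2 hlt
  have ha : 0 ≤ (firstZero w - y) / (firstZero w - x) := div_nonneg (sub_nonneg.2 hy.2) hd.le
  have ha1 : (firstZero w - y) / (firstZero w - x) < 1 := by
    rw [div_lt_one hd]; linarith
  have hb : 0 ≤ 1 - (firstZero w - y) / (firstZero w - x) := by linarith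
  have h1 := hw.boundary_convexOn.2 (show x ∈ Ici (0 : ℝ) from hx.1)
    (show firstZero w ∈ Ici (0 : ℝ) from firstZero_nonneg w) ha hb (by ring)
  have e : ((firstZero w - y) / (firstZero w - x)) • x +
      (1 - (firstZero w - y) / (firstZero w - x)) • firstZero w = y := by
    simp only [smul_eq_mul]
    field_simp
    ring
  rw [e, hw.boundary_eq_zero le_rfl, smul_zero, add_zero, smul_eq_mul] at h1
  exact h1.trans_lt (mul_lt_of_lt_one_left hpos ha1)

theorem zeroSet_eq : {p : ℝ × ℝ | 0 ≤ p.1 ∧ 0 ≤ p.2 ∧ w p = 0} =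
    quadrantEpigraph (boundary w) := by
  ext ⟨x, y⟩
  simp only [quadrantEpigraph, mem_ofPred_eq]
  refine and_congr_right fun hx => and_congr_right fun hy => ?_
  exact (hw.boundary_le_iff hx hy).symm

theorem le_boundary_zero : L ≤ boundary w 0 := by
  by_contra! h
  refine (hw.neg (0, boundary w 0) ⟨le_rfl, boundary_nonneg w 0⟩ (by simpa using h)).ne
    (hw.apply_boundary le_rfl)

theorem le_firstZero : L ≤ firstZero w := by
  by_contra! h
  exact (hw.neg (firstZero w, 0) ⟨firstZero_nonneg w, le_rfl⟩ (by simpa using h)).ne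
    hw.apply_firstZero

theorem boundary_zero_le : boundary w 0 ≤ M := (hw.boundary_le_iff le_rfl hw.nonneg).2 hw.zero_snd

theorem firstZero_le : firstZero w ≤ M := (hw.firstZero_le_iff hw.nonneg).2 hw.zero_fst

theorem boundary_mono {w' : ℝ × ℝ → ℝ} (hw' : HasBoundary w' L M) (h : ∀ p, 0 ≤ p → w' p ≤ w p)
    {x : ℝ} (hx : 0 ≤ x) : boundary w x ≤ boundary w' x := by
  refine (hw.boundary_le_iff hx (boundary_nonneg w' x)).2 (le_antisymm (hw.nonpos _) ?_)
  rw [← hw'.apply_boundary hx]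
  exact h _ ⟨hx, boundary_nonneg w' x⟩

theorem firstZero_mono {w' : ℝ × ℝ → ℝ} (hw' : HasBoundary w' L M)
    (h : ∀ p, 0 ≤ p → w' p ≤ w p) : firstZero w ≤ firstZero w' := by
  refine (hw.firstZero_le_iff (firstZero_nonneg w')).2 (le_antisymm (hw.nonpos _)
    (hw'.apply_firstZero.symm.le.trans (h (firstZero w', 0) ⟨firstZero_nonneg w', le_rfl⟩)))

end HasBoundary

/-- If l is the supremum of the boundaries at x, every v_n with n ≥ 1 vanishes at (x, l), hence so
does the limit w, and its boundary is at most l. Indices are shifted by one because nothing is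
assumed on the boundary of `v 0`. -/
theorem tendsto_boundary {w : ℝ × ℝ → ℝ} {L M : ℝ} (hw : HasBoundary w L M)
    {v : ℕ → ℝ × ℝ → ℝ} (hv : ∀ n, 1 ≤ n → HasBoundary (v n) L M) (hanti : Antitone v)
    (hlim : ∀ p, 0 ≤ p → Tendsto (fun n => v n p) atTop (𝓝 (w p))) {x : ℝ} (hx : 0 ≤ x) :
    Tendsto (fun n => boundary (v n) x) atTop (𝓝 (boundary w x)) := by
  have hle : ∀ n p, 0 ≤ p → w p ≤ v n p := fun n p hp =>
    Antitone.le_of_tendsto (fun i j hij => hanti hij p) (hlim p hp) n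
  have hmono : Monotone fun n => boundary (v (n + 1)) x := fun i j hij =>
    (hv (i + 1) (by omega)).boundary_mono (hv (j + 1) (by omega))
      (fun p _ => hanti (by omega : i + 1 ≤ j + 1) p) hx
  have hbd : ∀ n, boundary (v (n + 1)) x ≤ boundary w x := fun n =>
    (hv (n + 1) (by omega)).boundary_mono hw (hle (n + 1)) hx
  rw [← tendsto_add_atTop_iff_nat 1]
  have ht := tendsto_atTop_ciSup hmono ⟨_, by rintro _ ⟨n, rfl⟩; exact hbd n⟩
  set l := ⨆ n, boundary (v (n + 1)) x with hl
  have hnl : ∀ n, boundary (v (n + 1)) x ≤ l := fun n => hmono.ge_of_tendsto ht n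
  have hl0 : 0 ≤ l := (HasBoundary.boundary_nonneg _ _).trans (hnl 0)
  have hzero : ∀ n, v (n + 1) (x, l) = 0 := fun n =>
    ((hv (n + 1) (by omega)).boundary_le_iff hx hl0).1 (hnl n)
  have hw0 : w (x, l) = 0 := by
    have h1 := (tendsto_add_atTop_iff_nat 1).2 (hlim (x, l) ⟨hx, hl0⟩)
    simp only [hzero] at h1
    exact tendsto_nhds_unique h1 tendsto_const_nhds
  have : l = boundary w x := le_antisymm (ciSup_le hbd) ((hw.boundary_le_iff hx hl0).2 hw0)
  rwa [← this]


/-! ### The bound `ξ*` -/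

section

variable {lam mu c m : ℝ} (H : Params lam mu c m)

/-- Under the sign condition the trajectory is convex in time and lies above its tangent at 0.
Negative u matter, as the trajectory is also followed backwards from the point of tangency. -/
theorem flowX_tangent {lam : ℝ} (hlam : 0 < lam) {m x : ℝ} (hx : 0 ≤ (lam + 1) * x + driftX lam m)
    (u : ℝ) : x + ((lam + 1) * x + driftX lam m) * u ≤ flowX lam m u x := by
  have h1 := mul_expInt (lam + 1) u
  have h2 := Real.add_one_le_exp ((lam + 1) * u)
  have h3 : u ≤ expInt (lam + 1) u :=
    le_of_mul_le_mul_left (by linarith : (lam + 1) * u ≤ (lam + 1) * expInt (lam + 1) u)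
      (by linarith)
  have h4 := mul_le_mul_of_nonneg_left h3 hx
  have h5 : Real.exp ((lam + 1) * u) = 1 + (lam + 1) * expInt (lam + 1) u := by linarith
  rw [flowX_eq hlam, h5]
  linarith

/-- For λ < 1 convexity in time needs the opposite sign: y'' = (λ - 1) y' ≥ 0 when y' ≤ 0. -/
theorem flowY_tangent {lam : ℝ} (hlam : lam < 1) {m y : ℝ}
    (hy : (lam - 1) * y + driftY lam m ≤ 0) (u : ℝ) :
    y + ((lam - 1) * y + driftY lam m) * u ≤ flowY lam m u y := by
  have h1 := mul_expInt (lam - 1) u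
  have h2 := Real.add_one_le_exp ((lam - 1) * u)
  have h3 : expInt (lam - 1) u ≤ u := by
    have : (1 - lam) * expInt (lam - 1) u ≤ (1 - lam) * u := by linarith
    exact le_of_mul_le_mul_left this (by linarith)
  have h4 := mul_le_mul_of_nonpos_left h3 hy
  have h5 : Real.exp ((lam - 1) * u) = 1 + (lam - 1) * expInt (lam - 1) u := by linarith
  rw [flowY_eq, h5]
  linarith

include H

theorem flowX_neg_tStar (h0 : 0 < phiStar₀ lam mu c) :
    flowX lam m (-tStar lam mu c m) (phiStar₀ lam mu c) = 0 := by
  have hlam := H.lam_pos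
  have hm : 0 < 1 - m := by linarith [H.m_mem.2]
  have hs : 0 < √2 := by positivity
  unfold flowX tStar
  set x := phiStar₀ lam mu c
  have hpos : 0 < 1 + x * (√2 * (lam + 1)) / (lam * (1 - m)) := by positivity
  have e : (lam + 1) * -(Real.log (1 + x * (√2 * (lam + 1)) / (lam * (1 - m))) / (lam + 1)) =
      -Real.log (1 + x * (√2 * (lam + 1)) / (lam * (1 - m))) := by
    field_simp
  rw [e, Real.exp_neg, Real.exp_log hpos]
  have hne := hpos.ne'
  field_simp
  ring

/-- The flow from `(0, ξ*)` stays in the region `{x + y ≥ (λ + μ) √2 / c}`. -/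
theorem level_le_flow_xiStar_of_lt (hlam1 : lam < 1) {s : ℝ} (hs : 0 ≤ s) :
    level lam mu c ≤ flowX lam m s 0 + flowY lam m s (xiStar lam mu c m) := by
  have hlam := H.lam_pos
  have hr : 0 < √2 := by positivity
  have hl : 0 < 1 - lam := by linarith
  have hdX := driftX_pos hlam H.m_mem
  have hdY := driftY_pos hlam H.m_mem
  have hd := driftX_add_driftY lam m
  unfold xiStar
  split_ifs with hcase
  · have hK : lam * √2 < (1 - lam) * level lam mu c := by
      have h1 := mul_lt_mul_of_pos_right ((div_lt_iff₀ hl).1 hcase.2) hr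
      unfold level
      linarith
    have hp0 : 0 < phiStar₀ lam mu c := by
      unfold phiStar₀; unfold level at hK; linarith
    have e0 : 2 * phiStar₀ lam mu c = (1 - lam) * level lam mu c - lam * √2 := by
      unfold phiStar₀ level; ring
    have e1 : phiStar₁ lam mu c = level lam mu c - phiStar₀ lam mu c := rfl
    have hz := flowX_neg_tStar H hp0
    set t := tStar lam mu c m
    -- The trajectory from (0, ξ*) passes through (φ₀*, φ₁*) at time t*, so its position at time s
    -- is reached from there in time s - t*.
    have a1 : flowX lam m s 0 = flowX lam m (s + -t) (phiStar₀ lam mu c) := by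
      rw [flowX_add, hz]
    rw [a1, ← flowY_add]
    have b1 := flowX_tangent hlam (m := m) (x := phiStar₀ lam mu c) (by positivity) (s + -t)
    have b2 := flowY_tangent hlam1 (m := m) (y := phiStar₁ lam mu c) (by
      rw [e1]; nlinarith) (s + -t)
    -- On the first of the two lines the time derivative of x + y is zero: the tangent slopes
    -- cancel, and x + y never falls below its value at (φ₀*, φ₁*), which is `level`.
    have b3 : ((lam + 1) * phiStar₀ lam mu c + driftX lam m) +
        ((lam - 1) * phiStar₁ lam mu c + driftY lam m) = 0 := by
      rw [e1]; linear_combination hd + e0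
    have b4 : ((lam + 1) * phiStar₀ lam mu c + driftX lam m) * (s + -t) +
        ((lam - 1) * phiStar₁ lam mu c + driftY lam m) * (s + -t) = 0 := by
      rw [← add_mul, b3, zero_mul]
    linarith
  -- Here the derivative of x + y at (0, `level`), equal to λ√2 - (1 - λ) `level`, is already
  -- nonnegative.
  · have hK : (1 - lam) * level lam mu c ≤ lam * √2 := by
      have h0 : (lam + mu) / c ≤ lam / (1 - lam) := by
        by_contra! h; exact hcase ⟨hlam1, h⟩
      have h1 := mul_le_mul_of_nonneg_right ((le_div_iff₀ hl).1 h0) hr.le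
      unfold level
      linarith
    change level lam mu c ≤ flowX lam m s 0 + flowY lam m s (level lam mu c)
    rw [flowX_eq hlam, flowY_eq, mul_zero, zero_add]
    have h1 : expInt (lam - 1) s ≤ expInt (lam + 1) s := expInt_mono_left (by linarith) hs
    have h2 := mul_le_mul_of_nonneg_left h1 hdX.le
    have h3 := mul_expInt (lam - 1) s
    have h4 := expInt_nonneg (α := lam - 1) hs
    have h5 := mul_le_mul_of_nonneg_right hK h4
    have h6 : Real.exp ((lam - 1) * s) * level lam mu c =
        level lam mu c - (1 - lam) * level lam mu c * expInt (lam - 1) s := by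
      linear_combination -(level lam mu c) * h3
    have h7 : lam * √2 * expInt (lam - 1) s =
      driftX lam m * expInt (lam - 1) s + driftY lam m * expInt (lam - 1) s := by rw [← hd]; ring
    linarith

theorem level_le_xiStar : level lam mu c ≤ xiStar lam mu c m := by
  rcases lt_or_ge lam 1 with h | h
  · have h1 := level_le_flow_xiStar_of_lt H h le_rfl
    have h2 := congrArg Prod.fst (flow_zero (lam := lam) (m := m) (0, xiStar lam mu c m))
    have h3 := congrArg Prod.snd (flow_zero (lam := lam) (m := m) (0, xiStar lam mu c m))
    simp only [flow] at h2 h3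
    rw [h2, h3] at h1
    linarith
  · rw [xiStar, if_neg fun h' => not_lt.2 h h'.1]
    rfl

/-- A bound for the zeros of the value function on the axes that is smaller than `ξ*`. -/
noncomputable def zeroBound (lam mu c m : ℝ) : ℝ :=
  max 0 (xiStar lam mu c m - mu * (√2 / c - lossBound lam mu c m))

theorem zeroBound_lt : zeroBound lam mu c m < xiStar lam mu c m := by
  have h1 := lossBound_lt H
  have h2 := level_pos H
  have h3 := level_le_xiStar H
  have h4 : 0 < mu * (√2 / c - lossBound lam mu c m) :=
    mul_pos (by linarith [H.one_lt_mu]) (by linarith)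
  exact max_lt (by linarith) (by linarith)

/-- For λ < 1, lowering the start from ξ* by δ lowers the flow by e^{(λ-1)s} δ ≤ δ. For λ ≥ 1 the
flow from (0, y) with y ≥ 0 never falls below the initial sum, so the bound at the start suffices.
-/
theorem level_le_flow_zeroBound_snd {s : ℝ} (hs : 0 ≤ s) :
    level lam mu c - mu * (√2 / c - lossBound lam mu c m) ≤
      flowX lam m s 0 + flowY lam m s (zeroBound lam mu c m) := by
  have hlam := H.lam_pos
  have hdX := driftX_pos hlam H.m_mem
  have hdY := driftY_pos hlam H.m_mem
  have hb : xiStar lam mu c m - mu * (√2 / c - lossBound lam mu c m) ≤ zeroBound lam mu c m :=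
    le_max_right _ _
  have hb0 : 0 ≤ zeroBound lam mu c m := le_max_left _ _
  have hlt := zeroBound_lt H
  rcases lt_or_ge lam 1 with h | h
  · have h1 := level_le_flow_xiStar_of_lt H h hs
    have h2 : Real.exp ((lam - 1) * s) ≤ 1 := Real.exp_le_one_iff.2 (by nlinarith)
    have h3 := mul_le_mul_of_nonneg_right h2 (sub_nonneg.2 hlt.le)
    have h4 : flowY lam m s (xiStar lam mu c m) - flowY lam m s (zeroBound lam mu c m) =
        Real.exp ((lam - 1) * s) * (xiStar lam mu c m - zeroBound lam mu c m) := by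
      rw [flowY_eq, flowY_eq]; ring
    linarith
  · have h1 := level_le_xiStar H
    have h2 : 1 ≤ Real.exp ((lam - 1) * s) := Real.one_le_exp (mul_nonneg (by linarith) hs)
    have h3 := mul_le_mul_of_nonneg_right h2 hb0
    have h4 := mul_nonneg hdX.le (expInt_nonneg (α := lam + 1) hs)
    have h5 := mul_nonneg hdY.le (expInt_nonneg (α := lam - 1) hs)
    rw [flowX_eq hlam, flowY_eq, mul_zero, zero_add]
    linarith

/-- The same initial amount grows by e^{(λ+1)s} in the first coordinate and only by e^{(λ-1)s} in
the second, so the horizontal axis follows from the vertical one. -/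
theorem level_le_flow_zeroBound_fst {s : ℝ} (hs : 0 ≤ s) :
    level lam mu c - mu * (√2 / c - lossBound lam mu c m) ≤
      flowX lam m s (zeroBound lam mu c m) + flowY lam m s 0 := by
  refine (level_le_flow_zeroBound_snd H hs).trans ?_
  have hb0 : 0 ≤ zeroBound lam mu c m := le_max_left _ _
  have h1 : Real.exp ((lam - 1) * s) ≤ Real.exp ((lam + 1) * s) :=
    Real.exp_le_exp.2 (by nlinarith)
  have h2 := mul_le_mul_of_nonneg_right h1 hb0
  rw [flowX_eq H.lam_pos, flowX_eq H.lam_pos, flowY_eq, flowY_eq]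
  linarith

theorem hasBoundary_detJ₀ {w : ℝ × ℝ → ℝ} (hw : Admissible lam mu c m w) :
    HasBoundary (detJ₀ lam mu c m w) (lam / c * √2) (zeroBound lam mu c m) := by
  have ha := admissible_detJ₀ H hw
  have hb0 : 0 ≤ zeroBound lam mu c m := le_max_left _ _
  exact
    { nonpos := ha.nonpos
      mono := ha.mono
      cont := ha.continuous H
      concave := ha.concave
      neg := fun p hp hlt => detJ₀_neg H hw hp hlt
      nonneg := hb0
      zero_fst := detJ₀_eq_zero H hw ⟨hb0, le_rfl⟩ fun s hs => level_le_flow_zeroBound_fst H hs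
      zero_snd := detJ₀_eq_zero H hw ⟨le_rfl, hb0⟩ fun s hs => level_le_flow_zeroBound_snd H hs }

theorem hasBoundary_detV {n : ℕ} (hn : 1 ≤ n) :
    HasBoundary (detV lam mu c m n) (lam / c * √2) (zeroBound lam mu c m) := by
  obtain ⟨k, rfl⟩ := Nat.exists_eq_add_of_le' hn
  exact hasBoundary_detJ₀ H (admissible_detV H k)

/-- The fixed-point equation writes `limV` as a `detJ₀`, so it has the same `zeroBound` as every
iterate, and the strict inequality with ξ* is not lost in the limit. -/
theorem hasBoundary_limV :
    HasBoundary (limV lam mu c m) (lam / c * √2) (zeroBound lam mu c m) := by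
  have h := hasBoundary_detJ₀ H (admissible_limV H)
  rwa [funext fun p => detJ₀_limV H p] at h

end

end PoissonDisorder

theorem proposition8p1 {Ω : Type*} [MeasurableSpace Ω] (P : Measure Ω) [IsProbabilityMeasure P]
    (lam mu c m : ℝ) (hlam : 0 < lam) (hmu : 1 < mu) (hc : 0 < c) (hm : m ∈ Ioo (-1 : ℝ) 1)
    (N : ℝ≥0 → Ω → ℕ) (hN : PoissonDisorder.IsPoissonProcess N mu P) :
    ∃ (γn : ℕ → ℝ → ℝ) (γ : ℝ → ℝ) (ξn : ℕ → ℝ) (ξ : ℝ),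
      -- regularity of the boundary functions on `[0, ∞)`
      (∀ n, 1 ≤ n → (∀ x, 0 ≤ x → 0 ≤ γn n x) ∧ AntitoneOn (γn n) (Ici 0) ∧
        ConvexOn ℝ (Ici 0) (γn n) ∧ ContinuousOn (γn n) (Ici 0)) ∧
      ((∀ x, 0 ≤ x → 0 ≤ γ x) ∧ AntitoneOn γ (Ici 0) ∧
        ConvexOn ℝ (Ici 0) γ ∧ ContinuousOn γ (Ici 0)) ∧
      -- the stopping regions are their epigraphs
      (∀ n, 1 ≤ n → PoissonDisorder.stopRegionN P lam mu c m N n =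
        PoissonDisorder.quadrantEpigraph (γn n)) ∧
      PoissonDisorder.stopRegion P lam mu c m N hN.measurable =
        PoissonDisorder.quadrantEpigraph γ ∧
      -- the boundary functions increase to `γ`
      (∀ x, 0 ≤ x → (∀ n, 1 ≤ n → γn n x ≤ γn (n + 1) x) ∧
        Tendsto (fun n => γn n x) atTop (𝓝 (γ x))) ∧
      -- the first zeros
      lam / c * √2 ≤ ξn 1 ∧ (∀ n, 1 ≤ n → ξn n ≤ ξn (n + 1)) ∧ (∀ n, 1 ≤ n → ξn n ≤ ξ) ∧
      ξ < PoissonDisorder.xiStar lam mu c m ∧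
      (∀ n, 1 ≤ n → StrictAntiOn (γn n) (Icc 0 (ξn n)) ∧ ∀ x, ξn n ≤ x → γn n x = 0) ∧
      (StrictAntiOn γ (Icc 0 ξ) ∧ ∀ x, ξ ≤ x → γ x = 0) ∧
      -- the values at zero
      lam / c * √2 ≤ γn 1 0 ∧ (∀ n, 1 ≤ n → γn n 0 ≤ γn (n + 1) 0) ∧
      (∀ n, 1 ≤ n → γn n 0 ≤ γ 0) ∧ γ 0 < PoissonDisorder.xiStar lam mu c m := by
  have H : PoissonDisorder.Params lam mu c m := ⟨hlam, hmu, hc, hm⟩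
  have hB := fun n (hn : 1 ≤ n) => PoissonDisorder.hasBoundary_detV H hn
  have hV := PoissonDisorder.hasBoundary_limV H
  have hsucc : ∀ n, ∀ p, 0 ≤ p → PoissonDisorder.detV lam mu c m (n + 1) p ≤
      PoissonDisorder.detV lam mu c m n p := fun n p _ => PoissonDisorder.detV_succ_le H n p
  have hle : ∀ n, ∀ p, 0 ≤ p → PoissonDisorder.limV lam mu c m p ≤
      PoissonDisorder.detV lam mu c m n p := fun n p _ => PoissonDisorder.limV_le H n p
  have hlt := PoissonDisorder.zeroBound_lt H
  have hstep : ∀ x, 0 ≤ x → ∀ n, 1 ≤ n →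
      PoissonDisorder.boundary (PoissonDisorder.detV lam mu c m n) x ≤
        PoissonDisorder.boundary (PoissonDisorder.detV lam mu c m (n + 1)) x :=
    fun x hx n hn => (hB n hn).boundary_mono (hB (n + 1) n.succ_pos) (hsucc n) hx
  refine ⟨fun n => PoissonDisorder.boundary (PoissonDisorder.detV lam mu c m n),
    PoissonDisorder.boundary (PoissonDisorder.limV lam mu c m),
    fun n => PoissonDisorder.firstZero (PoissonDisorder.detV lam mu c m n),
    PoissonDisorder.firstZero (PoissonDisorder.limV lam mu c m),
    fun n hn => ⟨fun x _ => PoissonDisorder.HasBoundary.boundary_nonneg _ x,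
      (hB n hn).boundary_antitoneOn, (hB n hn).boundary_convexOn, (hB n hn).boundary_continuousOn⟩,
    ⟨fun x _ => PoissonDisorder.HasBoundary.boundary_nonneg _ x,
      hV.boundary_antitoneOn, hV.boundary_convexOn, hV.boundary_continuousOn⟩,
    fun n hn => ?_, ?_, fun x hx => ⟨hstep x hx, ?_⟩,
    (hB 1 le_rfl).le_firstZero,
    fun n hn => (hB n hn).firstZero_mono (hB (n + 1) n.succ_pos) (hsucc n),
    fun n hn => (hB n hn).firstZero_mono hV (hle n), hV.firstZero_le.trans_lt hlt,
    fun n hn => ⟨(hB n hn).boundary_strictAntiOn, fun x hx => (hB n hn).boundary_eq_zero hx⟩,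
    ⟨hV.boundary_strictAntiOn, fun x hx => hV.boundary_eq_zero hx⟩,
    (hB 1 le_rfl).le_boundary_zero, hstep 0 le_rfl,
    fun n hn => (hB n hn).boundary_mono hV (hle n) le_rfl, hV.boundary_zero_le.trans_lt hlt⟩
  · rw [← (hB n hn).zeroSet_eq]
    ext p
    refine and_congr_right fun h1 => and_congr_right fun h2 => ?_
    rw [PoissonDisorder.iterV_eq_detV hN H n (show (0 : ℝ × ℝ) ≤ p from ⟨h1, h2⟩)]
  · rw [← hV.zeroSet_eq]
    ext p
    rw [PoissonDisorder.mem_stopRegion_iff hN H]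
    exact ⟨fun h => ⟨h.1.1, h.1.2, h.2⟩, fun h => ⟨⟨h.1, h.2.1⟩, h.2.2⟩⟩
  · exact PoissonDisorder.tendsto_boundary hV hB
      (antitone_nat_of_succ_le fun n p => PoissonDisorder.detV_succ_le H n p)
      (fun p _ => PoissonDisorder.tendsto_detV H p) hx
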